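/- Let $(M,\boldsymbol c)$ be a conformal manifold of Riemannian signature and dimension $d\ge 3$, and let $\Sigma\subset M$ be a smoothly embedded hypersurface with a conformal unit defining density $\bar\sigma$: a section of $\mathcal E[1]$ whose zero locus is $\Sigma$, with $\nabla\bar\sigma$ nowhere zero along $\Sigma$, such that $$\bar I^2 := h_{AB}\bar I^A\bar I^B = 1+\bar\sigma^d B,\qquad \bar I^A:=\widehat D^A\bar\sigma ,$$ for some smooth $B\in\Gamma(\mathcal E[-d])$. Let $\mathcal B:=B|_\Sigma$ be the obstruction density. Notation: $h$ is the tractor metric and $X^A$ the canonical tractor. On tractors of weight $w$, in a scale $g\in\boldsymbol c$, the Thomas operator is $$D^A=\big((d+2w-2)w,\ (d+2w-2)\nabla_a,\ -(\Delta+w\mathrm J)\big),\qquad \mathrm J=\frac{\mathrm{Sc}}{2(d-1)},\qquad \widehat D^A=\frac{1}{d+2w-2}D^A ,$$ where $\nabla$ is the coupled Levi-Civita–tractor connection. Let $\bar I\cdot D=\bar I_AD^A$. Let $N^A$ be a smooth weight $0$ tractor field which is an arbitrary extension of the normal tractor, i.e. in each scale $N^A|_\Sigma=(0,\hat n_a,-H)$,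 with $\hat n=\nabla\bar\sigma/|\nabla\bar\sigma|$ the unit conormal and $H$ the mean curvature (the trace of $\nabla^\top_a\hat n_b$ divided by $d-1$). Put $$P^{AB}:=\widehat D^A\bar I^B,\qquad K_{\rm ext}:=P_{AB}P^{AB},\qquad \mathsf P_{d-1}N^B:=\Big(-\frac1{\bar I^2}\,\bar I\cdot D\Big)^{d-1}N^B .$$ Let $\Sigma^A_B=\delta^A_B-N^AN_B$ along $\Sigma$ be the orthogonal projection onto $N^\perp\subset\mathcal T M|_\Sigma$, followed by the canonical isomorphism $N^\perp\cong\mathcal T\Sigma$ given in a scale by $(v^+,v_a,v^-)\mapsto(v^+,\,v_a-\hat n_aHv^+,\,v^-+\tfrac12H^2v^+)$, and let $\bar D_A$ be the intrinsic Thomas operator of $\Sigma$ with its induced conformal structure. (For $d=3$, where $\dim\Sigma=2$, the contraction $\bar D_AV^A$ involves the Schouten tensor of $\Sigma$ only through its trace $\bar{\mathrm J}=\tfrac12\overline{\mathrm{Sc}}$, so it is well defined.) Then, along $\Sigma$, $$\mathcal B=\frac{2}{d!\,(d-1)!}\ \bar D_A\Big[\Sigma^A_B\Big(\mathsf P_{d-1}N^B+(-1)^{d-2}\,(\bar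 I\cdot D)^{d-2}\big(X^BK_{\rm ext}\big)\Big)\Big|_\Sigma\Big].$$ -/

import Mathlib

open scoped Manifold ContDiff

noncomputable section

namespace ConformalHypersurface

/-! ## Riemannian geometry and tractor calculus in a coordinate domain

A metric is given by its component matrix `G x = (g_ab(x))`, a density by the function that
represents it in the scale `g`, a tractor by its components `(σ, μ_a, ρ)` in the splitting
determined by `g`. All operators are local, so that only the values of the fields near a point
matter. -/

/-- Coordinate space of dimension `n`. -/
abbrev Coord (n : ℕ) := EuclideanSpace ℝ (Fin n)

/-- The components of a symmetric 2-tensor field, for instance of a metric. -/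
abbrev MetricField (n : ℕ) := Coord n → Matrix (Fin n) (Fin n) ℝ

/-- Values `(σ, μ_a, ρ)` in `V ⊗ (tractor bundle)`, split by a metric. -/
abbrev Tri (n : ℕ) (V : Type*) := V × (Fin n → V) × V

/-- An operation of the type of a covariant derivative: `nab f a x` is `(∇_a f)(x)`. -/
abbrev Deriv (n : ℕ) (V : Type*) := (Coord n → V) → Fin n → Coord n → V

/-- The partial derivative `∂_a f`. On densities, written in the scale `g`, this is also the
Levi-Civita derivative, since `g` is parallel. -/
def pd {n : ℕ} {V : Type*} [NormedAddCommGroup V] [NormedSpace ℝ V] : Deriv n V :=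
  fun f a x => fderiv ℝ f x (EuclideanSpace.single a 1)

/-- Christoffel symbols `Γ^c_ab` of the Levi-Civita connection. -/
def christoffel {n : ℕ} (G : MetricField n) (c a b : Fin n) (x : Coord n) : ℝ :=
  (1 / 2) * ∑ e, (G x)⁻¹ c e *
    (pd (fun y => G y b e) a x + pd (fun y => G y a e) b x - pd (fun y => G y a b) e x)

/-- The curvature `R_ab^c_e`, where `R(u,v)w = ∇_u ∇_v w - ∇_v ∇_u w - ∇_[u,v] w` has the
components `u^a v^b w^e R_ab^c_e`. -/
def riemann {n : ℕ} (G : MetricField n) (a b c e : Fin n) (x : Coord n) : ℝ :=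
  pd (christoffel G c b e) a x - pd (christoffel G c a e) b x
    + ∑ f, (christoffel G c a f x * christoffel G f b e x
      - christoffel G c b f x * christoffel G f a e x)

/-- `Ric_ab = R_ca^c_b`. -/
def ricci {n : ℕ} (G : MetricField n) (a b : Fin n) (x : Coord n) : ℝ :=
  ∑ c, riemann G c a c b x

/-- The scalar curvature. -/
def scalarCurv {n : ℕ} (G : MetricField n) (x : Coord n) : ℝ :=
  ∑ a, ∑ b, (G x)⁻¹ a b * ricci G a b x

/-- `J = Sc / (2 (n - 1))`, for `n ≥ 2`. -/
def schoutenTrace {n : ℕ} (G : MetricField n) (x : Coord n) : ℝ :=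
  scalarCurv G x / (2 * ((n : ℝ) - 1))

/-- The Schouten tensor `P_ab`, determined for `n ≥ 3` by `Ric_ab = (n - 2) P_ab + J g_ab`.
For `n = 2` this equation and `P_a^a = J` only fix the trace part; the trace-free part is then
taken to be zero. (A metric of dimension 2 occurs below only on surfaces `Σ`, inside
`D̄_A V^A`, where nothing but the trace `J` of `P` enters.) -/
def schouten {n : ℕ} (G : MetricField n) (a b : Fin n) (x : Coord n) : ℝ :=
  if n = 2 then schoutenTrace G x / 2 * G x a b
  else (ricci G a b x - schoutenTrace G x * G x a b) / ((n : ℝ) - 2)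

/-- Contraction `h_AB S^A T^B` with the tractor metric `h` at a point with metric matrix `g`, for
tractors with coefficients in `U` and `V`, the coefficients being combined by `β`. -/
def contract {n : ℕ} {U V W : Type*} [AddCommGroup W] [Module ℝ W]
    (g : Matrix (Fin n) (Fin n) ℝ) (β : U → V → W) (S : Tri n U) (T : Tri n V) : W :=
  β S.1 T.2.2 + ∑ a, ∑ b, g⁻¹ a b • β (S.2.1 a) (T.2.1 b) + β S.2.2 T.1

/-- The tractor metric `h(S, T) = σ κ + g^ab μ_a ν_b + ρ τ`. -/
def tractorMetric {n : ℕ} (g : Matrix (Fin n) (Fin n) ℝ) (S T : Tri n ℝ) : ℝ :=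
  contract g (fun s t => s * t) S T

/-- The trace `h_AB Q^AB` of a tractor with two indices. -/
def tractorTrace {n : ℕ} (g : Matrix (Fin n) (Fin n) ℝ) (Q : Tri n (Tri n ℝ)) : ℝ :=
  Q.1.2.2 + ∑ a, ∑ b, g⁻¹ a b * (Q.2.1 a).2.1 b + Q.2.2.1

/-- The tractor connection (coupled to the Levi-Civita connection on weights):
`∇_a (σ, μ_b, ρ) = (∇_a σ - μ_a, ∇_a μ_b + g_ab ρ + P_ab σ, ∇_a ρ - P_ac μ^c)`. -/
def tractorNabla {n : ℕ} (G : MetricField n) : Deriv n (Tri n ℝ) := fun T a x =>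
  (pd (fun y => (T y).1) a x - (T x).2.1 a,
   fun b => pd (fun y => (T y).2.1 b) a x - ∑ c, christoffel G c a b x * (T x).2.1 c
      + G x a b * (T x).2.2 + schouten G a b x * (T x).1,
   pd (fun y => (T y).2.2) a x - ∑ c, ∑ e, schouten G a c x * (G x)⁻¹ c e * (T x).2.1 e)

/-- The Laplacian `Δ f = g^ab ∇_a ∇_b f`, the outer derivative being coupled to the Levi-Civita
connection on the index `b`. -/
def laplacian {n : ℕ} {V : Type*} [AddCommGroup V] [Module ℝ V]
    (G : MetricField n) (nab : Deriv n V) (f : Coord n → V) (x : Coord n) : V :=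
  ∑ a, ∑ b, (G x)⁻¹ a b •
    (nab (fun y => nab f b y) a x - ∑ c, christoffel G c a b x • nab f c x)

/-- The Thomas operator on (tractor valued) densities of weight `w`:
`D^A f = (w (n + 2 w - 2) f, (n + 2 w - 2) ∇_a f, -(Δ + w J) f)`. -/
def thomasD {n : ℕ} {V : Type*} [AddCommGroup V] [Module ℝ V]
    (G : MetricField n) (nab : Deriv n V) (w : ℝ) (f : Coord n → V) (x : Coord n) : Tri n V :=
  ((w * (n + 2 * w - 2)) • f x,
   fun a => ((n : ℝ) + 2 * w - 2) • nab f a x,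
   -(laplacian G nab f x + (w * schoutenTrace G x) • f x))

/-- `D̂^A = (n + 2 w - 2)⁻¹ D^A`, for `w ≠ 1 - n / 2`. -/
def thomasDHat {n : ℕ} {V : Type*} [AddCommGroup V] [Module ℝ V]
    (G : MetricField n) (nab : Deriv n V) (w : ℝ) (f : Coord n → V) (x : Coord n) : Tri n V :=
  ((n : ℝ) + 2 * w - 2)⁻¹ • thomasD G nab w f x

/-- The scale tractor `I^A = D̂^A σ` of a density `σ` of weight 1. -/
def scaleTractor {n : ℕ} (G : MetricField n) (s : Coord n → ℝ) (x : Coord n) : Tri n ℝ :=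
  thomasDHat G pd 1 s x

/-- `I² = h_AB I^A I^B`. -/
def scaleTractorSq {n : ℕ} (G : MetricField n) (s : Coord n → ℝ) (x : Coord n) : ℝ :=
  tractorMetric (G x) (scaleTractor G s x) (scaleTractor G s x)

/-- The Laplace–Robin operator `I·D = I_A D^A` on tractors `T^B` of weight `w`. -/
def laplaceRobin {n : ℕ} (G : MetricField n) (s : Coord n → ℝ) (w : ℝ)
    (T : Coord n → Tri n ℝ) (x : Coord n) : Tri n ℝ :=
  contract (G x) (fun (r : ℝ) (t : Tri n ℝ) => r • t)
    (scaleTractor G s x) (thomasD G (tractorNabla G) w T x)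

/-- The power `(I·D)^k` on tractors `T^B` of weight `w`. Each factor lowers the weight by 1. -/
def laplaceRobinPow {n : ℕ} (G : MetricField n) (s : Coord n → ℝ) :
    ℕ → ℝ → (Coord n → Tri n ℝ) → Coord n → Tri n ℝ
  | 0, _, T => T
  | k + 1, w, T => laplaceRobinPow G s k (w - 1) (laplaceRobin G s w T)

/-- The power `(-I⁻² I·D)^k` on tractors `T^B` of weight `w`. -/
def yPow {n : ℕ} (G : MetricField n) (s : Coord n → ℝ) :
    ℕ → ℝ → (Coord n → Tri n ℝ) → Coord n → Tri n ℝ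
  | 0, _, T => T
  | k + 1, w, T => yPow G s k (w - 1)
      (fun x => (-(1 / scaleTractorSq G s x)) • laplaceRobin G s w T x)

/-- The operator `(-I⁻² I·D)^k` on tractors of weight `(k - n + 1) / 2`. Its restriction to the
zero locus of `σ` is the extrinsic conformal Laplacian `P_k`. -/
def extrinsicLaplacian {n : ℕ} (G : MetricField n) (s : Coord n → ℝ) (k : ℕ)
    (T : Coord n → Tri n ℝ) : Coord n → Tri n ℝ :=
  yPow G s k (((k : ℝ) - n + 1) / 2) T

/-- `P^AB = D̂^A I^B`. -/
def scaleTractorDeriv {n : ℕ} (G : MetricField n) (s : Coord n → ℝ) (x : Coord n) :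
    Tri n (Tri n ℝ) :=
  thomasDHat G (tractorNabla G) 0 (scaleTractor G s) x

/-- `K_ext = P_AB P^AB`. -/
def kExt {n : ℕ} (G : MetricField n) (s : Coord n → ℝ) (x : Coord n) : ℝ :=
  contract (G x) (tractorMetric (G x)) (scaleTractorDeriv G s x) (scaleTractorDeriv G s x)

/-- The tractor field `X^B f`, where `X^B` is the canonical tractor. -/
def canonicalTractorMul {n : ℕ} (f : Coord n → ℝ) (x : Coord n) : Tri n ℝ := (0, 0, f x)

/-! ### The hypersurface `s = 0`, with the unit conormal `n̂ = ds / |ds|` -/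

/-- The unit conormal `n̂_a = ∂_a s / |ds|`. -/
def conormal {n : ℕ} (G : MetricField n) (s : Coord n → ℝ) (a : Fin n) (x : Coord n) : ℝ :=
  pd s a x / Real.sqrt (∑ b, ∑ c, (G x)⁻¹ b c * pd s b x * pd s c x)

/-- `n̂^a = g^ab n̂_b`. -/
def normal {n : ℕ} (G : MetricField n) (s : Coord n → ℝ) (a : Fin n) (x : Coord n) : ℝ :=
  ∑ b, (G x)⁻¹ a b * conormal G s b x

/-- The mean curvature `H = (g^ab - n̂^a n̂^b) ∇_a n̂_b / (n - 1)` of `s = 0`, that is the trace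
of the second fundamental form `∇_a^⊤ n̂_b`, divided by `n - 1`. -/
def meanCurvature {n : ℕ} (G : MetricField n) (s : Coord n → ℝ) (x : Coord n) : ℝ :=
  (1 / ((n : ℝ) - 1)) * ∑ a, ∑ b,
    ((G x)⁻¹ a b - normal G s a x * normal G s b x) *
      (pd (conormal G s b) a x - ∑ c, christoffel G c a b x * conormal G s c x)

/-- The normal tractor `N^A = (0, n̂_a, -H)` at points of `s = 0`. -/
def normalTractor {n : ℕ} (G : MetricField n) (s : Coord n → ℝ) (x : Coord n) : Tri n ℝ :=
  (0, fun a => conormal G s a x, -meanCurvature G s x)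

/-- The projection `δ^A_B - N^A N_B` onto the orthogonal complement of the normal tractor. -/
def projNormal {n : ℕ} (G : MetricField n) (s : Coord n → ℝ) (x : Coord n) (V : Tri n ℝ) :
    Tri n ℝ :=
  V - tractorMetric (G x) V (normalTractor G s x) • normalTractor G s x

/-- The metric induced on a hypersurface with the parametrisation `j`. -/
def inducedMetric {m n : ℕ} (G : MetricField n) (j : Coord m → Coord n) : MetricField m :=
  fun y => Matrix.of fun i k => ∑ a, ∑ b,
    G (j y) a b * pd (fun z => j z a) i y * pd (fun z => j z b) k y

/-- The isomorphism from the orthogonal complement of `N` along the hypersurface to the intrinsic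
tractor bundle, `(v⁺, v_a, v⁻) ↦ (v⁺, v_a - n̂_a H v⁺, v⁻ + H² v⁺ / 2)`, the middle slot being
pulled back along the parametrisation `j` to a 1-form on the hypersurface. -/
def toIntrinsic {m n : ℕ} (G : MetricField n) (s : Coord n → ℝ) (j : Coord m → Coord n)
    (y : Coord m) (V : Tri n ℝ) : Tri m ℝ :=
  (V.1,
   fun i => ∑ a, (V.2.1 a - conormal G s a (j y) * meanCurvature G s (j y) * V.1) *
      pd (fun z => j z a) i y,
   V.2.2 + meanCurvature G s (j y) ^ 2 / 2 * V.1)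

/-- `Σ^A_B V^B` restricted to the hypersurface: projection followed by the identification with
intrinsic tractors. -/
def sigmaRestrict {m n : ℕ} (G : MetricField n) (s : Coord n → ℝ) (j : Coord m → Coord n)
    (V : Coord n → Tri n ℝ) (y : Coord m) : Tri m ℝ :=
  toIntrinsic G s j y (projNormal G s (j y) (V (j y)))

/-- `D̄_A V^A` for a field `V^A` of intrinsic tractors of weight `w` on an `m`-dimensional
manifold with metric `G`. -/
def thomasDiv {m : ℕ} (G : MetricField m) (w : ℝ) (V : Coord m → Tri m ℝ) (y : Coord m) : ℝ :=
  tractorTrace (G y) (thomasD G (tractorNabla G) w V y)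

/-- The holographic expression
`2 / (n! (n-1)!) D̄_A [Σ^A_B (P_{n-1} N^B + (-1)^{n-2} (I·D)^{n-2} (X^B K_ext))|_Σ]`.
Here `X^B K_ext` has weight -1 and the tractor in the bracket has weight `1 - n`. -/
def holographic {m n : ℕ} (G : MetricField n) (s : Coord n → ℝ) (N : Coord n → Tri n ℝ)
    (j : Coord m → Coord n) (y : Coord m) : ℝ :=
  2 / ((Nat.factorial n : ℝ) * (Nat.factorial (n - 1) : ℝ)) *
    thomasDiv (inducedMetric G j) (1 - (n : ℝ))
      (sigmaRestrict G s j (fun x =>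
        extrinsicLaplacian G s (n - 1) N x
          + (-1 : ℝ) ^ (n - 2) •
            laplaceRobinPow G s (n - 2) (-1) (canonicalTractorMul (kExt G s)) x)) y

/-! ## Conformal manifolds, densities and tractor fields -/

section Manifold

variable {d : ℕ} (M : Type*) [TopologicalSpace M] [ChartedSpace (Coord d) M]

/-- Smooth Riemannian metrics on `M`. -/
abbrev Metric [IsManifold (𝓡 d) ∞ M] :=
  Bundle.ContMDiffRiemannianMetric (𝓡 d) ∞ (Coord d) (fun p : M => TangentSpace (𝓡 d) p)

/-- A field of triples `(σ, μ_a, ρ)` consisting of a function, a 1-form and a function. -/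
structure TripleField where
  top : M → ℝ
  mid : ∀ p : M, TangentSpace (𝓡 d) p →L[ℝ] ℝ
  bot : M → ℝ

variable {M}

/-- The coordinate vector field `∂_a` of the chart `φ`, at the point with coordinates `x`. -/
def frame (φ : OpenPartialHomeomorph M (Coord d)) (x : Coord d) (a : Fin d) :
    TangentSpace (𝓡 d) (φ.symm x) :=
  mfderiv (𝓡 d) (𝓡 d) φ.symm x (EuclideanSpace.single a (1 : ℝ) : Coord d)

/-- The components of a triple field in the chart `φ`. -/
def TripleField.comps (T : TripleField (d := d) M) (φ : OpenPartialHomeomorph M (Coord d))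
    (x : Coord d) : Tri d ℝ :=
  (T.top (φ.symm x), fun a => T.mid (φ.symm x) (frame φ x a), T.bot (φ.symm x))

variable [IsManifold (𝓡 d) ∞ M]

/-- The components `g_ab` of a metric in the chart `φ`. -/
def metricComps (g : Metric (d := d) M) (φ : OpenPartialHomeomorph M (Coord d)) : MetricField d :=
  fun x => Matrix.of fun a b => g.inner (φ.symm x) (frame φ x a) (frame φ x b)

/-- `g' = Ω² g` with `Ω` smooth and positive. -/
def IsRescaling (Ω : M → ℝ) (g g' : Metric (d := d) M) : Prop :=
  ContMDiff (𝓡 d) 𝓘(ℝ) ∞ Ω ∧ (∀ p, 0 < Ω p) ∧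
    ∀ (p : M) (v w : TangentSpace (𝓡 d) p), g'.inner p v w = Ω p ^ 2 * g.inner p v w

/-- A conformal structure: an equivalence class of metrics under rescaling. -/
def IsConformalStructure (c : Set (Metric (d := d) M)) : Prop :=
  ∃ g₀, c = {g | ∃ Ω, IsRescaling Ω g₀ g}

/-- A smooth section `f` of `𝓔[w]`, given by the functions `f g` that represent it in the scales
`g ∈ c`, with `f (Ω² g) = Ω^w f g`. -/
def IsDensity (c : Set (Metric (d := d) M)) (w : ℝ) (f : Metric (d := d) M → M → ℝ) : Prop :=
  (∀ g ∈ c, ContMDiff (𝓡 d) 𝓘(ℝ) ∞ (f g)) ∧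
  ∀ g ∈ c, ∀ g' ∈ c, ∀ Ω, IsRescaling Ω g g' → ∀ p, f g' p = Ω p ^ w * f g p

/-- A smooth section of the standard tractor bundle (of weight 0), given by the triples
`(σ, μ_a, ρ)` that represent it in the scales `g ∈ c`. The triple in the scale `Ω² g` is
`(Ω σ, Ω (μ_a + σ Υ_a), Ω⁻¹ (ρ - g^ab Υ_a μ_b - σ g^ab Υ_a Υ_b / 2))` with `Υ = Ω⁻¹ dΩ`; the
powers of `Ω` are due to the weights of the three slots. -/
def IsTractorField (c : Set (Metric (d := d) M))
    (T : Metric (d := d) M → TripleField (d := d) M) : Prop :=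
  (∀ g ∈ c, ∀ φ ∈ IsManifold.maximalAtlas (𝓡 d) ∞ M,
    ContDiffOn ℝ ∞ ((T g).comps φ) φ.target) ∧
  ∀ g ∈ c, ∀ g' ∈ c, ∀ Ω, IsRescaling Ω g g' →
    ∀ φ ∈ IsManifold.maximalAtlas (𝓡 d) ∞ M, ∀ x ∈ φ.target,
      let G := metricComps g φ
      let σ := ((T g).comps φ x).1
      let μ := ((T g).comps φ x).2.1
      let ρ := ((T g).comps φ x).2.2
      let r := Ω (φ.symm x)
      let Υ : Fin d → ℝ := fun a => pd (fun y => Ω (φ.symm y)) a x / r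
      (T g').comps φ x =
        (r * σ, fun a => r * (μ a + σ * Υ a),
         r⁻¹ * (ρ - ∑ a, ∑ b, (G x)⁻¹ a b * Υ a * μ b
            - σ / 2 * ∑ a, ∑ b, (G x)⁻¹ a b * Υ a * Υ b))

/-- `σ` is a defining density for the hypersurface `S`: a section of `𝓔[1]` with zero locus `S`
and nowhere vanishing derivative along `S`. -/
def IsDefiningDensity (c : Set (Metric (d := d) M)) (S : Set M)
    (σ : Metric (d := d) M → M → ℝ) : Prop :=
  IsDensity c 1 σ ∧ (∀ g ∈ c, ∀ p, σ g p = 0 ↔ p ∈ S) ∧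
    ∀ g ∈ c, ∀ p ∈ S, mfderiv (𝓡 d) 𝓘(ℝ) (σ g) p ≠ 0

/-- `B` is a smooth section of `𝓔[-d]` with `I_σ² = 1 + σ^d B`. -/
def IsUnitRemainder (c : Set (Metric (d := d) M)) (σ B : Metric (d := d) M → M → ℝ) : Prop :=
  IsDensity c (-(d : ℝ)) B ∧
    ∀ g ∈ c, ∀ φ ∈ IsManifold.maximalAtlas (𝓡 d) ∞ M, ∀ x ∈ φ.target,
      scaleTractorSq (metricComps g φ) (fun y => σ g (φ.symm y)) x
        = 1 + σ g (φ.symm x) ^ d * B g (φ.symm x)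

/-- `σ` is a conformal unit defining density for `S`: `I_σ² = 1 + O(σ^d)`. -/
def IsUnitDefiningDensity (c : Set (Metric (d := d) M)) (S : Set M)
    (σ : Metric (d := d) M → M → ℝ) : Prop :=
  IsDefiningDensity c S σ ∧ ∃ B, IsUnitRemainder c σ B

/-- `b` is the obstruction density of the hypersurface `S` with conformal unit defining density
`σ`, that is the restriction to `S` of the `B` with `I_σ² = 1 + σ^d B`; the value of `b` in the
scale of the metric induced by `g` is written `b g`. -/
def IsObstructionDensity (c : Set (Metric (d := d) M)) (S : Set M)
    (σ : Metric (d := d) M → M → ℝ) (b : Metric (d := d) M → S → ℝ) : Prop :=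
  ∃ B, IsUnitRemainder c σ B ∧ ∀ g ∈ c, ∀ p : S, b g p = B g p

/-- `N` is a smooth tractor field on `M` that extends the normal tractor of `S`. -/
def IsNormalTractorExtension (c : Set (Metric (d := d) M)) (S : Set M)
    (σ : Metric (d := d) M → M → ℝ) (N : Metric (d := d) M → TripleField (d := d) M) : Prop :=
  IsTractorField c N ∧
    ∀ g ∈ c, ∀ φ ∈ IsManifold.maximalAtlas (𝓡 d) ∞ M, ∀ x ∈ φ.target, φ.symm x ∈ S →
      (N g).comps φ x = normalTractor (metricComps g φ) (fun y => σ g (φ.symm y)) x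

end Manifold

end ConformalHypersurface

end

namespace ConformalHypersurface

noncomputable section

/-! Put `k = d - 2`, let `y = -I⁻² I·D`, and compute modulo multiples of the defining density `σ`.

The source of `K_ext` is the identity `I·D I^B = X^B K_ext + (1/2) D^B(I²)` (`robin_scaleI`), which
rests on the contracted Bianchi identity, the Ricci identity and the metricity of the tractor
connection. With `I² = 1 + σ^d B`, the term `D^B(I²)` is `σ^k V^B` with `V^B = -d(d-1) B X^B + O(σ)`
(`thomas_remainder`).

The second ingredient is the sl(2) relation `[y, σ] = -(d + 2w)` on weight `w` (`yL_smul`). It has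
three consequences. First, `y^(d-1)` on weight 0 commutes with multiplication by `σ`, so along `Σ`
it depends only on the restriction of its argument (`yPow_smul`). The normal tractor equals `I`
along `Σ`, because `|dσ| = 1` there and `H` is minus the bottom slot of `I` (`meanCurv_eq`); hence
any extension `N` may be replaced by `I`. Second, `y^k (σ^k V) = (k!)² V + O(σ)` at the relevant
weight (`yPow_pow_smul`). Third, `y^k` and `(-1)^k (I·D)^k` agree along `Σ`, since `I²` is 1 to
order `d` (`yPow_sub_robinPow`).

Now expand `y^(d-1) I = y^k (-I⁻² I·D I)`. The contribution of `X^B K_ext` cancels against the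
second term of the bracket, and what remains is `-(1/2)(k!)² V = (d! k!/2) B X^B` (`bracket_scaleI`,
`bracket_mem`). Such a tractor passes unchanged through the projection and the identification with
intrinsic tractors, and `D̄_A (X^A f) = (d-1) f` at the resulting weight (`thomasDiv_canonical`),
which gives the constant in the theorem.

All the identities are proved in a commutative algebra with commuting derivations, so that they are
pure algebra. They are then specialised to smooth functions on an open set of coordinate space, and
finally to charts of the manifold. -/

/-! ## Riemannian geometry over an algebra with commuting derivations -/

/-- The entrywise application of a derivation to a matrix. -/
def matD {n : ℕ} {A : Type*} [CommRing A] [Algebra ℝ A] (δ : Derivation ℝ A A)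
    (X : Matrix (Fin n) (Fin n) A) : Matrix (Fin n) (Fin n) A := X.map δ

section matD
variable {n : ℕ} {A : Type*} [CommRing A] [Algebra ℝ A] (δ : Derivation ℝ A A)
  (X Y : Matrix (Fin n) (Fin n) A)

lemma matD_apply (a b : Fin n) : matD δ X a b = δ (X a b) := rfl

lemma matD_mul : matD δ (X * Y) = matD δ X * Y + X * matD δ Y := by
  ext a b
  simp only [matD_apply, Matrix.mul_apply, Matrix.add_apply, map_sum, Derivation.leibniz,
    smul_eq_mul, Finset.sum_add_distrib]
  rw [add_comm]
  congr 1
  exact Finset.sum_congr rfl fun _ _ => mul_comm _ _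

lemma matD_add : matD δ (X + Y) = matD δ X + matD δ Y := by
  ext a b; simp [matD_apply]

lemma matD_sub : matD δ (X - Y) = matD δ X - matD δ Y := by
  ext a b; simp [matD_apply]

lemma matD_transpose : matD δ X.transpose = (matD δ X).transpose := rfl

lemma matD_one : matD δ (1 : Matrix (Fin n) (Fin n) A) = 0 := by
  ext a b; by_cases h : a = b <;> simp [matD_apply, h]

end matD

/-- A commutative algebra with commuting derivations `D a` (partial derivatives), and a symmetric
invertible matrix `g` (a metric) with inverse `gi`. -/
structure MetricAlg (n : ℕ) (A : Type*) [CommRing A] [Algebra ℝ A] where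
  D : Fin n → Derivation ℝ A A
  comm : ∀ a b f, D a (D b f) = D b (D a f)
  g : Matrix (Fin n) (Fin n) A
  gi : Matrix (Fin n) (Fin n) A
  symm : g.transpose = g
  mul_inv : g * gi = 1

namespace MetricAlg

variable {n : ℕ} {A : Type*} [CommRing A] [Algebra ℝ A] (m : MetricAlg n A)

/-- Christoffel symbols. -/
def chr (c a b : Fin n) : A :=
  (1 / 2 : ℝ) • ∑ e, m.gi c e * (m.D a (m.g b e) + m.D b (m.g a e) - m.D e (m.g a b))

/-- The curvature `R_ab^c_e`. -/
def riem (a b c e : Fin n) : A :=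
  m.D a (m.chr c b e) - m.D b (m.chr c a e)
    + ∑ f, (m.chr c a f * m.chr f b e - m.chr c b f * m.chr f a e)

/-- The Ricci tensor. -/
def ric (a b : Fin n) : A := ∑ c, m.riem c a c b

/-- The scalar curvature. -/
def scal : A := ∑ a, ∑ b, m.gi a b * m.ric a b

/-- The trace of the Schouten tensor. -/
def J : A := (1 / (2 * ((n : ℝ) - 1))) • m.scal

/-- The Schouten tensor (for `n ≥ 3`). -/
def P (a b : Fin n) : A := (1 / ((n : ℝ) - 2)) • (m.ric a b - m.J * m.g a b)

/-- The connection matrices `(Γ_a)^c_e`. -/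
def conn (a : Fin n) : Matrix (Fin n) (Fin n) A := Matrix.of fun c e => m.chr c a e

/-- The curvature matrices `(R_ab)^c_e`. -/
def curv (a b : Fin n) : Matrix (Fin n) (Fin n) A := Matrix.of fun c e => m.riem a b c e

lemma conn_apply (a c e : Fin n) : m.conn a c e = m.chr c a e := rfl
lemma curv_apply (a b c e : Fin n) : m.curv a b c e = m.riem a b c e := rfl

lemma curv_eq (a b : Fin n) : m.curv a b = matD (m.D a) (m.conn b) - matD (m.D b) (m.conn a)
    + (m.conn a * m.conn b - m.conn b * m.conn a) := by
  ext c e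
  simp [curv_apply, riem, matD_apply, conn_apply, Matrix.mul_apply]

lemma g_symm (a b : Fin n) : m.g a b = m.g b a := congrFun (congrFun m.symm b) a

lemma inv_mul : m.gi * m.g = 1 := mul_eq_one_comm.mp m.mul_inv

lemma gi_transpose : m.gi.transpose = m.gi := by
  have h : m.gi.transpose * m.g = 1 := by
    rw [← m.symm, ← Matrix.transpose_mul, m.mul_inv, Matrix.transpose_one]
  calc m.gi.transpose = m.gi.transpose * (m.g * m.gi) := by rw [m.mul_inv, mul_one]
    _ = m.gi := by rw [← mul_assoc, h, one_mul]

lemma gi_symm (a b : Fin n) : m.gi a b = m.gi b a := congrFun (congrFun m.gi_transpose b) a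

lemma chr_symm (c a b : Fin n) : m.chr c a b = m.chr c b a := by
  unfold chr
  congr 1
  refine Finset.sum_congr rfl fun e _ => ?_
  rw [m.g_symm a b]; ring

lemma sum_g_gi (b : Fin n) (v : Fin n → A) : ∑ e, m.g b e * ∑ f, m.gi e f * v f = v b := by
  have h : m.g.mulVec (m.gi.mulVec v) = v := by
    rw [Matrix.mulVec_mulVec, m.mul_inv, Matrix.one_mulVec]
  exact congrFun h b

lemma sum_g_chr (b a c : Fin n) : ∑ e, m.g b e * m.chr e a c =
    (1 / 2 : ℝ) • (m.D a (m.g c b) + m.D c (m.g a b) - m.D b (m.g a c)) := by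
  simp only [chr, mul_smul_comm, ← Finset.smul_sum]
  rw [m.sum_g_gi b fun e => m.D a (m.g c e) + m.D c (m.g a e) - m.D e (m.g a c)]

/-- Metric compatibility `∇g = 0` in terms of connection matrices. Everything about the inverse
metric and the skewness of the curvature is derived from this form. -/
lemma matD_g (a : Fin n) :
    matD (m.D a) m.g = m.g * m.conn a + (m.conn a).transpose * m.g := by
  ext b c
  have h1 : (m.g * m.conn a) b c = _ := m.sum_g_chr b a c
  have h2 : ((m.conn a).transpose * m.g) b c =
      (1 / 2 : ℝ) • (m.D a (m.g b c) + m.D b (m.g a c) - m.D c (m.g a b)) := by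
    rw [← m.sum_g_chr c a b, Matrix.mul_apply]
    exact Finset.sum_congr rfl fun e _ => by
      rw [m.g_symm c e, mul_comm, Matrix.transpose_apply, conn_apply]
  rw [Matrix.add_apply, h1, h2, matD_apply, m.g_symm c b]
  module

lemma matD_gi (a : Fin n) :
    matD (m.D a) m.gi = -(m.conn a * m.gi + m.gi * (m.conn a).transpose) := by
  have h : matD (m.D a) m.g * m.gi + m.g * matD (m.D a) m.gi = 0 := by
    rw [← matD_mul, m.mul_inv, matD_one]
  have h2 : m.gi * (m.g * matD (m.D a) m.gi) = - (m.gi * (matD (m.D a) m.g * m.gi)) := by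
    rw [← mul_neg, eq_neg_of_add_eq_zero_right h]
  rw [← mul_assoc, m.inv_mul, one_mul, matD_g] at h2
  rw [h2, add_mul, mul_add, ← mul_assoc m.gi, ← mul_assoc m.gi, m.inv_mul, one_mul,
    mul_assoc _ m.g, m.mul_inv, mul_one]

lemma D_gi (a b c : Fin n) : m.D a (m.gi b c) =
    -(∑ f, m.chr b a f * m.gi f c + ∑ f, m.chr c a f * m.gi b f) := by
  have h := congrFun (congrFun (m.matD_gi a) b) c
  simp only [Matrix.neg_apply, Matrix.add_apply, Matrix.mul_apply, Matrix.transpose_apply,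
    conn_apply, matD_apply] at h
  rw [h]
  simp only [mul_comm]

lemma D_g (a b c : Fin n) : m.D a (m.g b c) =
    ∑ f, m.chr f a c * m.g b f + ∑ f, m.chr f a b * m.g f c := by
  have h := congrFun (congrFun (m.matD_g a) b) c
  simp only [Matrix.add_apply, Matrix.mul_apply, Matrix.transpose_apply,
    conn_apply, matD_apply] at h
  rw [h]
  simp only [mul_comm]

lemma matD_comm (a b : Fin n) (X : Matrix (Fin n) (Fin n) A) :
    matD (m.D a) (matD (m.D b) X) = matD (m.D b) (matD (m.D a) X) := by
  ext c e; exact m.comm a b _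

/-- Second derivatives of `g` commute. Expanding both orders by `matD_g`, the difference is exactly
the symmetrised curvature with its index lowered. -/
lemma g_mul_curv (a b : Fin n) : m.g * m.curv a b + (m.g * m.curv a b).transpose = 0 := by
  have key : ∀ a b, matD (m.D a) (matD (m.D b) m.g) =
      m.g * m.conn a * m.conn b + (m.conn a).transpose * m.g * m.conn b
      + m.g * matD (m.D a) (m.conn b) + (m.g * m.conn a * m.conn b
      + (m.conn a).transpose * m.g * m.conn b
      + m.g * matD (m.D a) (m.conn b)).transpose := by
    intro a b
    rw [m.matD_g b, matD_add, matD_mul, matD_mul, matD_transpose, m.matD_g a]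
    simp only [Matrix.transpose_add, Matrix.transpose_mul, m.symm, Matrix.transpose_transpose,
      mul_assoc, add_mul, mul_add]
    abel
  have h := m.matD_comm a b m.g
  rw [key a b, key b a, ← sub_eq_zero] at h
  rw [curv_eq, ← h]
  simp only [Matrix.transpose_add, Matrix.transpose_sub, Matrix.transpose_mul, m.symm,
    Matrix.transpose_transpose, mul_assoc, mul_add, mul_sub]
  abel

/-- The curvature with raised index, `R_ab^cd`. -/
def curvUp (a b : Fin n) : Matrix (Fin n) (Fin n) A := m.curv a b * m.gi

lemma curvUp_transpose (a b : Fin n) : (m.curvUp a b).transpose = -m.curvUp a b := by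
  have h := m.g_mul_curv a b
  have h2 : m.gi * (m.g * m.curv a b + (m.g * m.curv a b).transpose) * m.gi = 0 := by
    rw [h, mul_zero, zero_mul]
  rw [Matrix.transpose_mul, m.symm, mul_add, ← mul_assoc, m.inv_mul, one_mul, add_mul,
    mul_assoc m.gi, mul_assoc _ m.g, m.mul_inv, mul_one] at h2
  rw [curvUp, Matrix.transpose_mul, m.gi_transpose]
  exact eq_neg_of_add_eq_zero_right h2

lemma curvUp_swap (a b c e : Fin n) : m.curvUp a b c e = -m.curvUp a b e c := by
  have h := congrFun (congrFun (m.curvUp_transpose a b) e) c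
  exact h

lemma curv_neg (a b : Fin n) : m.curv a b = -m.curv b a := by
  rw [curv_eq, curv_eq]; abel

lemma curvUp_neg (a b : Fin n) : m.curvUp a b = -m.curvUp b a := by
  rw [curvUp, curv_neg, neg_mul]; rfl

lemma curvUp_neg_apply (a b c e : Fin n) : m.curvUp a b c e = -m.curvUp b a c e := by
  rw [curvUp_neg]; rfl

/-- The second Bianchi identity, with the covariant derivative acting on the endomorphism indices
only: for a torsion-free connection the terms from the form indices cancel in the cyclic sum. -/
lemma bianchi_curv (a b c : Fin n) :
    (matD (m.D a) (m.curv b c) + m.conn a * m.curv b c - m.curv b c * m.conn a)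
    + (matD (m.D b) (m.curv c a) + m.conn b * m.curv c a - m.curv c a * m.conn b)
    + (matD (m.D c) (m.curv a b) + m.conn c * m.curv a b - m.curv a b * m.conn c) = 0 := by
  simp only [curv_eq, matD_add, matD_sub, matD_mul]
  rw [m.matD_comm a b, m.matD_comm b c, m.matD_comm c a]
  simp only [mul_add, mul_sub, add_mul, sub_mul, mul_assoc]
  abel

/-- Raising an index commutes with covariant differentiation; after that both pairs of indices can
be treated by transposition. -/
lemma matD_curvUp (a b c : Fin n) :
    (matD (m.D a) (m.curv b c) + m.conn a * m.curv b c - m.curv b c * m.conn a) * m.gi =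
      matD (m.D a) (m.curvUp b c) + m.conn a * m.curvUp b c
        + m.curvUp b c * (m.conn a).transpose := by
  rw [curvUp, matD_mul, matD_gi]
  simp only [mul_add, add_mul, sub_mul, mul_neg, mul_assoc]
  abel

lemma bianchi_curvUp (a b c : Fin n) :
    (matD (m.D a) (m.curvUp b c) + m.conn a * m.curvUp b c + m.curvUp b c * (m.conn a).transpose)
    + (matD (m.D b) (m.curvUp c a) + m.conn b * m.curvUp c a
      + m.curvUp c a * (m.conn b).transpose)
    + (matD (m.D c) (m.curvUp a b) + m.conn c * m.curvUp a b
      + m.curvUp a b * (m.conn c).transpose) = 0 := by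
  rw [← matD_curvUp, ← matD_curvUp, ← matD_curvUp, ← add_mul, ← add_mul, bianchi_curv, zero_mul]

/-- The Ricci tensor with raised index, `Ric_b^a`. -/
def ricUp (b a : Fin n) : A := ∑ e, m.ric b e * m.gi e a

lemma sum_curvUp (b a : Fin n) : ∑ c, m.curvUp c b c a = m.ricUp b a := by
  simp only [curvUp, Matrix.mul_apply, ricUp, ric, Finset.sum_mul, curv_apply]
  rw [Finset.sum_comm]

lemma sum_curvUp' (b a : Fin n) : ∑ c, m.curvUp b c a c = m.ricUp b a := by
  rw [← sum_curvUp]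
  refine Finset.sum_congr rfl fun c _ => ?_
  rw [curvUp_neg_apply, curvUp_swap, neg_neg]

lemma sum_ricUp : ∑ a, m.ricUp a a = m.scal := by
  simp only [ricUp, scal]
  exact Finset.sum_congr rfl fun a _ => Finset.sum_congr rfl fun e _ => by
    rw [m.gi_symm, mul_comm]

/-- The contracted second Bianchi identity `2 ∇_a Ric_b^a = ∇_b Sc`. -/
lemma contracted_bianchi (b : Fin n) :
    2 * (∑ a, m.D a (m.ricUp b a) + ∑ a, ∑ f, m.chr a a f * m.ricUp b f
      - ∑ a, ∑ f, m.chr a b f * m.ricUp a f) = m.D b m.scal := by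
  have hsum : ∑ a, ∑ c,
      ((matD (m.D a) (m.curvUp b c) + m.conn a * m.curvUp b c
        + m.curvUp b c * (m.conn a).transpose) a c
      + (matD (m.D b) (m.curvUp c a) + m.conn b * m.curvUp c a
        + m.curvUp c a * (m.conn b).transpose) a c
      + (matD (m.D c) (m.curvUp a b) + m.conn c * m.curvUp a b
        + m.curvUp a b * (m.conn c).transpose) a c) = 0 := by
    refine Finset.sum_eq_zero fun a _ => Finset.sum_eq_zero fun c _ => ?_
    exact congrFun (congrFun (m.bianchi_curvUp a b c) a) c
  simp only [Finset.sum_add_distrib] at hsum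
  -- Exchanging the summation indices and using skewness in each pair, the third cyclic term equals
  -- the first; this is the factor 2 in the conclusion.
  have h3 : ∑ a, ∑ c, (matD (m.D c) (m.curvUp a b) + m.conn c * m.curvUp a b
        + m.curvUp a b * (m.conn c).transpose) a c =
      ∑ a, ∑ c, (matD (m.D a) (m.curvUp b c) + m.conn a * m.curvUp b c
        + m.curvUp b c * (m.conn a).transpose) a c := by
    rw [Finset.sum_comm]
    refine Finset.sum_congr rfl fun a _ => Finset.sum_congr rfl fun c _ => ?_
    have h : (matD (m.D a) (m.curvUp c b) + m.conn a * m.curvUp c b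
        + m.curvUp c b * (m.conn a).transpose) =
        (matD (m.D a) (m.curvUp b c) + m.conn a * m.curvUp b c
        + m.curvUp b c * (m.conn a).transpose).transpose := by
      rw [Matrix.transpose_add, Matrix.transpose_add, Matrix.transpose_mul, Matrix.transpose_mul,
        ← matD_transpose, curvUp_transpose, ← curvUp_neg, Matrix.transpose_transpose]
      abel
    rw [h, Matrix.transpose_apply]
  have h1 : ∑ a, ∑ c, (matD (m.D a) (m.curvUp b c) + m.conn a * m.curvUp b c
        + m.curvUp b c * (m.conn a).transpose) a c =
      ∑ a, m.D a (m.ricUp b a) + ∑ a, ∑ f, m.chr a a f * m.ricUp b f := by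
    simp only [Matrix.add_apply, Finset.sum_add_distrib, matD_apply, Matrix.mul_apply,
      Matrix.transpose_apply, conn_apply]
    -- A skew pair contracted with the symmetric lower indices of a Christoffel symbol.
    have hz : ∑ a, ∑ c, ∑ f, m.curvUp b c a f * m.chr c a f = 0 := by
      rw [Finset.sum_comm]
      refine Finset.sum_eq_zero fun c _ => ?_
      have hh : ∑ a, ∑ f, m.curvUp b c a f * m.chr c a f =
          -∑ a, ∑ f, m.curvUp b c a f * m.chr c a f := by
        conv_lhs => rw [Finset.sum_comm]
        rw [← Finset.sum_neg_distrib]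
        refine Finset.sum_congr rfl fun a _ => ?_
        rw [← Finset.sum_neg_distrib]
        refine Finset.sum_congr rfl fun f _ => ?_
        rw [curvUp_swap, chr_symm, neg_mul]
      have h2 : (2 : ℝ) • ∑ a, ∑ f, m.curvUp b c a f * m.chr c a f = 0 := by
        rw [two_smul]; nth_rw 1 [hh]; exact neg_add_cancel _
      simpa using h2
    rw [hz, add_zero]
    congr 1
    · refine Finset.sum_congr rfl fun a _ => ?_
      rw [← map_sum, sum_curvUp']
    · refine Finset.sum_congr rfl fun a _ => ?_
      rw [Finset.sum_comm]
      refine Finset.sum_congr rfl fun f _ => ?_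
      rw [← Finset.mul_sum, sum_curvUp']
  have h2 : ∑ a, ∑ c, (matD (m.D b) (m.curvUp c a) + m.conn b * m.curvUp c a
        + m.curvUp c a * (m.conn b).transpose) a c =
      -m.D b m.scal - 2 * ∑ a, ∑ f, m.chr a b f * m.ricUp a f := by
    simp only [Matrix.add_apply, Finset.sum_add_distrib, matD_apply, Matrix.mul_apply,
      Matrix.transpose_apply, conn_apply]
    have e1 : ∑ a, ∑ c, m.D b (m.curvUp c a a c) = -m.D b m.scal := by
      rw [← sum_ricUp, map_sum, ← Finset.sum_neg_distrib]
      refine Finset.sum_congr rfl fun a _ => ?_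
      rw [← map_sum, ← map_neg, ← sum_curvUp, ← Finset.sum_neg_distrib]
      congr 1
      exact Finset.sum_congr rfl fun c _ => m.curvUp_swap _ _ _ _
    have e2 : ∑ a, ∑ c, ∑ f, m.chr a b f * m.curvUp c a f c =
        -∑ a, ∑ f, m.chr a b f * m.ricUp a f := by
      rw [← Finset.sum_neg_distrib]
      refine Finset.sum_congr rfl fun a _ => ?_
      rw [Finset.sum_comm, ← Finset.sum_neg_distrib]
      refine Finset.sum_congr rfl fun f _ => ?_
      rw [← Finset.mul_sum, ← mul_neg, ← sum_curvUp, ← Finset.sum_neg_distrib]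
      congr 1
      exact Finset.sum_congr rfl fun c _ => m.curvUp_swap _ _ _ _
    have e3 : ∑ a, ∑ c, ∑ f, m.curvUp c a a f * m.chr c b f =
        -∑ a, ∑ f, m.chr a b f * m.ricUp a f := by
      rw [Finset.sum_comm, ← Finset.sum_neg_distrib]
      refine Finset.sum_congr rfl fun c _ => ?_
      rw [Finset.sum_comm, ← Finset.sum_neg_distrib]
      refine Finset.sum_congr rfl fun f _ => ?_
      rw [← Finset.sum_mul, mul_comm, ← mul_neg, ← sum_curvUp, ← Finset.sum_neg_distrib]
      congr 1
      exact Finset.sum_congr rfl fun a _ => m.curvUp_neg_apply _ _ _ _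
    rw [e1, e2, e3]; ring
  rw [h3, h2, h1] at hsum
  linear_combination hsum

end MetricAlg

/-! ### Symmetry of Ricci, divergences, and the Ricci identity -/

namespace MetricAlg

variable {n : ℕ} {A : Type*} [CommRing A] [Algebra ℝ A] (m : MetricAlg n A)

lemma bianchi_first (a b c e : Fin n) :
    m.riem a b c e + m.riem b e c a + m.riem e a c b = 0 := by
  simp only [riem, Finset.sum_sub_distrib, m.chr_symm _ b a, m.chr_symm _ e b, m.chr_symm _ e a]
  ring

/-- The trace of a skew matrix times a symmetric one is zero; the symmetry of the Ricci tensor needs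
this besides the first Bianchi identity. -/
lemma sum_curv_diag (a b : Fin n) : ∑ c, m.riem a b c c = 0 := by
  have h : m.curv a b = m.curvUp a b * m.g := by
    rw [curvUp, mul_assoc, m.inv_mul, mul_one]
  have h1 : (m.curv a b).trace = (m.curvUp a b * m.g).trace := by rw [← h]
  have h2 : (m.curvUp a b * m.g).trace = -(m.curvUp a b * m.g).trace := by
    nth_rw 1 [← Matrix.trace_transpose]
    rw [Matrix.transpose_mul, m.symm, curvUp_transpose, mul_neg, Matrix.trace_neg,
      Matrix.trace_mul_comm]
  have h3 : (2 : ℝ) • (m.curvUp a b * m.g).trace = 0 := by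
    rw [two_smul]; nth_rw 1 [h2]; exact neg_add_cancel _
  have h4 : (m.curvUp a b * m.g).trace = 0 := by simpa using h3
  rw [h4] at h1
  exact h1

lemma riem_neg (a b c e : Fin n) : m.riem a b c e = -m.riem b a c e :=
  congrFun (congrFun (m.curv_neg a b) c) e

lemma ric_symm (a b : Fin n) : m.ric a b = m.ric b a := by
  rw [← sub_eq_zero]
  have h : m.ric a b - m.ric b a = -∑ c, m.riem a b c c := by
    simp only [ric, ← Finset.sum_sub_distrib, ← Finset.sum_neg_distrib]
    refine Finset.sum_congr rfl fun c _ => ?_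
    rw [m.riem_neg c b]
    linear_combination m.bianchi_first a b c c
  rw [h, sum_curv_diag, neg_zero]

lemma P_symm (a b : Fin n) : m.P a b = m.P b a := by
  rw [P, P, ric_symm, g_symm]

/-- The divergence `∇^a T_ae`. -/
def div (T : Fin n → Fin n → A) (e : Fin n) : A :=
  ∑ a, ∑ b, m.gi a b * (m.D a (T b e) - ∑ c, m.chr c a e * T b c - ∑ c, m.chr c a b * T c e)

/-- `T_e^a = g^ab T_be`. -/
def up (T : Fin n → Fin n → A) (e a : Fin n) : A := ∑ b, T b e * m.gi b a

lemma up_ric (e a : Fin n) : m.up m.ric e a = m.ricUp e a :=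
  Finset.sum_congr rfl fun b _ => by rw [ric_symm]

/-- Since the inverse metric is parallel, the index may be raised before differentiating. The right
side is the shape in which `contracted_bianchi` is available. -/
lemma div_eq (T : Fin n → Fin n → A) (e : Fin n) : m.div T e =
    ∑ a, m.D a (m.up T e a) + ∑ a, ∑ f, m.chr a a f * m.up T e f
      - ∑ a, ∑ f, m.chr a e f * m.up T a f := by
  have h1 : ∑ a, m.D a (m.up T e a) = ∑ a, ∑ b, m.gi a b * m.D a (T b e)
      - ∑ a, ∑ b, m.gi a b * ∑ c, m.chr c a b * T c e
      - ∑ a, ∑ f, m.chr a a f * m.up T e f := by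
    have hx : ∀ a, m.D a (m.up T e a) = ∑ b, m.gi a b * m.D a (T b e)
        - ∑ b, m.gi a b * ∑ c, m.chr c a b * T c e - ∑ f, m.chr a a f * m.up T e f := by
      intro a
      simp only [up, map_sum, Derivation.leibniz, smul_eq_mul, D_gi, Finset.sum_add_distrib,
        mul_neg, mul_add, Finset.mul_sum, Finset.sum_neg_distrib]
      have e1 : ∑ b, ∑ f, T b e * (m.chr b a f * m.gi f a) =
          ∑ b, ∑ c, m.gi a b * (m.chr c a b * T c e) := by
        rw [Finset.sum_comm]
        exact Finset.sum_congr rfl fun b _ => Finset.sum_congr rfl fun c _ => by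
          rw [m.gi_symm b a]; ring
      have e2 : ∑ b, ∑ f, T b e * (m.chr a a f * m.gi b f) =
          ∑ f, ∑ b, m.chr a a f * (T b e * m.gi b f) := by
        rw [Finset.sum_comm]
        exact Finset.sum_congr rfl fun b _ => Finset.sum_congr rfl fun c _ => by ring
      have e3 : ∑ b, m.gi b a * m.D a (T b e) = ∑ b, m.gi a b * m.D a (T b e) :=
        Finset.sum_congr rfl fun b _ => by rw [m.gi_symm b a]
      rw [e1, e2, e3]; ring
    simp only [hx, Finset.sum_sub_distrib]
  have h2 : ∑ a, ∑ b, m.gi a b * ∑ c, m.chr c a e * T b c =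
      ∑ a, ∑ f, m.chr a e f * m.up T a f := by
    simp only [up, Finset.mul_sum]
    have : ∀ a, ∑ b, ∑ c, m.gi a b * (m.chr c a e * T b c) =
        ∑ c, ∑ b, m.chr c e a * (T b c * m.gi b a) := fun a => by
      rw [Finset.sum_comm]
      exact Finset.sum_congr rfl fun b _ => Finset.sum_congr rfl fun c _ => by
        rw [m.gi_symm a c, m.chr_symm b a e]; ring
    simp only [this]
    rw [Finset.sum_comm]
  rw [h1, ← h2, div]
  simp only [mul_sub, Finset.sum_sub_distrib]
  ring

lemma div_ric (b : Fin n) : 2 * m.div m.ric b = m.D b m.scal := by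
  rw [div_eq, ← contracted_bianchi]
  simp only [up_ric]

lemma div_add (T T' : Fin n → Fin n → A) (e : Fin n) :
    m.div (fun a b => T a b + T' a b) e = m.div T e + m.div T' e := by
  simp only [div, ← Finset.sum_add_distrib, ← mul_add]
  refine Finset.sum_congr rfl fun a _ => Finset.sum_congr rfl fun b _ => ?_
  simp only [mul_add, Finset.sum_add_distrib, map_add]
  ring

lemma div_sub (T T' : Fin n → Fin n → A) (e : Fin n) :
    m.div (fun a b => T a b - T' a b) e = m.div T e - m.div T' e := by
  simp only [div, ← Finset.sum_sub_distrib, ← mul_sub]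
  refine Finset.sum_congr rfl fun a _ => Finset.sum_congr rfl fun b _ => ?_
  simp only [mul_sub, Finset.sum_sub_distrib, map_sub]
  ring

lemma div_smul (r : ℝ) (T : Fin n → Fin n → A) (e : Fin n) :
    m.div (fun a b => r • T a b) e = r • m.div T e := by
  simp only [div, Finset.smul_sum]
  refine Finset.sum_congr rfl fun a _ => Finset.sum_congr rfl fun b _ => ?_
  simp only [Derivation.map_smul, mul_smul_comm, ← Finset.smul_sum, ← smul_sub]

lemma div_mul (f : A) (T : Fin n → Fin n → A) (e : Fin n) :
    m.div (fun a b => f * T a b) e =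
      f * m.div T e + ∑ a, ∑ b, m.gi a b * (m.D a f * T b e) := by
  simp only [div, Finset.mul_sum, ← Finset.sum_add_distrib]
  refine Finset.sum_congr rfl fun a _ => Finset.sum_congr rfl fun b _ => ?_
  simp only [Derivation.leibniz, smul_eq_mul, mul_left_comm _ f, ← Finset.mul_sum]
  ring

lemma div_g (e : Fin n) : m.div (fun a b => m.g a b) e = 0 := by
  refine Finset.sum_eq_zero fun a _ => Finset.sum_eq_zero fun b _ => ?_
  rw [D_g, sub_sub, add_comm, mul_comm]
  simp

lemma sum_gi_mul_g (a b : Fin n) : ∑ c, m.gi a c * m.g c b = if a = b then 1 else 0 := by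
  have := congrFun (congrFun m.inv_mul a) b
  rwa [Matrix.mul_apply, Matrix.one_apply] at this

lemma sum_gi_mul_g_left (v : Fin n → A) (e : Fin n) :
    ∑ a, ∑ b, m.gi a b * (v a * m.g b e) = v e := by
  have : ∀ a, ∑ b, m.gi a b * (v a * m.g b e) = v a * ∑ b, m.gi a b * m.g b e := fun a => by
    rw [Finset.mul_sum]; exact Finset.sum_congr rfl fun b _ => by ring
  simp [this, sum_gi_mul_g]

lemma trace_g : ∑ a, ∑ b, m.gi a b * m.g a b = (n : A) := by
  have : ∀ a, ∑ b, m.gi a b * m.g a b = 1 := fun a => by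
    have := m.sum_gi_mul_g a a
    rw [if_pos rfl] at this
    rw [← this]
    exact Finset.sum_congr rfl fun b _ => by rw [m.g_symm]
  simp [this]

lemma two_mul_J (h1 : (n : ℝ) ≠ 1) : (2 * ((n : ℝ) - 1)) • m.J = m.scal := by
  rw [J, smul_smul, mul_one_div_cancel, one_smul]
  exact mul_ne_zero two_ne_zero (sub_ne_zero.mpr h1)

lemma trace_P (h1 : (n : ℝ) ≠ 1) (h2 : (n : ℝ) ≠ 2) : ∑ a, ∑ b, m.gi a b * m.P a b = m.J := by
  have h : ∑ a, ∑ b, m.gi a b * m.P a b = (1 / ((n : ℝ) - 2)) • (m.scal - m.J * (n : A)) := by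
    rw [← m.trace_g, scal]
    simp only [P, Finset.mul_sum, ← Finset.sum_sub_distrib, Finset.smul_sum, mul_smul_comm]
    refine Finset.sum_congr rfl fun a _ => Finset.sum_congr rfl fun b _ => ?_
    congr 1; ring
  have h3 : m.J * (n : A) = (n : ℝ) • m.J := by
    rw [Algebra.smul_def, map_natCast, mul_comm]
  rw [h, h3, ← m.two_mul_J h1, ← sub_smul, smul_smul]
  have : 1 / ((n : ℝ) - 2) * (2 * ((n : ℝ) - 1) - n) = 1 := by
    have := sub_ne_zero.mpr h2
    field_simp; ring
  rw [this, one_smul]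

/-- The contracted Bianchi identity reads `div Ric = (n - 1) dJ`, and removing `J g` leaves `(n - 2)
dJ`, which the normalisation of `P` divides out. -/
lemma div_P (h1 : (n : ℝ) ≠ 1) (h2 : (n : ℝ) ≠ 2) (e : Fin n) : m.div m.P e = m.D e m.J := by
  have h : m.div m.P e = (1 / ((n : ℝ) - 2)) • (m.div m.ric e - m.D e m.J) := by
    have : m.P = fun a b => (1 / ((n : ℝ) - 2)) • (m.ric a b - m.J * m.g a b) := rfl
    rw [this, div_smul, div_sub, m.div_mul m.J (fun a b => m.g a b), div_g,
      sum_gi_mul_g_left, mul_zero, zero_add]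
  have h3 : m.div m.ric e = ((n : ℝ) - 1) • m.D e m.J := by
    have : (2 : ℝ) • m.div m.ric e = (2 : ℝ) • ((n : ℝ) - 1) • m.D e m.J := by
      rw [smul_smul, ← Derivation.map_smul, m.two_mul_J h1, ← div_ric, two_smul, two_mul]
    exact smul_right_injective A (two_ne_zero (α := ℝ)) this
  rw [h, h3]
  have h4 := sub_ne_zero.mpr h2
  have : ((n : ℝ) - 1) • m.D e m.J - m.D e m.J = ((n : ℝ) - 2) • m.D e m.J := by module
  rw [this, smul_smul, one_div_mul_cancel h4, one_smul]

/-- The Hessian `∇_a ∇_b f`. -/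
def hess (f : A) (a b : Fin n) : A := m.D a (m.D b f) - ∑ c, m.chr c a b * m.D c f

/-- The Laplacian of a function. -/
def lapl (f : A) : A := ∑ a, ∑ b, m.gi a b * m.hess f a b

lemma hess_symm (f : A) (a b : Fin n) : m.hess f a b = m.hess f b a := by
  simp only [hess, m.comm a b, m.chr_symm _ a b]

/-- Third covariant derivatives of a function: the Hessian is symmetric, so moving the outer
derivative past the last index costs one curvature term. -/
lemma ricci_identity (f : A) (a b e : Fin n) :
    m.D a (m.hess f b e) - ∑ c, m.chr c a e * m.hess f b c - ∑ c, m.chr c a b * m.hess f c e =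
    m.D e (m.hess f a b) - ∑ c, m.chr c e b * m.hess f a c - ∑ c, m.chr c e a * m.hess f c b
      - ∑ c, m.riem a e c b * m.D c f := by
  have h : ∑ c, m.riem a e c b * m.D c f =
      ∑ c, m.D a (m.chr c e b) * m.D c f - ∑ c, m.D e (m.chr c a b) * m.D c f
      + (∑ c, m.chr c e b * ∑ k, m.chr k a c * m.D k f
        - ∑ c, m.chr c a b * ∑ k, m.chr k e c * m.D k f) := by
    have hx : ∀ a e, ∑ c, m.chr c e b * ∑ k, m.chr k a c * m.D k f =
        ∑ c, (∑ k, m.chr c a k * m.chr k e b) * m.D c f := fun a e => by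
      simp only [Finset.mul_sum, Finset.sum_mul]
      rw [Finset.sum_comm]
      exact Finset.sum_congr rfl fun _ _ => Finset.sum_congr rfl fun _ _ => by ring
    rw [hx a e, hx e a]
    simp only [← Finset.sum_sub_distrib, ← Finset.sum_add_distrib, riem]
    refine Finset.sum_congr rfl fun c _ => ?_
    rw [Finset.sum_sub_distrib]; ring
  have h0 : ∑ c, m.chr c a e * m.hess f b c = ∑ c, m.chr c e a * m.hess f c b :=
    Finset.sum_congr rfl fun c _ => by rw [m.chr_symm c a e, hess_symm]
  rw [h, h0]
  have s1 : ∀ c k, m.chr k c e = m.chr k e c := fun c k => m.chr_symm k c e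
  have s2 : ∀ c, m.D c (m.D e f) = m.D e (m.D c f) := fun c => m.comm c e f
  simp only [hess, map_sub, map_sum, Derivation.leibniz, smul_eq_mul, mul_sub,
    Finset.sum_sub_distrib, Finset.sum_add_distrib, s1, s2, m.comm a e (m.D b f),
    mul_comm (m.D _ f)]
  ring

/-- Covariant differentiation commutes with the metric trace. -/
lemma sum_gi_D (T : Fin n → Fin n → A) (e : Fin n) :
    ∑ a, ∑ b, m.gi a b * (m.D e (T a b) - ∑ c, m.chr c e b * T a c - ∑ c, m.chr c e a * T c b) =
      m.D e (∑ a, ∑ b, m.gi a b * T a b) := by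
  have h1 : ∑ a, ∑ b, m.gi a b * ∑ c, m.chr c e b * T a c =
      ∑ a, ∑ b, (∑ c, m.chr b e c * m.gi a c) * T a b := by
    refine Finset.sum_congr rfl fun a _ => ?_
    simp only [Finset.mul_sum, Finset.sum_mul]
    rw [Finset.sum_comm]
    exact Finset.sum_congr rfl fun _ _ => Finset.sum_congr rfl fun _ _ => by ring
  have h2 : ∑ a, ∑ b, m.gi a b * ∑ c, m.chr c e a * T c b =
      ∑ a, ∑ b, (∑ c, m.chr a e c * m.gi c b) * T a b := by
    rw [Finset.sum_comm]
    conv_rhs => rw [Finset.sum_comm]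
    refine Finset.sum_congr rfl fun a _ => ?_
    simp only [Finset.mul_sum, Finset.sum_mul]
    rw [Finset.sum_comm]
    exact Finset.sum_congr rfl fun _ _ => Finset.sum_congr rfl fun _ _ => by ring
  simp only [mul_sub, Finset.sum_sub_distrib]
  rw [h1, h2]
  simp only [map_sum, Derivation.leibniz, smul_eq_mul, D_gi, ← Finset.sum_sub_distrib]
  exact Finset.sum_congr rfl fun _ _ => Finset.sum_congr rfl fun _ _ => by ring

/-- The trace of `ricci_identity`, that is, the commutator of `Δ` and `d` in the Bochner formula. -/
lemma div_hess (f : A) (e : Fin n) :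
    m.div (m.hess f) e = m.D e (m.lapl f) + ∑ c, m.ricUp e c * m.D c f := by
  rw [lapl, ← sum_gi_D]
  simp only [div, m.ricci_identity f _ _ e]
  have h : ∑ a, ∑ b, m.gi a b * ∑ c, m.riem a e c b * m.D c f =
      -∑ c, m.ricUp e c * m.D c f := by
    have h1 : ∀ c, -m.ricUp e c = ∑ a, ∑ b, m.gi a b * m.riem a e c b := fun c => by
      rw [← sum_curvUp, ← Finset.sum_neg_distrib]
      refine Finset.sum_congr rfl fun a _ => ?_
      rw [← curvUp_swap, curvUp, Matrix.mul_apply]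
      exact Finset.sum_congr rfl fun b _ => by rw [m.gi_symm, mul_comm, curv_apply]
    simp only [← Finset.sum_neg_distrib, ← neg_mul, h1, Finset.sum_mul, Finset.mul_sum]
    rw [Finset.sum_comm]
    conv_rhs => rw [Finset.sum_comm' (t' := Finset.univ) (s' := fun _ => Finset.univ) (by simp)]
    rw [Finset.sum_comm]
    refine Finset.sum_congr rfl fun a _ => ?_
    conv_rhs => rw [Finset.sum_comm]
    exact Finset.sum_congr rfl fun b _ => Finset.sum_congr rfl fun c _ => by ring
  simp only [mul_sub, Finset.sum_sub_distrib] at h ⊢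
  rw [h]; ring

end MetricAlg

namespace MetricAlg

variable {n : ℕ} {A : Type*} [CommRing A] [Algebra ℝ A] (m : MetricAlg n A)

/-! ## Tractor calculus over a metric algebra -/

/-- The tractor connection. -/
def nab (a : Fin n) (T : Tri n A) : Tri n A :=
  (m.D a T.1 - T.2.1 a,
   fun b => m.D a (T.2.1 b) - ∑ c, m.chr c a b * T.2.1 c + m.g a b * T.2.2 + m.P a b * T.1,
   m.D a T.2.2 - ∑ c, ∑ e, m.P a c * m.gi c e * T.2.1 e)

/-- The Laplacian of a connection `nb` on a module. -/
def lapV {V : Type*} [AddCommGroup V] [Module A V] (nb : Fin n → V → V) (f : V) : V :=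
  ∑ a, ∑ b, m.gi a b • (nb a (nb b f) - ∑ c, m.chr c a b • nb c f)

lemma nab_smul (a : Fin n) (f : A) (T : Tri n A) :
    m.nab a (f • T) = f • m.nab a T + m.D a f • T := by
  refine Prod.ext ?_ (Prod.ext (funext fun b => ?_) ?_)
  · simp [nab]; ring
  · simp [nab, mul_left_comm _ f, ← Finset.mul_sum]; ring
  · simp [nab, mul_left_comm _ f, ← Finset.mul_sum]; ring

lemma nab_add (a : Fin n) (S T : Tri n A) : m.nab a (S + T) = m.nab a S + m.nab a T := by
  refine Prod.ext ?_ (Prod.ext (funext fun b => ?_) ?_)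
  · simp [nab]; ring
  · simp [nab, mul_add, Finset.sum_add_distrib]; ring
  · simp [nab, mul_add, Finset.sum_add_distrib]; ring

lemma lapV_add {V : Type*} [AddCommGroup V] [Module A V] {nb : Fin n → V → V}
    (hadd : ∀ a S T, nb a (S + T) = nb a S + nb a T) (S T : V) :
    m.lapV nb (S + T) = m.lapV nb S + m.lapV nb T := by
  simp only [lapV, hadd, ← Finset.sum_add_distrib, smul_add]
  refine Finset.sum_congr rfl fun a _ => Finset.sum_congr rfl fun b _ => ?_
  rw [Finset.sum_add_distrib]; module

lemma lapV_smul {V : Type*} [AddCommGroup V] [Module A V] {nb : Fin n → V → V}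
    (hadd : ∀ a S T, nb a (S + T) = nb a S + nb a T)
    (hsmul : ∀ a (f : A) T, nb a (f • T) = f • nb a T + m.D a f • T) (f : A) (T : V) :
    m.lapV nb (f • T) = f • m.lapV nb T
      + (2 : A) • ∑ a, ∑ b, m.gi a b • m.D a f • nb b T + m.lapl f • T := by
  have hcross : ∑ a, ∑ b, m.gi a b • m.D b f • nb a T =
      ∑ a, ∑ b, m.gi a b • m.D a f • nb b T := by
    rw [Finset.sum_comm]
    exact Finset.sum_congr rfl fun a _ => Finset.sum_congr rfl fun b _ => by rw [m.gi_symm]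
  have h2 : (2 : A) • ∑ a, ∑ b, m.gi a b • m.D a f • nb b T =
      ∑ a, ∑ b, m.gi a b • m.D a f • nb b T + ∑ a, ∑ b, m.gi a b • m.D b f • nb a T := by
    rw [hcross, two_smul]
  rw [h2]
  simp only [lapV, lapl, hess, hadd, hsmul, Finset.smul_sum, Finset.sum_smul,
    ← Finset.sum_add_distrib]
  refine Finset.sum_congr rfl fun a _ => Finset.sum_congr rfl fun b _ => ?_
  have h3 : ∑ c, m.chr c a b • (f • nb c T + m.D c f • T) =
      f • ∑ c, m.chr c a b • nb c T + (∑ c, m.chr c a b * m.D c f) • T := by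
    simp only [Finset.smul_sum, Finset.sum_smul, ← Finset.sum_add_distrib]
    exact Finset.sum_congr rfl fun c _ => by module
  rw [h3]
  module

/-- The tractor metric. -/
def tm (S T : Tri n A) : A :=
  S.1 * T.2.2 + ∑ a, ∑ b, m.gi a b * (S.2.1 a * T.2.1 b) + S.2.2 * T.1

lemma tm_symm (S T : Tri n A) : m.tm S T = m.tm T S := by
  have : ∑ a, ∑ b, m.gi a b * (S.2.1 a * T.2.1 b) = ∑ a, ∑ b, m.gi a b * (T.2.1 a * S.2.1 b) := by
    rw [Finset.sum_comm]
    exact Finset.sum_congr rfl fun a _ => Finset.sum_congr rfl fun b _ => by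
      rw [m.gi_symm]; ring
  rw [tm, tm, this]; ring

/-- The tractor metric as a linear form in its first argument. -/
def tmL (T : Tri n A) : Tri n A →ₗ[A] A where
  toFun S := m.tm S T
  map_add' S S' := by
    simp only [tm, Prod.fst_add, Prod.snd_add, Pi.add_apply, add_mul, mul_add,
      Finset.sum_add_distrib]; ring
  map_smul' f S := by
    simp only [tm, Prod.smul_fst, Prod.smul_snd, Pi.smul_apply, smul_eq_mul, RingHom.id_apply,
      mul_add, Finset.mul_sum, mul_assoc, mul_left_comm _ f]

lemma tmL_apply (S T : Tri n A) : m.tmL T S = m.tm S T := rfl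

/-- The tractor connection preserves the tractor metric: the algebraic terms with `g` and `P` in one
factor cancel those in the outer slots of the other, and the middle slots reduce to metricity of the
Levi-Civita connection. -/
lemma tm_nab (a : Fin n) (S T : Tri n A) :
    m.D a (m.tm S T) = m.tm (m.nab a S) T + m.tm S (m.nab a T) := by
  have h := m.sum_gi_D (fun b c => S.2.1 b * T.2.1 c) a
  have hg : ∀ v : Fin n → A, ∑ b, ∑ c, m.gi b c * (m.g a b * v c) = v a := fun v => by
    have : ∑ b, m.g a b * ∑ c, m.gi b c * v c = v a := m.sum_g_gi a v
    rw [← this]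
    simp only [Finset.mul_sum]
    exact Finset.sum_congr rfl fun _ _ => Finset.sum_congr rfl fun _ _ => by ring
  have hg' : ∀ v : Fin n → A, ∑ b, ∑ c, m.gi b c * (v b * m.g a c) = v a := fun v => by
    rw [Finset.sum_comm, ← hg v]
    exact Finset.sum_congr rfl fun b _ => Finset.sum_congr rfl fun c _ => by
      rw [m.gi_symm b c]; ring
  have hP : ∀ v : Fin n → A, ∑ b, ∑ c, m.gi b c * (v b * m.P a c) =
      ∑ c, ∑ e, m.P a c * m.gi c e * v e := fun v => by
    rw [Finset.sum_comm]
    exact Finset.sum_congr rfl fun b _ => Finset.sum_congr rfl fun c _ => by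
      rw [m.gi_symm c b]; ring
  have hP' : ∀ v : Fin n → A, ∑ b, ∑ c, m.gi b c * (m.P a b * v c) =
      ∑ c, ∑ e, m.P a c * m.gi c e * v e := fun v => by
    exact Finset.sum_congr rfl fun b _ => Finset.sum_congr rfl fun c _ => by ring
  have e1 : m.tm (m.nab a S) T = (m.D a S.1 - S.2.1 a) * T.2.2
      + (∑ b, ∑ c, m.gi b c * ((m.D a (S.2.1 b) - ∑ e, m.chr e a b * S.2.1 e) * T.2.1 c)
        + S.2.2 * ∑ b, ∑ c, m.gi b c * (m.g a b * T.2.1 c)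
        + S.1 * ∑ b, ∑ c, m.gi b c * (m.P a b * T.2.1 c))
      + (m.D a S.2.2 - ∑ c, ∑ e, m.P a c * m.gi c e * S.2.1 e) * T.1 := by
    simp only [tm, nab, Finset.mul_sum, ← Finset.sum_add_distrib]
    congr 2
    exact Finset.sum_congr rfl fun b _ => Finset.sum_congr rfl fun c _ => by ring
  have e2 : m.tm S (m.nab a T) = S.1 * (m.D a T.2.2 - ∑ c, ∑ e, m.P a c * m.gi c e * T.2.1 e)
      + (∑ b, ∑ c, m.gi b c * (S.2.1 b * (m.D a (T.2.1 c) - ∑ e, m.chr e a c * T.2.1 e))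
        + T.2.2 * ∑ b, ∑ c, m.gi b c * (S.2.1 b * m.g a c)
        + T.1 * ∑ b, ∑ c, m.gi b c * (S.2.1 b * m.P a c))
      + S.2.2 * (m.D a T.1 - T.2.1 a) := by
    simp only [tm, nab, Finset.mul_sum, ← Finset.sum_add_distrib]
    congr 2
    exact Finset.sum_congr rfl fun b _ => Finset.sum_congr rfl fun c _ => by ring
  have e3 : ∑ b, ∑ c, m.gi b c * ((m.D a (S.2.1 b) - ∑ e, m.chr e a b * S.2.1 e) * T.2.1 c)
      + ∑ b, ∑ c, m.gi b c * (S.2.1 b * (m.D a (T.2.1 c) - ∑ e, m.chr e a c * T.2.1 e)) =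
      m.D a (∑ b, ∑ c, m.gi b c * (S.2.1 b * T.2.1 c)) := by
    rw [← h]
    simp only [← Finset.sum_add_distrib]
    refine Finset.sum_congr rfl fun b _ => Finset.sum_congr rfl fun c _ => ?_
    simp only [Derivation.leibniz, smul_eq_mul, mul_left_comm _ (S.2.1 b), ←
      Finset.mul_sum, sub_mul]
    simp only [← mul_assoc, ← Finset.sum_mul]
    ring
  rw [e1, e2, hg, hg', hP, hP']
  simp only [tm, map_add, Derivation.leibniz, smul_eq_mul, ← e3]
  ring

/-- Bochner's formula for a squared length. For the scale tractor the gradient term is `K_ext`,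
which is how that quantity enters the argument. -/
lemma lapl_tm (S : Tri n A) : m.lapl (m.tm S S) = 2 * m.tm (m.lapV m.nab S) S
    + 2 * ∑ a, ∑ b, m.gi a b * m.tm (m.nab a S) (m.nab b S) := by
  have h1 : ∀ a, m.D a (m.tm S S) = 2 * m.tm (m.nab a S) S := fun a => by
    rw [tm_nab, m.tm_symm S]; ring
  have h2 : m.tm (m.lapV m.nab S) S = ∑ a, ∑ b, m.gi a b *
      (m.tm (m.nab a (m.nab b S)) S - ∑ c, m.chr c a b * m.tm (m.nab c S) S) := by
    rw [← tmL_apply, lapV]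
    simp only [map_sum, map_smul, map_sub, tmL_apply, smul_eq_mul]
  have h3 : ∀ a b, m.D a (2 * m.tm (m.nab b S) S) =
      2 * (m.tm (m.nab a (m.nab b S)) S + m.tm (m.nab a S) (m.nab b S)) := fun a b => by
    rw [two_mul, map_add, tm_nab, m.tm_symm (m.nab b S)]; ring
  rw [h2, lapl]
  simp only [hess, h1, h3, Finset.mul_sum, ← Finset.sum_add_distrib]
  refine Finset.sum_congr rfl fun a _ => Finset.sum_congr rfl fun b _ => ?_
  simp only [mul_left_comm _ (2 : A), ← Finset.mul_sum]
  ring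

/-- The bottom slot of the scale tractor. -/
def rho (s : A) : A := -((n : ℝ)⁻¹ • (m.lapl s + m.J * s))

/-- The scale tractor `(s, ds, ρ)`. -/
def scaleI (s : A) : Tri n A := (s, fun a => m.D a s, m.rho s)

/-- The square of the scale tractor. -/
def scaleSq (s : A) : A := m.tm (m.scaleI s) (m.scaleI s)

/-- The trace-free symmetric tensor `∇_a ∇_b s + P_ab s + ρ g_ab`. -/
def tfHess (s : A) (a b : Fin n) : A := m.hess s a b + m.g a b * m.rho s + m.P a b * s

/-- The bottom slot of the derivative of the scale tractor. -/
def botD (s : A) (a : Fin n) : A :=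
  m.D a (m.rho s) - ∑ c, ∑ e, m.P a c * m.gi c e * m.D e s

/-- The square `P_AB P^AB` of the derivative of the scale tractor. -/
def kExt (s : A) : A := ∑ a, ∑ b, m.gi a b * m.tm (m.nab a (m.scaleI s)) (m.nab b (m.scaleI s))

lemma nab_scaleI (s : A) (a : Fin n) : m.nab a (m.scaleI s) = (0, m.tfHess s a, m.botD s a) := by
  refine Prod.ext ?_ (Prod.ext (funext fun b => ?_) rfl)
  · simp [nab, scaleI]
  · simp [nab, scaleI, tfHess, hess]

lemma tfHess_symm (s : A) (a b : Fin n) : m.tfHess s a b = m.tfHess s b a := by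
  rw [tfHess, tfHess, hess_symm, g_symm, P_symm]

lemma natCast_smul_rho (h0 : (n : ℝ) ≠ 0) (s : A) :
    (n : A) * m.rho s = -(m.lapl s + m.J * s) := by
  have : (n : A) * m.rho s = (n : ℝ) • m.rho s := by rw [Algebra.smul_def, map_natCast]
  rw [this, rho, smul_neg, smul_smul, mul_inv_cancel₀ h0, one_smul]

/-- The bottom slot `rho` is normalised precisely so that this trace vanishes. -/
lemma trace_tfHess (h0 : (n : ℝ) ≠ 0) (h1 : (n : ℝ) ≠ 1) (h2 : (n : ℝ) ≠ 2) (s : A) :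
    ∑ a, ∑ b, m.gi a b * m.tfHess s a b = 0 := by
  have h := m.natCast_smul_rho h0 s
  have e : ∑ a, ∑ b, m.gi a b * m.tfHess s a b = m.lapl s
      + (∑ a, ∑ b, m.gi a b * m.g a b) * m.rho s + (∑ a, ∑ b, m.gi a b * m.P a b) * s := by
    simp only [lapl, Finset.sum_mul, ← Finset.sum_add_distrib]
    exact Finset.sum_congr rfl fun a _ => Finset.sum_congr rfl fun b _ => by
      rw [tfHess]; ring
  rw [e, trace_g, trace_P m h1 h2, h]; ring

lemma ricUp_contract (h2 : (n : ℝ) ≠ 2) (v : Fin n → A) (e : Fin n) :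
    ∑ c, m.ricUp e c * v c = ((n : ℝ) - 2) • (∑ c, ∑ k, m.P e c * m.gi c k * v k)
      + m.J * v e := by
  have hric : ∀ b, m.ric e b = ((n : ℝ) - 2) • m.P e b + m.J * m.g e b := fun b => by
    rw [P, smul_smul, mul_one_div_cancel (sub_ne_zero.mpr h2), one_smul]; ring
  have hg : ∑ c, m.g e c * ∑ k, m.gi c k * v k = v e := m.sum_g_gi e v
  have hg' : m.J * v e = m.J * ∑ c, m.g e c * ∑ k, m.gi c k * v k := by rw [hg]
  rw [hg']
  simp only [ricUp, Finset.sum_mul, Finset.mul_sum, Finset.smul_sum, ← Finset.sum_add_distrib]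
  rw [Finset.sum_comm]
  refine Finset.sum_congr rfl fun a _ => Finset.sum_congr rfl fun b _ => ?_
  rw [hric]
  simp only [Algebra.smul_def]
  ring

/-- The Ricci term from `div_hess` and the derivatives of `P` and `rho` assemble into the bottom
slot of `∇I`. So `∇I` is governed by the trace-free Hessian alone, and `ΔI` becomes computable. -/
lemma div_tfHess (h0 : (n : ℝ) ≠ 0) (h1 : (n : ℝ) ≠ 1) (h2 : (n : ℝ) ≠ 2) (s : A) (e : Fin n) :
    m.div (m.tfHess s) e = (1 - (n : ℝ)) • m.botD s e := by
  have hd : m.div (m.tfHess s) e = m.div (m.hess s) e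
      + m.div (fun a b => m.rho s * m.g a b) e + m.div (fun a b => s * m.P a b) e := by
    rw [← div_add, ← div_add]
    congr 1
    funext a b
    rw [tfHess]; ring
  have hr := congrArg (m.D e) (m.natCast_smul_rho h0 s)
  simp only [Derivation.leibniz, map_neg, map_add, smul_eq_mul, Derivation.map_natCast,
    mul_zero, add_zero] at hr
  have hPu : ∑ a, ∑ b, m.gi a b * (m.D a s * m.P b e) =
      ∑ c, ∑ k, m.P e c * m.gi c k * m.D k s := by
    rw [Finset.sum_comm]
    exact Finset.sum_congr rfl fun b _ => Finset.sum_congr rfl fun c _ => by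
      rw [m.gi_symm c b, m.P_symm b e]; ring
  rw [hd, div_hess, m.div_mul (m.rho s) (fun a b => m.g a b), m.div_mul s m.P, div_g, mul_zero,
    zero_add, m.sum_gi_mul_g_left (fun a => m.D a (m.rho s)), div_P m h1 h2, hPu,
    ricUp_contract m h2, botD]
  simp only [Algebra.smul_def, map_sub, map_natCast, map_one, map_ofNat]
  linear_combination hr

lemma lapV_scaleI_top (h0 : (n : ℝ) ≠ 0) (h1 : (n : ℝ) ≠ 1) (h2 : (n : ℝ) ≠ 2) (s : A) :
    (m.lapV m.nab (m.scaleI s)).1 = 0 := by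
  simp only [lapV, nab_scaleI, Prod.fst_sum, Prod.smul_fst, Prod.fst_sub, smul_zero,
    Finset.sum_const_zero, sub_zero]
  simp only [nab, map_zero, zero_sub, smul_eq_mul, mul_neg, Finset.sum_neg_distrib]
  rw [neg_eq_zero, ← m.trace_tfHess h0 h1 h2 s]
  exact Finset.sum_congr rfl fun a _ => Finset.sum_congr rfl fun b _ => by rw [tfHess_symm]

/-- The coefficient is `(1 - n) + 1`: the divergence of the middle slot plus the bottom slot fed
back by the `g` term of the connection. -/
lemma lapV_scaleI_mid (h0 : (n : ℝ) ≠ 0) (h1 : (n : ℝ) ≠ 1) (h2 : (n : ℝ) ≠ 2) (s : A)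
    (e : Fin n) : (m.lapV m.nab (m.scaleI s)).2.1 e = (2 - (n : ℝ)) • m.botD s e := by
  have h := m.div_tfHess h0 h1 h2 s e
  have hx : (m.lapV m.nab (m.scaleI s)).2.1 e = m.div (m.tfHess s) e
      + ∑ a, ∑ b, m.gi a b * (m.g a e * m.botD s b) := by
    simp only [lapV, nab_scaleI, Prod.fst_sum, Prod.snd_sum, Prod.smul_fst, Prod.smul_snd,
      Prod.fst_sub, Prod.snd_sub, Finset.sum_apply, Pi.smul_apply, Pi.sub_apply, smul_eq_mul,
      div, ← Finset.sum_add_distrib]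
    refine Finset.sum_congr rfl fun a _ => Finset.sum_congr rfl fun b _ => ?_
    simp only [nab]
    ring
  have hg : ∑ a, ∑ b, m.gi a b * (m.g a e * m.botD s b) = m.botD s e := by
    rw [← m.sum_gi_mul_g_left (m.botD s) e, Finset.sum_comm]
    exact Finset.sum_congr rfl fun a _ => Finset.sum_congr rfl fun b _ => by
      rw [m.gi_symm]; ring
  rw [hx, hg, h]
  module

/-- The operator `I·D` on tractors of weight `w`. -/
def robin (s : A) (w : ℝ) (T : Tri n A) : Tri n A :=
  s • (-(m.lapV m.nab T + (w • m.J) • T))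
    + ∑ a, ∑ b, m.gi a b • m.D a s • (((n : ℝ) + 2 * w - 2) • m.nab b T)
    + m.rho s • ((w * ((n : ℝ) + 2 * w - 2)) • T)

lemma robin_scaleI (h0 : (n : ℝ) ≠ 0) (h1 : (n : ℝ) ≠ 1) (h2 : (n : ℝ) ≠ 2) (s : A) :
    m.robin s 0 (m.scaleI s) = (0, fun e => (((n : ℝ) - 2) / 2) • m.D e (m.scaleSq s),
      m.kExt s - (1 / 2 : ℝ) • m.lapl (m.scaleSq s)) := by
  have hS : ∀ e, m.D e (m.scaleSq s) = 2 * (s * m.botD s e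
      + ∑ a, ∑ b, m.gi a b * (m.D a s * m.tfHess s e b)) := fun e => by
    rw [scaleSq, tm_nab, m.tm_symm (m.nab e _), nab_scaleI]
    simp only [tm, scaleI]
    ring
  have hL : m.lapl (m.scaleSq s) = 2 * (s * (m.lapV m.nab (m.scaleI s)).2.2
      + (2 - (n : ℝ)) • ∑ a, ∑ b, m.gi a b * (m.D a s * m.botD s b)) + 2 * m.kExt s := by
    rw [scaleSq, lapl_tm, kExt, m.tm_symm]
    congr 2
    simp only [tm, lapV_scaleI_top m h0 h1 h2, lapV_scaleI_mid m h0 h1 h2]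
    simp only [scaleI, mul_zero, add_zero, mul_smul_comm, Finset.smul_sum]
  refine Prod.ext ?_ (Prod.ext (funext fun e => ?_) ?_)
  · simp only [robin, nab_scaleI, Prod.fst_add, Prod.smul_fst, Prod.fst_neg, Prod.fst_sum,
      lapV_scaleI_top m h0 h1 h2]
    simp
  · simp only [robin, nab_scaleI, Prod.fst_add, Prod.snd_add, Prod.smul_fst, Prod.smul_snd,
      Prod.fst_neg, Prod.snd_neg, Prod.fst_sum, Prod.snd_sum, Finset.sum_apply, Pi.add_apply,
      Pi.neg_apply, Pi.smul_apply, lapV_scaleI_mid m h0 h1 h2, hS, m.tfHess_symm s _ e]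
    simp only [zero_smul, zero_mul, add_zero, mul_zero, smul_eq_mul, mul_smul_comm,
      ← Finset.smul_sum]
    have : ∀ x : A, (((n : ℝ) - 2) / 2) • (2 * x) = ((n : ℝ) - 2) • x := fun x => by
      rw [two_mul]; module
    rw [this]
    simp only [Algebra.smul_def, map_sub, map_natCast, map_ofNat]
    ring
  · simp only [robin, nab_scaleI, Prod.snd_add, Prod.smul_snd,
      Prod.snd_neg, Prod.snd_sum, hL]
    simp only [zero_smul, zero_mul, add_zero, mul_zero, smul_eq_mul, mul_smul_comm,
      ← Finset.smul_sum]
    have : ∀ x : A, (1 / 2 : ℝ) • (2 * x) = x := fun x => by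
      rw [two_mul]; module
    rw [smul_add, this, this]
    simp only [Algebra.smul_def, map_sub, map_natCast, map_ofNat]
    ring

end MetricAlg

namespace MetricAlg

variable {n : ℕ} {A : Type*} [CommRing A] [Algebra ℝ A] (m : MetricAlg n A)

/-! ## The `sl(2)` relation between the Laplace-Robin operator and the scale -/

/-- The derivative `∇^a s ∇_a T` of a tractor. -/
def gradD (s : A) (T : Tri n A) : Tri n A := ∑ a, ∑ b, m.gi a b • m.D a s • m.nab b T

/-- The square of the gradient. -/
def gradSq (s : A) : A := ∑ a, ∑ b, m.gi a b * (m.D a s * m.D b s)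

lemma scaleSq_eq (s : A) : m.scaleSq s = m.gradSq s + 2 * (s * m.rho s) := by
  simp only [scaleSq, tm, scaleI, gradSq]; ring

lemma robin_eq (s : A) (w : ℝ) (T : Tri n A) : m.robin s w T =
    s • (-(m.lapV m.nab T + (w • m.J) • T)) + ((n : ℝ) + 2 * w - 2) • m.gradD s T
      + m.rho s • ((w * ((n : ℝ) + 2 * w - 2)) • T) := by
  simp only [robin, gradD, Finset.smul_sum]
  congr 2
  exact Finset.sum_congr rfl fun a _ => Finset.sum_congr rfl fun b _ => by
    rw [smul_comm (m.D a s), smul_comm (m.gi a b)]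

lemma nab_real_smul (a : Fin n) (r : ℝ) (T : Tri n A) : m.nab a (r • T) = r • m.nab a T := by
  rw [← algebraMap_smul A r T, nab_smul, Derivation.map_algebraMap, zero_smul, add_zero,
    algebraMap_smul]

lemma gradD_add (s : A) (S T : Tri n A) : m.gradD s (S + T) = m.gradD s S + m.gradD s T := by
  simp only [gradD, nab_add, smul_add, Finset.sum_add_distrib]

lemma gradD_smul (s f : A) (T : Tri n A) : m.gradD s (f • T) =
    f • m.gradD s T + (∑ a, ∑ b, m.gi a b * (m.D a s * m.D b f)) • T := by
  simp only [gradD, nab_smul, smul_add, Finset.sum_add_distrib, Finset.smul_sum, Finset.sum_smul,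
    smul_smul]
  congr 1
  exact Finset.sum_congr rfl fun a _ => Finset.sum_congr rfl fun b _ => by
    congr 1; ring

lemma robin_add (s : A) (w : ℝ) (S T : Tri n A) :
    m.robin s w (S + T) = m.robin s w S + m.robin s w T := by
  rw [robin_eq, robin_eq, robin_eq, gradD_add, lapV_add m m.nab_add]
  module

lemma gradD_real_smul (s : A) (r : ℝ) (T : Tri n A) : m.gradD s (r • T) = r • m.gradD s T := by
  simp only [gradD, nab_real_smul, Finset.smul_sum, smul_comm r]

lemma lapV_real_smul (r : ℝ) (T : Tri n A) :
    m.lapV m.nab (r • T) = r • m.lapV m.nab T := by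
  simp only [lapV, nab_real_smul, Finset.smul_sum, smul_comm r, smul_sub]

/-- The Laplace-Robin operator as a linear map. -/
def robinL (s : A) (w : ℝ) : Tri n A →ₗ[ℝ] Tri n A where
  toFun := m.robin s w
  map_add' := m.robin_add s w
  map_smul' r T := by
    simp only [robin_eq, gradD_real_smul, lapV_real_smul, RingHom.id_apply]
    rw [smul_comm (w • m.J) r T]
    simp only [smul_add, smul_neg, smul_comm r, mul_smul]

/-- The powers of the Laplace-Robin operator. -/
def robinPow (s : A) : ℕ → ℝ → Tri n A →ₗ[ℝ] Tri n A
  | 0, _ => LinearMap.id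
  | k + 1, w => robinPow s k (w - 1) ∘ₗ m.robinL s w

/-- The operator `-I⁻² I·D`, where `t` is the inverse of `I²`. -/
def yL (s t : A) (w : ℝ) : Tri n A →ₗ[ℝ] Tri n A where
  toFun T := (-t) • m.robinL s w T
  map_add' S T := by rw [map_add, smul_add]
  map_smul' r T := by rw [map_smul, smul_comm]; rfl

/-- The powers of `-I⁻² I·D`. -/
def yPow (s t : A) : ℕ → ℝ → Tri n A →ₗ[ℝ] Tri n A
  | 0, _ => LinearMap.id
  | k + 1, w => yPow s t k (w - 1) ∘ₗ m.yL s t w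

lemma robinPow_succ (s : A) (k : ℕ) (w : ℝ) (T : Tri n A) :
    m.robinPow s (k + 1) w T = m.robinPow s k (w - 1) (m.robin s w T) := rfl

lemma yPow_succ (s t : A) (k : ℕ) (w : ℝ) (T : Tri n A) :
    m.yPow s t (k + 1) w T = m.yPow s t k (w - 1) (m.yL s t w T) := rfl

lemma yL_apply (s t : A) (w : ℝ) (T : Tri n A) : m.yL s t w T = (-t) • m.robin s w T := rfl

/-- The sl(2) commutator. The Leibniz terms contribute `|ds|²`, and `Δs = -n rho - J s` together
with the change of weight supplies `2 s rho`, completing `I²`. -/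
lemma robin_scale_smul (h0 : (n : ℝ) ≠ 0) (s : A) (w : ℝ) (T : Tri n A) :
    m.robin s (w + 1) (s • T) =
      s • m.robin s w T + ((n : ℝ) + 2 * w) • m.scaleSq s • T := by
  have hl : m.lapl s = -((n : A) * m.rho s) - m.J * s := by
    rw [natCast_smul_rho m h0]; ring
  have hL := m.lapV_smul m.nab_add m.nab_smul s T
  have hg : (∑ a, ∑ b, m.gi a b • m.D a s • m.nab b T) = m.gradD s T := rfl
  have hq : (∑ a, ∑ b, m.gi a b * (m.D a s * m.D b s)) = m.gradSq s := rfl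
  rw [hg, hl] at hL
  rw [robin_eq, robin_eq, gradD_smul, hL, hq, scaleSq_eq]
  rw [Algebra.smul_def (w + 1) m.J, Algebra.smul_def w m.J]
  simp only [← algebraMap_smul A (_ : ℝ) (_ : Tri n A), map_add, map_sub, map_mul, map_natCast,
    map_ofNat, map_one]
  module

/-- Dividing by `I²` makes the commutator with `s` a constant, so that the exact sl(2) combinatorics
holds even off the zero locus. -/
lemma yL_smul (h0 : (n : ℝ) ≠ 0) {s t : A} (ht : m.scaleSq s * t = 1) (w : ℝ) (T : Tri n A) :
    m.yL s t (w + 1) (s • T) = s • m.yL s t w T - ((n : ℝ) + 2 * w) • T := by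
  rw [yL_apply, yL_apply, robin_scale_smul m h0, smul_add, smul_comm (-t) s, sub_eq_add_neg]
  congr 1
  rw [smul_comm, smul_smul, neg_mul, mul_comm t, ht, neg_smul, one_smul, smul_neg]

/-- The constant is the arithmetic sum of `n + 2(w + i)` over `i = 0, ..., j`. -/
lemma yL_pow_smul (h0 : (n : ℝ) ≠ 0) {s t : A} (ht : m.scaleSq s * t = 1) (w : ℝ) (T : Tri n A)
    (j : ℕ) : m.yL s t (w + (j + 1)) (s ^ (j + 1) • T) =
      s ^ (j + 1) • m.yL s t w T - ((j + 1 : ℝ) * (n + 2 * w + j)) • s ^ j • T := by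
  induction j with
  | zero => simpa using m.yL_smul h0 ht w T
  | succ j ih =>
    rw [pow_succ' s (j + 1), mul_smul, ← add_assoc, yL_smul m h0 ht]
    push_cast
    rw [ih, mul_smul, pow_succ' s j]
    simp only [← algebraMap_smul A (_ : ℝ) (_ : Tri n A), map_add,
      map_mul, map_natCast, map_ofNat, map_one]
    module

/-- Tangentiality of the powers at the critical weight. -/
lemma yPow_smul (h0 : (n : ℝ) ≠ 0) {s t : A} (ht : m.scaleSq s * t = 1) (k : ℕ) (w : ℝ)
    (T : Tri n A) : m.yPow s t (k + 1) (w + 1) (s • T) =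
      s • m.yPow s t (k + 1) w T - ((k + 1 : ℝ) * (n + 2 * w - k)) • m.yPow s t k w T := by
  induction k generalizing w T with
  | zero =>
    simpa [yPow] using m.yL_smul h0 ht w T
  | succ k ih =>
    have e : w + 1 - 1 = w - 1 + 1 := by ring
    -- The constants add up as `(n + 2w) + (k + 1)(n + 2(w - 1) - k) = (k + 2)(n + 2w - (k + 1))`.
    rw [yPow_succ, yL_smul m h0 ht, map_sub, LinearMap.map_smul _ ((n : ℝ) + 2 * w) T, e, ih,
      sub_add_cancel, m.yPow_succ s t (k + 1), m.yPow_succ s t k w]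
    simp only [← algebraMap_smul A (_ : ℝ) (_ : Tri n A), map_add, map_sub,
      map_mul, map_natCast, map_ofNat, map_one, Nat.cast_add, Nat.cast_one]
    module

/-- Each application strips one power of `s` at the cost of a constant, or leaves all powers in
place; only the first choice, made every time, survives modulo `s`. -/
lemma yPow_pow_smul (h0 : (n : ℝ) ≠ 0) {s t : A} (ht : m.scaleSq s * t = 1) (k : ℕ) (w : ℝ)
    (V : Tri n A) : ∃ Z, m.yPow s t k (w + k) (s ^ k • V) =
      (∏ i ∈ Finset.range k, (-((i + 1 : ℝ) * (n + 2 * w + i)))) • V + s • Z := by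
  induction k generalizing V with
  | zero => exact ⟨0, by simp [yPow]⟩
  | succ k ih =>
    obtain ⟨Z, hZ⟩ := ih (s • m.yL s t w V - ((k + 1 : ℝ) * (n + 2 * w + k)) • V)
    refine ⟨(∏ i ∈ Finset.range k, (-((i + 1 : ℝ) * (n + 2 * w + i)))) • m.yL s t w V + Z, ?_⟩
    have e : w + ((k + 1 : ℕ) : ℝ) - 1 = w + k := by push_cast; ring
    have h2 : m.yL s t (w + ((k + 1 : ℕ) : ℝ)) (s ^ (k + 1) • V) =
        s ^ k • (s • m.yL s t w V - ((k + 1 : ℝ) * (n + 2 * w + k)) • V) := by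
      push_cast
      rw [yL_pow_smul m h0 ht, smul_sub, smul_smul, ← pow_succ, smul_comm (s ^ k)]
    rw [yPow_succ, e, h2, hZ, Finset.prod_range_succ, smul_sub, smul_add, smul_comm s, smul_smul,
      mul_neg, neg_smul]
    abel

/-- Replacing `I⁻²` by 1 costs a factor `s^n`, and fewer than `n` operators remain to lower this
power, so the error stays divisible by `s`. -/
lemma yPow_sub_robinPow (h0 : (n : ℝ) ≠ 0) {s t B : A} (hS : m.scaleSq s = 1 + s ^ n * B)
    (ht : m.scaleSq s * t = 1) (k : ℕ) (hk : k < n) (w : ℝ)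
    (T : Tri n A) : ∃ Z, m.yPow s t k w T = (-1 : ℝ) ^ k • m.robinPow s k w T + s • Z := by
  induction k generalizing w T with
  | zero => exact ⟨0, by simp [yPow, robinPow]⟩
  | succ k ih =>
    have hy : m.yL s t w T = (-1 : ℝ) • m.robin s w T
        + s ^ k • (s ^ (n - k)) • (B * t) • m.robin s w T := by
      have h1 : -t = -1 + s ^ n * (B * t) := by
        rw [hS] at ht; linear_combination -ht
      have h2 : s ^ n = s ^ k * s ^ (n - k) := by rw [← pow_add]; congr 1; omega
      rw [yL_apply, h1, h2]; module
    obtain ⟨Z, hZ⟩ := ih (by omega) (w - 1) (m.robin s w T)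
    obtain ⟨Z', hZ'⟩ := m.yPow_pow_smul h0 ht k (w - 1 - k) (s ^ (n - k) • (B * t) • m.robin s w T)
    have h3 : s ^ (n - k) = s * s ^ (n - k - 1) := by rw [← pow_succ']; congr 1; omega
    rw [sub_add_cancel] at hZ'
    rw [yPow_succ, hy, map_add, hZ', map_smul, hZ, robinPow_succ, pow_succ, h3]
    generalize m.robinPow s k (w - 1) (m.robin s w T) = R
    generalize (∏ i ∈ Finset.range k, (-((i + 1 : ℝ) * (n + 2 * (w - 1 - k) + i)))) = c
    refine ⟨-Z + Z' + c • s ^ (n - k - 1) • (B * t) • m.robin s w T, ?_⟩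
    simp only [smul_add, smul_neg, mul_smul, smul_comm s c]
    module

/-- The Thomas operator applied to `s^n B`. -/
lemma thomas_remainder {s B : A} {k : ℕ} (hn : n = k + 2) (hS : m.scaleSq s = 1 + s ^ n * B) :
    ∃ V Z : Tri n A, V = (0, 0, (-((n : ℝ) * (n - 1))) • B) + s • Z ∧
      ((0, fun e => ((n : ℝ) - 2) • m.D e (m.scaleSq s), -m.lapl (m.scaleSq s)) : Tri n A) =
        s ^ k • V := by
  -- `C` is `d(I²)` with its factor `s^(k+1)` removed; the Laplacian then carries a factor `s^k`.
  set C : Fin n → A := fun a => (n : A) * B * m.D a s + s * m.D a B with hC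
  have hk : (n : A) = k + 2 := by rw [hn]; push_cast; rfl
  have hs : s ^ n = s ^ (k + 2) := by rw [hn]
  have h1 : ∀ a, m.D a (m.scaleSq s) = s ^ (k + 1) * C a := fun a => by
    rw [hS, map_add, Derivation.map_one_eq_zero, Derivation.leibniz, Derivation.leibniz_pow, hC]
    simp only [smul_eq_mul, nsmul_eq_mul]
    have : n - 1 = k + 1 := by omega
    rw [this, hs]; ring
  have h2 : ∀ a b, m.hess (m.scaleSq s) a b = s ^ k * (((k : A) + 1) * m.D a s * C b
      + s * (m.D a (C b) - ∑ c, m.chr c a b * C c)) := fun a b => by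
    simp only [hess, h1]
    rw [Derivation.leibniz, Derivation.leibniz_pow]
    simp only [smul_eq_mul, nsmul_eq_mul, mul_left_comm _ (s ^ (k + 1)), ← Finset.mul_sum,
      Nat.add_sub_cancel]
    push_cast; ring
  have h3 : m.lapl (m.scaleSq s) = s ^ k * (((k : A) + 1) * ((n : A) * B * m.gradSq s)
      + s * (∑ a, ∑ b, m.gi a b * (((k : A) + 1) * m.D a s * m.D b B
        + (m.D a (C b) - ∑ c, m.chr c a b * C c)))) := by
    simp only [lapl, h2, gradSq, Finset.mul_sum, ← Finset.sum_add_distrib]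
    exact Finset.sum_congr rfl fun a _ => Finset.sum_congr rfl fun b _ => by
      simp only [hC]; ring
  -- Modulo `s` the gradient has length 1, so the leading coefficient of the Laplacian is `(k + 1) n
  -- B = n (n - 1) B`.
  have h4 : m.gradSq s = 1 + s * (s ^ (k + 1) * B - 2 * m.rho s) := by
    have := m.scaleSq_eq s
    rw [hS, hs] at this
    linear_combination -this
  rw [h4] at h3
  refine ⟨_, ⟨0, fun e => ((n : ℝ) - 2) • C e, -(((k : A) + 1) * (n : A) * B
    * (s ^ (k + 1) * B - 2 * m.rho s) + ∑ a, ∑ b, m.gi a b * (((k : A) + 1) * m.D a s * m.D b B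
        + (m.D a (C b) - ∑ c, m.chr c a b * C c)))⟩, rfl, ?_⟩
  refine Prod.ext ?_ (Prod.ext (funext fun b => ?_) ?_)
  · simp
  · simp only [h1, Prod.snd_add, Prod.fst_add, Prod.smul_snd, Prod.smul_fst,
      Pi.smul_apply, smul_eq_mul, zero_add, mul_smul_comm]
    congr 1; ring
  · simp only [h3, Prod.snd_add, Prod.smul_snd, smul_eq_mul,
      Algebra.smul_def (R := ℝ) (A := A), map_neg, map_mul, map_sub, map_natCast, map_one, hk]
    ring

/-- The bracket in the holographic formula, for the scale tractor, modulo `s`. -/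
lemma bracket_scaleI {s t B : A} {k : ℕ} (hk : 1 ≤ k) (hn : n = k + 2)
    (hS : m.scaleSq s = 1 + s ^ n * B) (ht : m.scaleSq s * t = 1) :
    ∃ Z, m.yPow s t (k + 1) 0 (m.scaleI s)
      + (-1 : ℝ) ^ k • m.robinPow s k (-1) (0, 0, m.kExt s) =
      (0, 0, ((n.factorial : ℝ) * k.factorial / 2) • B) + s • Z := by
  have hkR : (n : ℝ) = k + 2 := by rw [hn]; push_cast; rfl
  have hk1 : (1 : ℝ) ≤ k := by exact_mod_cast hk
  have h0 : (n : ℝ) ≠ 0 := by rw [hkR]; positivity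
  have h1 : (n : ℝ) ≠ 1 := by rw [hkR]; linarith
  have h2 : (n : ℝ) ≠ 2 := by rw [hkR]; linarith
  obtain ⟨V, Z, hV, hW⟩ := m.thomas_remainder hn hS
  set X : Tri n A := (0, 0, m.kExt s) with hX
  have hI : m.robin s 0 (m.scaleI s) = X + (1 / 2 : ℝ) • s ^ k • V := by
    rw [robin_scaleI m h0 h1 h2, ← hW, hX]
    refine Prod.ext ?_ (Prod.ext (funext fun b => ?_) ?_)
    · simp
    · simp [smul_smul]; congr 1; ring
    · simp [sub_eq_add_neg]
  -- The correction from `I⁻² ≠ 1` is split as `s^k` times a multiple of `s`: the `k` operators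
  -- still to come use up `s^k` and leave it invisible modulo `s`.
  have hy : m.yL s t 0 (m.scaleI s) = -X - (1 / 2 : ℝ) • s ^ k • V
      + s ^ k • s • (s * (B * t)) • m.robin s 0 (m.scaleI s) := by
    have h1 : -t = -1 + s ^ n * (B * t) := by
      rw [hS] at ht; linear_combination -ht
    have h2 : s ^ n = s ^ k * (s * s) := by rw [hn]; ring
    rw [yL_apply, h1, h2, add_smul, neg_smul, one_smul]
    nth_rw 1 [hI]
    module
  obtain ⟨Z1, hZ1⟩ := m.yPow_sub_robinPow h0 hS ht k (by omega) (-1) X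
  obtain ⟨Z2, hZ2⟩ := m.yPow_pow_smul h0 ht k (-1 - k) V
  obtain ⟨Z3, hZ3⟩ := m.yPow_pow_smul h0 ht k (-1 - k)
    (s • (s * (B * t)) • m.robin s 0 (m.scaleI s))
  rw [sub_add_cancel] at hZ2 hZ3
  -- At this weight and with `n = k + 2`, the `i`-th factor is `(i + 1)(k - i)`.
  have hc : (∏ i ∈ Finset.range k, (-((i + 1 : ℝ) * (n + 2 * (-1 - k) + i)))) =
      (k.factorial : ℝ) * k.factorial := by
    have e1 : ∀ i ∈ Finset.range k, (-((i + 1 : ℝ) * (n + 2 * (-1 - k) + i))) =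
        ((i + 1 : ℕ) : ℝ) * ((k - i : ℕ) : ℝ) := fun i hi => by
      rw [Nat.cast_sub (Finset.mem_range.mp hi).le, hkR]; push_cast; ring
    rw [Finset.prod_congr rfl e1, Finset.prod_mul_distrib]
    congr 1
    · rw [← Nat.cast_prod, Finset.prod_range_add_one_eq_factorial]
    · rw [← Finset.prod_range_reflect, ← Finset.prod_range_add_one_eq_factorial, Nat.cast_prod]
      refine Finset.prod_congr rfl fun i hi => ?_
      have := Finset.mem_range.mp hi
      congr 1; omega
  rw [hc] at hZ2 hZ3
  have hfac : (n.factorial : ℝ) = n * (n - 1) * k.factorial := by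
    rw [hkR, hn, Nat.factorial_succ, Nat.factorial_succ]; push_cast; ring
  -- Uses `n (n - 1) k! = n!`; the minus sign of `V` is cancelled by the minus sign in `y`.
  have hVB : ((k.factorial : ℝ) * k.factorial) • (1 / 2 : ℝ) • V =
      -((0, 0, ((n.factorial : ℝ) * k.factorial / 2) • B) : Tri n A)
        + s • (((k.factorial : ℝ) * k.factorial) • (1 / 2 : ℝ) • Z) := by
    rw [hV, smul_add, smul_add, hfac, smul_comm s, smul_comm s]
    congr 1
    refine Prod.ext ?_ (Prod.ext (funext fun b => ?_) ?_)
    · simp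
    · simp
    · simp only [Prod.smul_snd, Prod.snd_neg, smul_smul, ← neg_smul]
      congr 1; ring
  have e0 : (0 : ℝ) - 1 = -1 := by ring
  refine ⟨-Z1 - (((k.factorial : ℝ) * k.factorial) • (1 / 2 : ℝ) • Z) - (1 / 2 : ℝ) • Z2
    + ((k.factorial : ℝ) * k.factorial) • (s * (B * t)) • m.robin s 0 (m.scaleI s) + Z3, ?_⟩
  rw [yPow_succ, hy, e0, map_add, map_sub, map_neg, map_smul, hZ1, hZ2, hZ3]
  rw [smul_add (1 / 2 : ℝ), smul_comm (1 / 2 : ℝ), hVB]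
  simp only [smul_add, smul_sub, smul_neg, smul_comm s (_ : ℝ)]
  abel

end MetricAlg

namespace MetricAlg

variable {n : ℕ} {A : Type*} [CommRing A] [Algebra ℝ A] (m : MetricAlg n A)

/-! ## Orders of vanishing along the zero locus -/

/-- The elements of `p ∩ q` whose derivatives lie in `q`. -/
def vanStep (p q : Ideal A) : Ideal A where
  carrier := {f | f ∈ p ∧ f ∈ q ∧ ∀ a, m.D a f ∈ q}
  add_mem' hf hg := ⟨p.add_mem hf.1 hg.1, q.add_mem hf.2.1 hg.2.1, fun a => by
    rw [map_add]; exact q.add_mem (hf.2.2 a) (hg.2.2 a)⟩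
  zero_mem' := ⟨p.zero_mem, q.zero_mem, fun a => by rw [map_zero]; exact q.zero_mem⟩
  smul_mem' c f hf := ⟨p.mul_mem_left c hf.1, q.mul_mem_left c hf.2.1, fun a => by
    rw [smul_eq_mul, Derivation.leibniz]
    exact q.add_mem (q.mul_mem_left _ (hf.2.2 a)) (q.mul_mem_right _ hf.2.1)⟩

/-- The ideal of elements that lie in `p` with all derivatives of order less than `k`. -/
def van (p : Ideal A) : ℕ → Ideal A
  | 0 => ⊤
  | k + 1 => m.vanStep p (van p k)

variable {p : Ideal A}

lemma mem_van_one {f : A} : f ∈ m.van p 1 ↔ f ∈ p :=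
  ⟨fun h => h.1, fun h => ⟨h, Submodule.mem_top, fun _ => Submodule.mem_top⟩⟩

/-- The derivative along the vector field `ξ`. -/
def along (ξ : Fin n → A) (f : A) : A := ∑ b, ξ b * m.D b f

lemma along_mul (ξ : Fin n → A) (f g : A) :
    m.along ξ (f * g) = f * m.along ξ g + g * m.along ξ f := by
  simp only [along, Derivation.leibniz, smul_eq_mul, Finset.mul_sum, ← Finset.sum_add_distrib]
  exact Finset.sum_congr rfl fun _ _ => by ring

lemma along_sub (ξ : Fin n → A) (f g : A) :
    m.along ξ (f - g) = m.along ξ f - m.along ξ g := by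
  simp only [along, map_sub, mul_sub, Finset.sum_sub_distrib]

lemma along_real_smul (ξ : Fin n → A) (r : ℝ) (f : A) :
    m.along ξ (r • f) = r • m.along ξ f := by
  simp only [along, Derivation.map_smul, mul_smul_comm, Finset.smul_sum]

lemma D_along (ξ : Fin n → A) (f : A) (a : Fin n) :
    m.D a (m.along ξ f) = m.along ξ (m.D a f) + ∑ b, m.D a (ξ b) * m.D b f := by
  simp only [along, map_sum, Derivation.leibniz, smul_eq_mul, ← Finset.sum_add_distrib]
  exact Finset.sum_congr rfl fun b _ => by rw [m.comm a b]; ring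

/-- `p` behaves like the ideal of functions that vanish on the regular zero locus of `s`: the
field `ξ` is transversal to it, and the differential of an element of `p` is proportional to that
of `s` along it. -/
structure IsZeroLocus (p : Ideal A) (s : A) (ξ : Fin n → A) : Prop where
  mem : s ∈ p
  along_eq : m.along ξ s = 1
  D_mem : ∀ f ∈ p, ∀ a, m.D a f - m.D a s * m.along ξ f ∈ p

variable {m} {s : A} {ξ : Fin n → A}

/-- Tangential derivatives of elements of `p` stay in `p`, so the order of vanishing is controlled
by the transversal derivative alone. The commutator of `ξ` with a partial derivative is of first
order, hence harmless in the induction. -/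
lemma mem_van_of_along (h : m.IsZeroLocus p s ξ) {k : ℕ} {r : A} (hr : r ∈ p)
    (hX : m.along ξ r ∈ m.van p k) : r ∈ m.van p (k + 1) := by
  induction k generalizing r with
  | zero => exact m.mem_van_one.mpr hr
  | succ k ih =>
    have hr' := ih hr hX.2.1
    refine ⟨hr, hr', fun a => ih ?_ ?_⟩
    · have := p.add_mem (h.D_mem r hr a) (p.mul_mem_left (m.D a s) hX.1)
      rwa [sub_add_cancel] at this
    · have e := m.D_along ξ r a
      rw [← sub_eq_iff_eq_add] at e
      rw [← e]
      exact Ideal.sub_mem _ (hX.2.2 a)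
        (Ideal.sum_mem _ fun b _ => Ideal.mul_mem_left _ _ (hr'.2.2 b))

lemma along_pow (h : m.IsZeroLocus p s ξ) (k : ℕ) :
    m.along ξ (s ^ (k + 1)) = ((k : ℝ) + 1) • s ^ k := by
  induction k with
  | zero => simpa using h.along_eq
  | succ k ih =>
    rw [pow_succ', along_mul, ih, h.along_eq, mul_smul_comm, ← pow_succ', mul_one]
    simp only [Nat.cast_add, Nat.cast_one, add_smul, one_smul]

lemma pow_mem_van (h : m.IsZeroLocus p s ξ) (k : ℕ) : s ^ k ∈ m.van p k := by
  induction k with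
  | zero => exact Submodule.mem_top
  | succ k ih =>
    refine mem_van_of_along h (Ideal.pow_mem_of_mem _ h.mem _ (Nat.succ_pos k)) ?_
    rw [along_pow h, Algebra.smul_def]
    exact Ideal.mul_mem_left _ _ ih

/-- Elements of `p` are divisible by `s` up to any order. -/
lemma exists_sub_mul_mem_van (h : m.IsZeroLocus p s ξ) {f : A} (hf : f ∈ p) (k : ℕ) :
    ∃ u, f - s * u ∈ m.van p k := by
  -- A formal substitute for Hadamard's lemma: rather than dividing exactly, the quotient is
  -- improved one order at a time.
  have key : ∀ k, ∃ u w, m.along ξ (f - s * u) = s ^ k * w := by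
    intro k
    induction k with
    | zero => exact ⟨0, _, (by rw [pow_zero, one_mul])⟩
    | succ k ih =>
      obtain ⟨u, w, hu⟩ := ih
      -- The new term integrates `s^k w` along `ξ`, since `ξ s^(k+1) = (k + 1) s^k`; only the
      -- derivative of `w` is left over, one order higher.
      refine ⟨u + ((k : ℝ) + 1)⁻¹ • (s ^ k * w), -(((k : ℝ) + 1)⁻¹ • m.along ξ w), ?_⟩
      have e : f - s * (u + ((k : ℝ) + 1)⁻¹ • (s ^ k * w)) =
          (f - s * u) - ((k : ℝ) + 1)⁻¹ • (s ^ (k + 1) * w) := by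
        rw [mul_add, mul_smul_comm, ← mul_assoc, ← pow_succ']; ring
      have hk : ((k : ℝ) + 1) ≠ 0 := by positivity
      rw [e, along_sub, along_real_smul, along_mul, along_pow h, hu, mul_smul_comm, smul_add,
        smul_smul, inv_mul_cancel₀ hk, one_smul, mul_neg, mul_smul_comm]
      ring
  obtain ⟨u, w, hu⟩ := key k
  refine ⟨u, ?_⟩
  have h1 : f - s * u ∈ m.van p (k + 1) := by
    refine mem_van_of_along h (p.sub_mem hf (p.mul_mem_right _ h.mem)) ?_
    rw [hu]
    exact Ideal.mul_mem_right _ _ (pow_mem_van h k)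
  exact h1.2.1

variable (m)

/-- Tractors with components in `van p k`. -/
def vanT (p : Ideal A) (k : ℕ) : Submodule A (Tri n A) where
  carrier := {T | T.1 ∈ m.van p k ∧ (∀ a, T.2.1 a ∈ m.van p k) ∧ T.2.2 ∈ m.van p k}
  add_mem' hS hT := ⟨Ideal.add_mem _ hS.1 hT.1, fun a => Ideal.add_mem _ (hS.2.1 a) (hT.2.1 a),
    Ideal.add_mem _ hS.2.2 hT.2.2⟩
  zero_mem' := ⟨Ideal.zero_mem _, fun _ => Ideal.zero_mem _, Ideal.zero_mem _⟩
  smul_mem' c _ hT := ⟨Ideal.mul_mem_left _ c hT.1, fun a => Ideal.mul_mem_left _ c (hT.2.1 a),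
    Ideal.mul_mem_left _ c hT.2.2⟩

variable {m}

lemma vanT_succ_le {k : ℕ} {T : Tri n A} (h : T ∈ m.vanT p (k + 1)) : T ∈ m.vanT p k :=
  ⟨h.1.2.1, fun a => (h.2.1 a).2.1, h.2.2.2.1⟩

lemma real_smul_mem_vanT {k : ℕ} {T : Tri n A} (r : ℝ) (h : T ∈ m.vanT p k) :
    r • T ∈ m.vanT p k := by
  rw [← algebraMap_smul A r T]
  exact Submodule.smul_mem _ _ h

lemma nab_mem_vanT {k : ℕ} {T : Tri n A} (h : T ∈ m.vanT p (k + 1)) (a : Fin n) :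
    m.nab a T ∈ m.vanT p k := by
  have h' := vanT_succ_le h
  refine ⟨Ideal.sub_mem _ (h.1.2.2 a) (h'.2.1 a), fun b => ?_, ?_⟩
  · exact Ideal.add_mem _ (Ideal.add_mem _ (Ideal.sub_mem _ ((h.2.1 b).2.2 a)
      (Ideal.sum_mem _ fun c _ => Ideal.mul_mem_left _ _ (h'.2.1 c)))
      (Ideal.mul_mem_left _ _ h'.2.2)) (Ideal.mul_mem_left _ _ h'.1)
  · exact Ideal.sub_mem _ (h.2.2.2.2 a) (Ideal.sum_mem _ fun c _ => Ideal.sum_mem _ fun e _ =>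
      Ideal.mul_mem_left _ _ (h'.2.1 e))

lemma robin_mem_vanT {k : ℕ} {T : Tri n A} (h : T ∈ m.vanT p (k + 2)) (s : A) (w : ℝ) :
    m.robin s w T ∈ m.vanT p k := by
  have h1 := vanT_succ_le h
  have h0 := vanT_succ_le h1
  refine Submodule.add_mem _ (Submodule.add_mem _ ?_ ?_) ?_
  · refine Submodule.smul_mem _ _ (Submodule.neg_mem _ (Submodule.add_mem _ ?_
      (Submodule.smul_mem _ _ h0)))
    exact Submodule.sum_mem _ fun a _ => Submodule.sum_mem _ fun b _ => Submodule.smul_mem _ _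
      (Submodule.sub_mem _ (nab_mem_vanT (nab_mem_vanT h b) a)
        (Submodule.sum_mem _ fun c _ => Submodule.smul_mem _ _ (nab_mem_vanT h1 c)))
  · exact Submodule.sum_mem _ fun a _ => Submodule.sum_mem _ fun b _ => Submodule.smul_mem _ _
      (Submodule.smul_mem _ _ (real_smul_mem_vanT _ (nab_mem_vanT h1 b)))
  · exact Submodule.smul_mem _ _ (real_smul_mem_vanT _ h0)

/-- A crude count, two orders for each second-order operator. It suffices because division by `s` is
available to every order. -/
lemma yPow_mem_vanT {k j : ℕ} {T : Tri n A} (h : T ∈ m.vanT p (j + 2 * k)) (s t : A) (w : ℝ) :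
    m.yPow s t k w T ∈ m.vanT p j := by
  induction k generalizing w T with
  | zero => exact h
  | succ k ih => exact ih (Submodule.smul_mem _ _ (robin_mem_vanT h s w)) _

lemma smul_mem_vanT_one (h : m.IsZeroLocus p s ξ) (Z : Tri n A) : s • Z ∈ m.vanT p 1 :=
  ⟨m.mem_van_one.mpr (p.mul_mem_right _ h.mem), fun _ => m.mem_van_one.mpr
    (p.mul_mem_right _ h.mem), m.mem_van_one.mpr (p.mul_mem_right _ h.mem)⟩

lemma exists_sub_smul_mem_vanT (h : m.IsZeroLocus p s ξ) {T : Tri n A} (hT : T ∈ m.vanT p 1)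
    (k : ℕ) : ∃ U, T - s • U ∈ m.vanT p k := by
  obtain ⟨u1, h1⟩ := exists_sub_mul_mem_van h (m.mem_van_one.mp hT.1) k
  choose u2 h2 using fun a => exists_sub_mul_mem_van h (m.mem_van_one.mp (hT.2.1 a)) k
  obtain ⟨u3, h3⟩ := exists_sub_mul_mem_van h (m.mem_van_one.mp hT.2.2) k
  exact ⟨(u1, u2, u3), h1, h2, h3⟩

/-- The bracket in the holographic formula, for any extension of the scale tractor. -/
theorem bracket_mem {t B : A} {k : ℕ} (h : m.IsZeroLocus p s ξ) (hk : 1 ≤ k) (hn : n = k + 2)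
    (hS : m.scaleSq s = 1 + s ^ n * B) (ht : m.scaleSq s * t = 1) {N : Tri n A}
    (hN : N - m.scaleI s ∈ m.vanT p 1) :
    m.yPow s t (k + 1) 0 N + (-1 : ℝ) ^ k • m.robinPow s k (-1) (0, 0, m.kExt s)
      - (0, 0, ((n.factorial : ℝ) * k.factorial / 2) • B) ∈ m.vanT p 1 := by
  have hkR : (n : ℝ) = k + 2 := by rw [hn]; push_cast; rfl
  have h0 : (n : ℝ) ≠ 0 := by rw [hkR]; positivity
  -- The order is chosen so that `k + 1` applications of the operator still leave vanishing along
  -- the zero locus.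
  obtain ⟨U, hU⟩ := exists_sub_smul_mem_vanT h hN (1 + 2 * (k + 1))
  obtain ⟨Z, hZ⟩ := m.bracket_scaleI hk hn hS ht
  have e1 := yPow_mem_vanT hU s t 0
  have e2 := m.yPow_smul h0 ht k (-1) U
  -- Criticality of weight 0 for the power `n - 1`: the commutator with `s` vanishes, so `s • U`
  -- contributes nothing along the zero locus.
  have e3 : ((k + 1 : ℝ) * (n + 2 * (-1) - k)) = 0 := by rw [hkR]; ring
  rw [e3, zero_smul, sub_zero, neg_add_cancel] at e2
  rw [map_sub, map_sub, e2] at e1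
  have e4 := Submodule.add_mem _ e1 (smul_mem_vanT_one h (m.yPow s t (k + 1) (-1) U + Z))
  convert e4 using 1
  rw [← sub_eq_iff_eq_add'] at hZ
  rw [smul_add, ← hZ]
  abel

/-! ## The mean curvature -/

variable (m)

/-- The normal vector of the zero locus of `s`, where `ri = 1 / |ds|`. -/
def normalUp (s ri : A) (a : Fin n) : A := ∑ b, m.gi a b * (m.D b s * ri)

/-- The mean curvature of the zero locus of `s`, where `ri = 1 / |ds|`. -/
def meanCurv (s ri : A) : A := (1 / ((n : ℝ) - 1)) • ∑ a, ∑ b,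
  (m.gi a b - m.normalUp s ri a * m.normalUp s ri b) *
    (m.D a (m.D b s * ri) - ∑ c, m.chr c a b * (m.D c s * ri))

lemma D_gradSq (s : A) (e : Fin n) :
    m.D e (m.gradSq s) = 2 * ∑ a, ∑ b, m.gi a b * (m.D a s * m.hess s e b) := by
  have h : ∑ a, ∑ b, m.gi a b * (m.D a s * m.hess s e b) =
      ∑ a, ∑ b, m.gi a b * (m.D b s * m.hess s e a) := by
    rw [Finset.sum_comm]
    exact Finset.sum_congr rfl fun a _ => Finset.sum_congr rfl fun b _ => by rw [m.gi_symm]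
  rw [two_mul]
  nth_rw 2 [h]
  rw [gradSq, ← sum_gi_D]
  simp only [← Finset.sum_add_distrib, hess]
  refine Finset.sum_congr rfl fun a _ => Finset.sum_congr rfl fun b _ => ?_
  simp only [Derivation.leibniz, smul_eq_mul, mul_sub, mul_left_comm _ (m.D a s),
    ← Finset.mul_sum]
  simp only [← mul_assoc, ← Finset.sum_mul]
  ring

/-- Along the zero locus of a unit scale, the mean curvature is minus the bottom slot of the
scale tractor. -/
lemma meanCurv_eq (h1 : (n : ℝ) ≠ 1) (hn : 2 ≤ n) {s B r ri : A}
    (hS : m.scaleSq s = 1 + s ^ n * B) (hr : r * r = m.gradSq s) (hri : r * ri = 1) :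
    ∃ Z, m.meanCurv s ri = -(m.rho s * ri) + s * Z := by
  have h0 : (n : ℝ) ≠ 0 := by positivity
  set v : Fin n → A := fun a => ∑ b, m.gi a b * m.D b s with hv
  have hnu : ∀ a, m.normalUp s ri a = ri * v a := fun a => by
    simp only [normalUp, hv, Finset.mul_sum]
    exact Finset.sum_congr rfl fun b _ => by ring
  have hq : ∑ b, v b * m.D b s = m.gradSq s := by
    simp only [hv, gradSq, Finset.sum_mul]
    refine Finset.sum_congr rfl fun a _ => Finset.sum_congr rfl fun b _ => by ring
  have hqri : ri * ri * m.gradSq s = 1 := by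
    rw [← hr]; linear_combination (r * ri + 1) * hri
  have hcov : ∀ a b, m.D a (m.D b s * ri) - ∑ c, m.chr c a b * (m.D c s * ri) =
      ri * m.hess s a b + m.D b s * m.D a ri := fun a b => by
    simp only [Derivation.leibniz, smul_eq_mul, hess, mul_sub, ← mul_assoc, ← Finset.sum_mul]
    ring
  set w : A := ∑ a, v a * m.D a ri with hw
  set vvh : A := ∑ a, ∑ b, v a * v b * m.hess s a b with hvvh
  have hsum : ∑ a, ∑ b, (m.gi a b - m.normalUp s ri a * m.normalUp s ri b) *
      (m.D a (m.D b s * ri) - ∑ c, m.chr c a b * (m.D c s * ri)) =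
      ri * m.lapl s - ri * ri * ri * vvh := by
    have e1 : ∑ a, ∑ b, m.gi a b * (m.D b s * m.D a ri) = w := by
      simp only [hw, hv, Finset.sum_mul]
      exact Finset.sum_congr rfl fun a _ => Finset.sum_congr rfl fun b _ => by ring
    have e2 : ∑ a, ∑ b, v a * v b * (m.D b s * m.D a ri) = m.gradSq s * w := by
      rw [← hq, mul_comm, Finset.sum_comm]
      simp only [hw, Finset.sum_mul, Finset.mul_sum]
      exact Finset.sum_congr rfl fun a _ => Finset.sum_congr rfl fun b _ => by ring
    -- The derivatives of `ri = 1 / |ds|` contribute `w - ri² |ds|² w`, which is zero because the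
    -- projection annihilates the conormal.
    have e3 : ∑ a, ∑ b, (m.gi a b - m.normalUp s ri a * m.normalUp s ri b) *
      (m.D a (m.D b s * ri) - ∑ c, m.chr c a b * (m.D c s * ri)) =
      ri * m.lapl s + ∑ a, ∑ b, m.gi a b * (m.D b s * m.D a ri) - ri * ri * ri * vvh
        - ri * ri * ∑ a, ∑ b, v a * v b * (m.D b s * m.D a ri) := by
      simp only [hcov, hnu, lapl, hvvh, Finset.mul_sum, ← Finset.sum_add_distrib,
        ← Finset.sum_sub_distrib]
      exact Finset.sum_congr rfl fun a _ => Finset.sum_congr rfl fun b _ => by ring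
    rw [e3, e1, e2]
    linear_combination (-w) * hqri
  have hDq : ∑ e, v e * m.D e (m.gradSq s) = 2 * vvh := by
    simp only [D_gradSq, hvvh, Finset.mul_sum]
    refine Finset.sum_congr rfl fun e _ => ?_
    rw [Finset.sum_comm]
    refine Finset.sum_congr rfl fun b _ => ?_
    have hvb : v b = ∑ a, m.gi b a * m.D a s := rfl
    rw [hvb]
    simp only [Finset.mul_sum, Finset.sum_mul]
    exact Finset.sum_congr rfl fun a _ => by rw [m.gi_symm a b]; ring
  have hs : s ^ n = s * s * s ^ (n - 2) := by
    rw [← pow_two, ← pow_add]; congr 1; omega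
  have hgrad : m.gradSq s = 1 + s * (s * (s ^ (n - 2) * B) - 2 * m.rho s) := by
    have := m.scaleSq_eq s
    rw [hS, hs] at this
    linear_combination -this
  set G : A := s ^ (n - 2) * B
  -- From `|ds|² = 1 - 2 s rho + O(s²)` one gets `d|ds|² = -2 rho ds + O(s)`. This determines the
  -- Hessian in the normal direction modulo `s`.
  have hDe : ∀ e, m.D e (m.gradSq s) =
      -(2 * m.rho s * m.D e s) + s * (2 * G * m.D e s + s * m.D e G - 2 * m.D e (m.rho s)) :=
      fun e => by
    have h2 : m.D e (2 : A) = 0 := Derivation.map_natCast (m.D e) 2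
    rw [hgrad]
    simp only [map_add, map_sub, Derivation.map_one_eq_zero, Derivation.leibniz, smul_eq_mul, h2]
    ring
  obtain ⟨Y, hY⟩ : ∃ Y, (2 : A) * vvh = -(2 * m.rho s * m.gradSq s) + s * Y := by
    refine ⟨∑ e, v e * (2 * G * m.D e s + s * m.D e G - 2 * m.D e (m.rho s)), ?_⟩
    conv_rhs => rw [← hq]
    rw [← hDq, Finset.mul_sum, Finset.mul_sum, ← Finset.sum_neg_distrib,
      ← Finset.sum_add_distrib]
    exact Finset.sum_congr rfl fun e _ => by rw [hDe]; ring
  have hvvh' : vvh = -(m.rho s * m.gradSq s) + s * ((1 / 2 : ℝ) • Y) := by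
    have hhY : (1 / 2 : ℝ) • Y + (1 / 2 : ℝ) • Y = Y := by module
    refine smul_right_injective A (two_ne_zero (α := ℝ)) ?_
    simp only [two_smul]
    linear_combination hY - s * hhY
  have hl : m.lapl s = -((n : A) * m.rho s) - m.J * s := by
    rw [natCast_smul_rho m h0]; ring
  refine ⟨(1 / ((n : ℝ) - 1)) • (-(ri * m.J) - ri * ri * ri * ((1 / 2 : ℝ) • Y)), ?_⟩
  -- The trace gives `-n rho` and the normal direction returns `rho`; dividing by `n - 1` leaves
  -- `-rho`.
  have hfin : ri * m.lapl s - ri * ri * ri * vvh = -(((n : ℝ) - 1) • (m.rho s * ri))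
      + s * (-(ri * m.J) - ri * ri * ri * ((1 / 2 : ℝ) • Y)) := by
    rw [hl, hvvh', Algebra.smul_def ((n : ℝ) - 1), map_sub, map_natCast, map_one]
    linear_combination (ri * m.rho s) * hqri
  rw [meanCurv, hsum, hfin, smul_add, smul_neg, smul_smul,
    one_div_mul_cancel (sub_ne_zero.mpr h1), one_smul,
    mul_smul_comm (1 / ((n : ℝ) - 1)) s]

end MetricAlg

/-! ## The algebra of smooth functions on an open set -/

open TopologicalSpace (Opens)

section SmoothAlg

variable {n : ℕ} {U : Opens (Coord n)}

/-- The extension by zero of a function on `U`. -/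
def extendZero (f : U → ℝ) (x : Coord n) : ℝ := open Classical in if h : x ∈ U then f ⟨x, h⟩ else 0

lemma extendZero_coe (f : U → ℝ) (x : U) : extendZero f x = f x := dif_pos x.2

lemma extendZero_eqOn {f : U → ℝ} {F : Coord n → ℝ} (h : ∀ x : U, F x = f x) :
    Set.EqOn (extendZero f) F U := fun x hx => by
  rw [h ⟨x, hx⟩]; exact extendZero_coe f ⟨x, hx⟩

variable (U) in
/-- The algebra of smooth functions on `U`. -/
def smoothAlg : Subalgebra ℝ (U → ℝ) where
  carrier := {f | ContDiffOn ℝ ∞ (extendZero f) U}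
  mul_mem' {f g} hf hg := (hf.mul hg).congr (extendZero_eqOn fun x => by
    simp [extendZero_coe])
  add_mem' {f g} hf hg := (hf.add hg).congr (extendZero_eqOn fun x => by
    simp [extendZero_coe])
  algebraMap_mem' r := (contDiffOn_const (c := r)).congr (extendZero_eqOn fun _ => rfl)

/-- Evaluation of smooth functions at a point. -/
def ev (x : U) : smoothAlg U →ₐ[ℝ] ℝ := (Pi.evalAlgHom ℝ (fun _ : U => ℝ) x).comp (smoothAlg U).val

lemma ext_ev {f g : smoothAlg U} (h : ∀ x, ev x f = ev x g) : f = g :=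
  Subtype.ext (funext h)

/-- The function `F` is represented by `f` on `U`. -/
def Rep (F : Coord n → ℝ) (f : smoothAlg U) : Prop := ∀ x : U, F x = ev x f

/-- The element of `smoothAlg U` given by a function that is smooth on `U`. -/
def ofSmooth (F : Coord n → ℝ) (hF : ContDiffOn ℝ ∞ F U) : smoothAlg U :=
  ⟨fun x => F x, hF.congr (extendZero_eqOn fun _ => rfl)⟩

lemma rep_ofSmooth {F : Coord n → ℝ} (hF : ContDiffOn ℝ ∞ F U) : Rep F (ofSmooth F hF) :=
  fun _ => rfl

lemma Rep.contDiffOn {F : Coord n → ℝ} {f : smoothAlg U} (h : Rep F f) : ContDiffOn ℝ ∞ F U :=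
  f.2.congr fun _ hx => ((extendZero_eqOn h) hx).symm

lemma pd_congr {F F' : Coord n → ℝ} (h : Set.EqOn F F' U) (a : Fin n) (x : U) :
    pd F a x = pd F' a x := by
  have : F =ᶠ[nhds (x : Coord n)] F' := h.eventuallyEq_of_mem (U.isOpen.mem_nhds x.2)
  rw [pd, pd, this.fderiv_eq]

lemma contDiffOn_pd {F : Coord n → ℝ} (h : ContDiffOn ℝ ∞ F U) (a : Fin n) :
    ContDiffOn ℝ ∞ (pd F a) U :=
  (h.fderiv_of_isOpen U.isOpen (by simp)).clm_apply contDiffOn_const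

lemma ContDiffOn.differentiableAt_coe {F : Coord n → ℝ} (h : ContDiffOn ℝ ∞ F U) (x : U) :
    DifferentiableAt ℝ F x :=
  (h.differentiableOn (by simp)).differentiableAt (U.isOpen.mem_nhds x.2)

lemma pd_comm {F : Coord n → ℝ} (h : ContDiffOn ℝ ∞ F U) (a b : Fin n) (x : U) :
    pd (pd F b) a x = pd (pd F a) b x := by
  have hx : ContDiffAt ℝ ∞ F x := h.contDiffAt (U.isOpen.mem_nhds x.2)
  have hd : DifferentiableAt ℝ (fderiv ℝ F) x :=
    (hx.fderiv_right (m := 1) (by norm_cast)).differentiableAt (by simp)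
  have key : ∀ a b, pd (pd F b) a x =
      fderiv ℝ (fderiv ℝ F) x (EuclideanSpace.single a 1) (EuclideanSpace.single b 1) := by
    intro a b
    have : pd F b = fun y => fderiv ℝ F y (EuclideanSpace.single b 1) := rfl
    rw [pd, this, fderiv_clm_apply hd (differentiableAt_const _)]
    simp
  rw [key, key]
  exact (hx.isSymmSndFDerivAt (by
    simpa using WithTop.coe_le_coe.mpr (le_top : (2 : ℕ∞) ≤ ⊤))).eq _ _

lemma rep_extendZero (f : smoothAlg U) : Rep (extendZero f.1) f := fun x => extendZero_coe f.1 x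

/-- The partial derivative of a smooth function. -/
def partialFun (a : Fin n) (f : smoothAlg U) : smoothAlg U :=
  ofSmooth (pd (extendZero f.1) a) (contDiffOn_pd f.2 a)

lemma Rep.partialFun {F : Coord n → ℝ} {f : smoothAlg U} (h : Rep F f) (a : Fin n) :
    Rep (pd F a) (partialFun a f) := fun x =>
  (pd_congr (extendZero_eqOn (f := f.1) h) a x).symm

variable (f g : smoothAlg U) (a : Fin n)

lemma partialFun_add : partialFun a (f + g) = partialFun a f + partialFun a g :=
  ext_ev fun x => by
    have h : Rep (extendZero f.1 + extendZero g.1) (f + g) := fun y => by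
      rw [map_add, Pi.add_apply, rep_extendZero f y, rep_extendZero g y]
    rw [map_add, ← h.partialFun a x, ← (rep_extendZero f).partialFun a x,
      ← (rep_extendZero g).partialFun a x]
    simp only [pd]
    rw [fderiv_add (ContDiffOn.differentiableAt_coe f.2 x)
      (ContDiffOn.differentiableAt_coe g.2 x)]
    rfl

lemma partialFun_smul (r : ℝ) : partialFun a (r • f) = r • partialFun a f :=
  ext_ev fun x => by
    have h : Rep (r • extendZero f.1) (r • f) := fun y => by
      rw [map_smul, Pi.smul_apply, rep_extendZero f y]
    rw [map_smul, ← h.partialFun a x, ← (rep_extendZero f).partialFun a x]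
    simp only [pd]
    rw [fderiv_const_smul (ContDiffOn.differentiableAt_coe f.2 x)]
    rfl

lemma partialFun_mul :
    partialFun a (f * g) = f • partialFun a g + g • partialFun a f :=
  ext_ev fun x => by
    have h : Rep (extendZero f.1 * extendZero g.1) (f * g) := fun y => by
      rw [map_mul, Pi.mul_apply, rep_extendZero f y, rep_extendZero g y]
    rw [smul_eq_mul, smul_eq_mul, map_add, map_mul, map_mul, ← h.partialFun a x,
      ← (rep_extendZero f).partialFun a x, ← (rep_extendZero g).partialFun a x,
      ← rep_extendZero f x, ← rep_extendZero g x]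
    simp only [pd]
    rw [fderiv_mul (ContDiffOn.differentiableAt_coe f.2 x)
      (ContDiffOn.differentiableAt_coe g.2 x)]
    rfl

/-- The partial derivatives as derivations. -/
def partialD (a : Fin n) : Derivation ℝ (smoothAlg U) (smoothAlg U) :=
  Derivation.mk'
    { toFun := partialFun a
      map_add' := fun f g => partialFun_add f g a
      map_smul' := fun r f => partialFun_smul f a r }
    fun f g => partialFun_mul f g a

variable {f g a}

lemma Rep.pd {F : Coord n → ℝ} (h : Rep F f) (a : Fin n) :
    Rep (pd F a) (partialD a f) := h.partialFun a

lemma partialD_comm (a b : Fin n) (f : smoothAlg U) :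
    partialD a (partialD b f) = partialD b (partialD a f) := ext_ev fun x => by
  have h := rep_extendZero f
  rw [← (h.pd b).pd a x, ← (h.pd a).pd b x, pd_comm f.2]

/-- A metric whose components are smooth on `U`. -/
structure IsMetricOn (G : MetricField n) (U : Opens (Coord n)) : Prop where
  smooth : ∀ a b, ContDiffOn ℝ ∞ (fun x => G x a b) U
  symm : ∀ x ∈ U, (G x).transpose = G x
  posDef : ∀ x ∈ U, (G x).PosDef

lemma IsMetricOn.mono {G : MetricField n} {V : Opens (Coord n)} (h : IsMetricOn G U)
    (hV : V ≤ U) : IsMetricOn G V :=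
  ⟨fun a b => (h.smooth a b).mono hV, fun x hx => h.symm x (hV hx),
    fun x hx => h.posDef x (hV hx)⟩

lemma contDiffOn_det {k : ℕ} {G : Coord n → Matrix (Fin k) (Fin k) ℝ} {S : Set (Coord n)}
    (h : ∀ a b, ContDiffOn ℝ ∞ (fun x => G x a b) S) : ContDiffOn ℝ ∞ (fun x => (G x).det) S := by
  simp only [Matrix.det_apply']
  exact ContDiffOn.sum fun σ _ => contDiffOn_const.mul (contDiffOn_prod fun i _ => h _ _)

lemma IsMetricOn.det_ne_zero {G : MetricField n} (h : IsMetricOn G U) (x : U) :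
    (G x).det ≠ 0 := (h.posDef x x.2).det_pos.ne'

lemma IsMetricOn.smooth_inv {G : MetricField n} (h : IsMetricOn G U) (a b : Fin n) :
    ContDiffOn ℝ ∞ (fun x => (G x)⁻¹ a b) U := by
  have h1 : ContDiffOn ℝ ∞ (fun x => ((G x).det)⁻¹ * (G x).adjugate a b) U := by
    refine ((contDiffOn_det h.smooth).inv fun x hx => h.det_ne_zero ⟨x, hx⟩).mul ?_
    simp only [Matrix.adjugate_apply]
    refine contDiffOn_det fun c e => ?_
    by_cases hc : c = b
    · subst hc; simpa using contDiffOn_const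
    · simpa [Matrix.updateRow_ne hc] using h.smooth c e
  refine h1.congr fun x hx => ?_
  rw [Matrix.inv_def, Matrix.smul_apply, Ring.inverse_eq_inv', smul_eq_mul]

/-- The metric algebra of a metric on `U`. -/
def IsMetricOn.alg {G : MetricField n} (h : IsMetricOn G U) : MetricAlg n (smoothAlg U) where
  D := partialD
  comm := partialD_comm
  g := Matrix.of fun a b => ofSmooth (fun x => G x a b) (h.smooth a b)
  gi := Matrix.of fun a b => ofSmooth (fun x => (G x)⁻¹ a b) (h.smooth_inv a b)
  symm := by
    refine Matrix.ext fun a b => ext_ev fun x => ?_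
    exact congrFun (congrFun (h.symm x x.2) a) b
  mul_inv := by
    refine Matrix.ext fun a b => ext_ev fun x => ?_
    rw [Matrix.mul_apply, map_sum]
    have h1 : (G x * (G x)⁻¹) a b = (1 : Matrix (Fin n) (Fin n) ℝ) a b := by
      rw [Matrix.mul_nonsing_inv _ (h.det_ne_zero x).isUnit]
    rw [Matrix.mul_apply, Matrix.one_apply] at h1
    simp only [map_mul, Matrix.one_apply]
    rw [apply_ite (ev x), map_one, map_zero, ← h1]
    rfl

/-! ### Coordinate expressions represented in the algebra of smooth functions -/

section Transfer

variable {G : MetricField n} (h : IsMetricOn G U)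

lemma rep_g (a b : Fin n) : Rep (fun x => G x a b) (h.alg.g a b) := fun _ => rfl

lemma ev_g (x : U) (a b : Fin n) : ev x (h.alg.g a b) = G x a b := rfl

lemma ev_gi (x : U) (a b : Fin n) : ev x (h.alg.gi a b) = (G x)⁻¹ a b := rfl

lemma rep_D {F : Coord n → ℝ} {f : smoothAlg U} (hF : Rep F f) (a : Fin n) :
    Rep (pd F a) (h.alg.D a f) := hF.pd a

lemma rep_chr (c a b : Fin n) : Rep (christoffel G c a b) (h.alg.chr c a b) := fun x => by
  simp only [christoffel, MetricAlg.chr, map_smul, map_sum, map_mul, map_add, map_sub, smul_eq_mul,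
    ev_gi, ← rep_D h (rep_g h _ _) _ x]

lemma rep_riem (a b c e : Fin n) : Rep (riemann G a b c e) (h.alg.riem a b c e) := fun x => by
  simp only [riemann, MetricAlg.riem, map_sum, map_mul, map_add, map_sub,
    ← rep_D h (rep_chr h _ _ _) _ x, ← rep_chr h _ _ _ x]

lemma rep_ric (a b : Fin n) : Rep (ricci G a b) (h.alg.ric a b) := fun x => by
  simp only [ricci, MetricAlg.ric, map_sum, ← rep_riem h _ _ _ _ x]

lemma rep_scal : Rep (scalarCurv G) h.alg.scal := fun x => by
  simp only [scalarCurv, MetricAlg.scal, map_sum, map_mul, ev_gi, ← rep_ric h _ _ x]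

lemma rep_J : Rep (schoutenTrace G) h.alg.J := fun x => by
  rw [schoutenTrace, MetricAlg.J, map_smul, ← rep_scal h x, smul_eq_mul, one_div_mul_eq_div]

/-- Dimension 2 is excluded since `schouten` has a separate convention there; the algebra uses the
general formula. -/
lemma rep_P (hn : n ≠ 2) (a b : Fin n) : Rep (schouten G a b) (h.alg.P a b) := fun x => by
  rw [schouten, if_neg hn, MetricAlg.P, map_smul, map_sub, map_mul, ← rep_ric h _ _ x,
    ← rep_J h x, ev_g, smul_eq_mul, one_div_mul_eq_div]

/-- Evaluation of tractors at a point. -/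
def evT (x : U) : Tri n (smoothAlg U) →ₗ[ℝ] Tri n ℝ where
  toFun T := (ev x T.1, fun a => ev x (T.2.1 a), ev x T.2.2)
  map_add' S T := by simp only [Prod.fst_add, Prod.snd_add, Pi.add_apply, map_add]; rfl
  map_smul' r T := by
    simp only [Prod.smul_fst, Prod.smul_snd, Pi.smul_apply, map_smul]; rfl

lemma evT_apply (x : U) (T : Tri n (smoothAlg U)) :
    evT x T = (ev x T.1, fun a => ev x (T.2.1 a), ev x T.2.2) := rfl

lemma evT_smul (x : U) (f : smoothAlg U) (T : Tri n (smoothAlg U)) :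
    evT x (f • T) = ev x f • evT x T := by
  simp only [evT_apply, Prod.smul_fst, Prod.smul_snd, Pi.smul_apply, smul_eq_mul, map_mul]; rfl

/-- The tractor field `F` is represented by `T` on `U`. -/
def RepT (F : Coord n → Tri n ℝ) (T : Tri n (smoothAlg U)) : Prop := ∀ x : U, F x = evT x T

section
variable {F : Coord n → Tri n ℝ} {T : Tri n (smoothAlg U)}

lemma RepT.top (hF : RepT F T) : Rep (fun x => (F x).1) T.1 := fun x => by
  simp only [hF x]; rfl

lemma RepT.mid (hF : RepT F T) (a : Fin n) : Rep (fun x => (F x).2.1 a) (T.2.1 a) := fun x => by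
  simp only [hF x]; rfl

lemma RepT.bot (hF : RepT F T) : Rep (fun x => (F x).2.2) T.2.2 := fun x => by
  simp only [hF x]; rfl

lemma rep_nab (hn : n ≠ 2) (hF : RepT F T) (a : Fin n) :
    RepT (tractorNabla G F a) (h.alg.nab a T) := fun x => by
  rw [tractorNabla, evT_apply]
  simp only [MetricAlg.nab, map_sub, map_add, map_sum, map_mul, ← rep_D h hF.top _ x,
    ← rep_D h (hF.mid _) _ x, ← rep_D h hF.bot _ x, ← rep_chr h _ _ _ x, ← rep_P h hn _ _ x,
    ev_g, ev_gi, ← hF.top x, ← hF.mid _ x, ← hF.bot x]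

lemma rep_lapV (hn : n ≠ 2) (hF : RepT F T) :
    RepT (laplacian G (tractorNabla G) F) (h.alg.lapV h.alg.nab T) := fun x => by
  simp only [laplacian, MetricAlg.lapV, map_sum, evT_smul, map_sub,
    ← rep_nab h hn (rep_nab h hn hF _) _ x, ← rep_nab h hn hF _ x, ev_gi, ← rep_chr h _ _ _ x]

lemma rep_lapl {f : Coord n → ℝ} {φ : smoothAlg U} (hf : Rep f φ) :
    Rep (laplacian G pd f) (h.alg.lapl φ) := fun x => by
  simp only [laplacian, MetricAlg.lapl, MetricAlg.hess, map_sum, map_mul, map_sub, smul_eq_mul,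
    ← rep_D h (rep_D h hf _) _ x, ← rep_D h hf _ x, ev_gi, ← rep_chr h _ _ _ x]

lemma rep_tm {F' : Coord n → Tri n ℝ} {T' : Tri n (smoothAlg U)} (hF : RepT F T)
    (hF' : RepT F' T') : Rep (fun x => tractorMetric (G x) (F x) (F' x)) (h.alg.tm T T') :=
  fun x => by
  simp only [tractorMetric, contract, MetricAlg.tm, map_sum, map_mul, map_add, smul_eq_mul,
    ev_gi, ← hF.top x, ← hF.mid _ x, ← hF.bot x, ← hF'.top x, ← hF'.mid _ x, ← hF'.bot x]

lemma rep_canonical {f : Coord n → ℝ} {φ : smoothAlg U} (hf : Rep f φ) :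
    RepT (canonicalTractorMul f) (0, 0, φ) := fun x => by
  simp only [canonicalTractorMul, evT_apply, map_zero, Pi.zero_apply, hf x]; rfl

variable {f : Coord n → ℝ} {s : smoothAlg U} (hf : Rep f s)
include hf

lemma rep_scaleI (hn : n ≠ 0) : RepT (scaleTractor G f) (h.alg.scaleI s) := fun x => by
  have h0 : (n : ℝ) ≠ 0 := by exact_mod_cast hn
  have e : (n : ℝ) + 2 * 1 - 2 = n := by ring
  simp only [scaleTractor, thomasDHat, thomasD, e, evT_apply, MetricAlg.scaleI, MetricAlg.rho,
    map_neg, map_smul, map_add, map_mul, ← rep_lapl h hf x, ← rep_J h x, ← rep_D h hf _ x,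
    ← hf x]
  refine Prod.ext ?_ (Prod.ext (funext fun a => ?_) ?_)
  · simp [h0]
  · simp [h0]
  · simp; ring

lemma rep_scaleSq (hn : n ≠ 0) : Rep (scaleTractorSq G f) (h.alg.scaleSq s) :=
  rep_tm h (rep_scaleI h hf hn) (rep_scaleI h hf hn)

lemma rep_robin (hn : n ≠ 2) (hn0 : n ≠ 0) (hF : RepT F T) (w : ℝ) :
    RepT (laplaceRobin G f w F) (h.alg.robin s w T) := fun x => by
  simp only [laplaceRobin, contract, MetricAlg.robin, thomasD, map_add, map_sum, evT_smul, map_neg,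
    map_smul, ev_gi, smul_eq_mul, ← rep_lapV h hn hF x, ← rep_J h x, ← hF x,
    ← rep_nab h hn hF _ x, (rep_scaleI h hf hn0).top x, (rep_scaleI h hf hn0).mid _ x,
    (rep_scaleI h hf hn0).bot x]
  rfl

lemma rep_robinPow (hn : n ≠ 2) (hn0 : n ≠ 0) (k : ℕ) (hF : RepT F T) (w : ℝ) :
    RepT (laplaceRobinPow G f k w F) (h.alg.robinPow s k w T) := by
  induction k generalizing F T w with
  | zero => exact hF
  | succ k ih => exact ih (rep_robin h hf hn hn0 hF w) _

lemma rep_yPow (hn : n ≠ 2) (hn0 : n ≠ 0) {t : smoothAlg U} (ht : h.alg.scaleSq s * t = 1) (k : ℕ)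
    (hF : RepT F T) (w : ℝ) : RepT (yPow G f k w F) (h.alg.yPow s t k w T) := by
  induction k generalizing F T w with
  | zero => exact hF
  | succ k ih =>
    refine ih (fun x => ?_) _
    have e := congrArg (ev x) ht
    rw [map_mul, ← rep_scaleSq h hf hn0 x, map_one] at e
    rw [MetricAlg.yL_apply, evT_smul, map_neg, ← rep_robin h hf hn hn0 hF w x,
      eq_one_div_of_mul_eq_one_right e]

/-- In weight 0 the top slot of `D̂` is zero, so in the contraction the second-order bottom slot
meets only zeros and just the covariant derivatives of `I` remain. -/
lemma rep_kExt (hn : n ≠ 2) (hn0 : n ≠ 0) : Rep (kExt G f) (h.alg.kExt s) := fun x => by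
  have h0 : (n : ℝ) + 2 * 0 - 2 ≠ 0 := by
    rw [mul_zero, add_zero]; exact sub_ne_zero.mpr (by exact_mod_cast hn)
  have e : ∀ T T' : Tri n ℝ, T = 0 → tractorMetric (G x) T T' = 0 ∧ tractorMetric (G x) T' T = 0 :=
    fun T T' hT => by subst hT; simp [tractorMetric, contract]
  have e1 : (scaleTractorDeriv G f x).1 = 0 := by
    simp [scaleTractorDeriv, thomasDHat, thomasD]
  have e2 : ∀ a, (scaleTractorDeriv G f x).2.1 a = tractorNabla G (scaleTractor G f) a x :=
    fun a => by
    simp only [scaleTractorDeriv, thomasDHat, thomasD, Prod.smul_snd, Prod.smul_fst, Pi.smul_apply,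
      smul_smul, inv_mul_cancel₀ h0, one_smul]
  rw [kExt, contract, (e _ _ e1).1, (e _ _ e1).2]
  simp only [e2, MetricAlg.kExt, map_sum, map_mul, ev_gi, smul_eq_mul, zero_add, add_zero]
  refine Finset.sum_congr rfl fun a _ => Finset.sum_congr rfl fun b _ => ?_
  rw [← rep_tm h (rep_nab h hn (rep_scaleI h hf hn0) a) (rep_nab h hn (rep_scaleI h hf hn0) b) x]

end

end Transfer

end SmoothAlg

open TopologicalSpace (Opens)

section ZeroLocus

variable {n : ℕ} {U : Opens (Coord n)}

/-! ## The bracket in the holographic formula along the hypersurface -/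

/-- The smooth functions that vanish where `s` does. -/
def vanishIdeal (s : smoothAlg U) : Ideal (smoothAlg U) where
  carrier := {f | ∀ x, ev x s = 0 → ev x f = 0}
  add_mem' hf hg x hx := by rw [map_add, hf x hx, hg x hx, add_zero]
  zero_mem' _ _ := map_zero _
  smul_mem' c f hf x hx := by rw [smul_eq_mul, map_mul, hf x hx, mul_zero]

/-- A function that vanishes on the regular zero locus of another one has a proportional
differential along it. -/
lemma exists_fderiv_eq_smul {E : Type*} [NormedAddCommGroup E] [NormedSpace ℝ E] [CompleteSpace E]
    {s f : E → ℝ} {x : E} (hs : HasStrictFDerivAt s (fderiv ℝ s x) x)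
    (hf : HasStrictFDerivAt f (fderiv ℝ f x) x)
    (hvan : ∀ᶠ y in nhds x, s y = s x → f y = f x) (hds : fderiv ℝ s x ≠ 0) :
    ∃ c : ℝ, fderiv ℝ f x = c • fderiv ℝ s x := by
  -- Being constant on the level set, `f` has a constrained extremum there for trivial reasons; the
  -- Lagrange multiplier rule then gives the proportionality.
  have hext : IsLocalExtrOn f {y | s y = s x} x := by
    refine Or.inl ?_
    have : ∀ᶠ y in nhdsWithin x {y | s y = s x}, f x ≤ f y := by
      rw [eventually_nhdsWithin_iff]
      exact hvan.mono fun y hy h => (hy h).ge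
    exact this
  obtain ⟨a, b, hab, h⟩ := hext.exists_multipliers_of_hasStrictFDerivAt_1d hs hf
  have hb : b ≠ 0 := by
    rintro rfl
    rw [zero_smul, add_zero] at h
    rcases smul_eq_zero.mp h with h | h
    · subst h; exact hab rfl
    · exact hds h
  refine ⟨-(b⁻¹ * a), ?_⟩
  have h2 : b • fderiv ℝ f x = -(a • fderiv ℝ s x) := eq_neg_of_add_eq_zero_right h
  rw [neg_smul, mul_smul, ← smul_neg, ← h2, smul_smul, inv_mul_cancel₀ hb, one_smul]

variable {G : MetricField n} (h : IsMetricOn G U)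

/-- The transversal field is `grad s / |ds|²`. The condition on differentials is
`exists_fderiv_eq_smul`, the multiplier being the derivative along this field. -/
lemma isZeroLocus {s ri : smoothAlg U} (hri : ri * ri * h.alg.gradSq s = 1) :
    h.alg.IsZeroLocus (vanishIdeal s) s
      (fun a => ri * ri * ∑ b, h.alg.gi a b * h.alg.D b s) where
  mem _ hx := hx
  along_eq := by
    rw [← hri]
    simp only [MetricAlg.along, MetricAlg.gradSq, Finset.mul_sum, Finset.sum_mul]
    exact Finset.sum_congr rfl fun a _ => Finset.sum_congr rfl fun b _ => by ring
  D_mem f hf a x hx := by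
    set ξ : Fin n → smoothAlg U := fun a => ri * ri * ∑ b, h.alg.gi a b * h.alg.D b s with hξ
    have hal : ev x (h.alg.along ξ s) = 1 := by
      have : h.alg.along ξ s = 1 := by
        rw [← hri, hξ]
        simp only [MetricAlg.along, MetricAlg.gradSq, Finset.mul_sum, Finset.sum_mul]
        exact Finset.sum_congr rfl fun a _ => Finset.sum_congr rfl fun b _ => by ring
      rw [this, map_one]
    have hstrict : ∀ f : smoothAlg U,
        HasStrictFDerivAt (extendZero f.1) (fderiv ℝ (extendZero f.1) x) x := fun f =>
      (f.2.contDiffAt (U.isOpen.mem_nhds x.2)).hasStrictFDerivAt (by simp)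
    have hD : ∀ (f : smoothAlg U) b, ev x (h.alg.D b f) =
        fderiv ℝ (extendZero f.1) x (EuclideanSpace.single b 1) := fun f b =>
      (rep_D h (rep_extendZero f) b x).symm
    have hds : fderiv ℝ (extendZero s.1) x ≠ 0 := by
      intro h0
      have : ev x (h.alg.along ξ s) = 0 := by
        rw [MetricAlg.along, map_sum]
        exact Finset.sum_eq_zero fun b _ => by rw [map_mul, hD, h0]; simp
      rw [this] at hal
      exact zero_ne_one hal
    obtain ⟨c, hc⟩ := exists_fderiv_eq_smul (hstrict s) (hstrict f) (by
      filter_upwards [U.isOpen.mem_nhds x.2] with y hy hsy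
      have e1 : ev ⟨y, hy⟩ s = 0 := by
        rw [← rep_extendZero s ⟨y, hy⟩, hsy, rep_extendZero s x, hx]
      rw [rep_extendZero f ⟨y, hy⟩, rep_extendZero f x, hf _ e1, hf _ hx]) hds
    have hDf : ∀ b, ev x (h.alg.D b f) = c * ev x (h.alg.D b s) := fun b => by
      rw [hD, hD, hc]; rfl
    have hX : ev x (h.alg.along ξ f) = c := by
      rw [← mul_one c, ← hal]
      simp only [MetricAlg.along, map_sum, map_mul, hDf, Finset.mul_sum]
      exact Finset.sum_congr rfl fun b _ => by ring
    rw [map_sub, map_mul, hX, hDf, mul_comm, sub_self]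

lemma evT_eq_of_mem_vanT {s : smoothAlg U} {T : Tri n (smoothAlg U)}
    (hT : T ∈ h.alg.vanT (vanishIdeal s) 1) {x : U} (hx : ev x s = 0) : evT x T = 0 := by
  rw [evT_apply]
  exact Prod.ext ((h.alg.mem_van_one.mp hT.1) x hx) (Prod.ext
    (funext fun a => (h.alg.mem_van_one.mp (hT.2.1 a)) x hx) ((h.alg.mem_van_one.mp hT.2.2) x hx))

lemma mem_vanT_of_evT_eq {s : smoothAlg U} {T : Tri n (smoothAlg U)}
    (hT : ∀ x, ev x s = 0 → evT x T = 0) : T ∈ h.alg.vanT (vanishIdeal s) 1 :=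
  ⟨h.alg.mem_van_one.mpr fun x hx => congrArg Prod.fst (hT x hx),
    fun a => h.alg.mem_van_one.mpr fun x hx =>
      congrArg (fun t : Tri n ℝ => t.2.1 a) (hT x hx),
    h.alg.mem_van_one.mpr fun x hx => congrArg (fun t : Tri n ℝ => t.2.2) (hT x hx)⟩

variable {f : Coord n → ℝ} {s r ri : smoothAlg U} (hf : Rep f s)
include hf

lemma rep_gradSq :
    Rep (fun x => ∑ b, ∑ c, (G x)⁻¹ b c * pd f b x * pd f c x) (h.alg.gradSq s) := fun x => by
  simp only [MetricAlg.gradSq, map_sum, map_mul, ev_gi, ← rep_D h hf _ x, mul_assoc]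

variable (hr : r * r = h.alg.gradSq s) (hpos : ∀ x, 0 < ev x r) (hri : r * ri = 1)
include hr hpos hri

lemma rep_conormal (a : Fin n) : Rep (conormal G f a) (h.alg.D a s * ri) := fun x => by
  have h1 := rep_gradSq h hf x
  have h2 : ev x r * ev x ri = 1 := by rw [← map_mul, hri, map_one]
  simp only at h1
  rw [conormal, h1, ← hr, map_mul, Real.sqrt_mul_self (hpos x).le, map_mul, rep_D h hf a x,
    eq_div_of_mul_eq (hpos x).ne' ((mul_comm _ _).trans h2), mul_one_div]

lemma rep_meanCurvature : Rep (meanCurvature G f) (h.alg.meanCurv s ri) := fun x => by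
  have hn : ∀ a, normal G f a x = ev x (h.alg.normalUp s ri a) := fun a => by
    simp only [normal, MetricAlg.normalUp, map_sum, map_mul (ev x) (h.alg.gi _ _), ev_gi,
      ← rep_conormal h hf hr hpos hri _ x]
  simp only [meanCurvature, MetricAlg.meanCurv, map_smul, smul_eq_mul, map_sum,
    map_mul (ev x) (_ - _) (_ - _), map_mul (ev x) (h.alg.normalUp s ri _),
    map_mul (ev x) (h.alg.chr _ _ _), map_sub, ev_gi, ← hn,
    ← rep_D h (rep_conormal h hf hr hpos hri _) _ x, ← rep_conormal h hf hr hpos hri _ x,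
    ← rep_chr h _ _ _ x]

end ZeroLocus

/-! ### From the algebraic bracket to smooth fields near a point -/

open TopologicalSpace (Opens)

section Bracket

variable {n : ℕ}

lemma exists_rep_inv {U : Opens (Coord n)} {F : Coord n → ℝ} (hF : ContDiffOn ℝ ∞ F U)
    (h0 : ∀ x : U, F x ≠ 0) : ∃ t : smoothAlg U, ofSmooth F hF * t = 1 :=
  ⟨ofSmooth (fun x => (F x)⁻¹) (hF.inv fun x hx => h0 ⟨x, hx⟩), ext_ev fun x => by
    rw [map_mul, map_one]; exact mul_inv_cancel₀ (h0 x)⟩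

lemma exists_repT {U : Opens (Coord n)} {N : Coord n → Tri n ℝ} (hN : ContDiffOn ℝ ∞ N U) :
    ∃ T : Tri n (smoothAlg U), RepT N T :=
  ⟨(ofSmooth _ hN.fst, fun a => ofSmooth (fun x => (N x).2.1 a) (contDiffOn_pi.mp hN.snd.fst a),
    ofSmooth _ hN.snd.snd), fun _ => rfl⟩

/-- The bracket in the holographic formula along the zero locus of a unit scale, when the square
of the scale tractor and the gradient of the scale do not vanish. -/
lemma bracket_eq_of_ne_zero (hn : 3 ≤ n) {U : Opens (Coord n)} {G : MetricField n}
    (h : IsMetricOn G U) {f B : Coord n → ℝ} {N : Coord n → Tri n ℝ}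
    (hf : ContDiffOn ℝ ∞ f U) (hB : ContDiffOn ℝ ∞ B U) (hN : ContDiffOn ℝ ∞ N U)
    (hS : ∀ x ∈ U, scaleTractorSq G f x = 1 + f x ^ n * B x)
    (hS0 : ∀ x ∈ U, scaleTractorSq G f x ≠ 0)
    (hq : ∀ x ∈ U, 0 < ∑ b, ∑ c, (G x)⁻¹ b c * pd f b x * pd f c x)
    (hNf : ∀ x ∈ U, f x = 0 → N x = normalTractor G f x) (x : U) (hx : f x = 0) :
    extrinsicLaplacian G f (n - 1) N x + (-1 : ℝ) ^ (n - 2) •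
      laplaceRobinPow G f (n - 2) (-1) (canonicalTractorMul (kExt G f)) x =
      (0, 0, (n.factorial : ℝ) * (n - 2).factorial / 2 * B x) := by
  have hn2 : n ≠ 2 := by omega
  have hn0 : n ≠ 0 := by omega
  set s : smoothAlg U := ofSmooth f hf with hs
  have hfs : Rep f s := rep_ofSmooth hf
  obtain ⟨T, hT⟩ := exists_repT hN
  have hSr := rep_scaleSq h hfs hn0
  obtain ⟨t, ht⟩ := exists_rep_inv hSr.contDiffOn fun y => hS0 y y.2
  have hSe : ofSmooth _ hSr.contDiffOn = h.alg.scaleSq s := ext_ev fun y => hSr y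
  rw [hSe] at ht
  have hSA : h.alg.scaleSq s = 1 + s ^ n * ofSmooth B hB := ext_ev fun y => by
    rw [← hSr y, hS y y.2, map_add, map_mul, map_pow, map_one]; rfl
  have hqr := rep_gradSq h hfs
  have hrs : ContDiffOn ℝ ∞ (fun y => Real.sqrt (∑ b, ∑ c, (G y)⁻¹ b c * pd f b y * pd f c y)) U :=
    hqr.contDiffOn.sqrt fun y hy => (hq y hy).ne'
  have hpos : ∀ y : U, 0 < ev y (ofSmooth _ hrs) := fun y => Real.sqrt_pos.mpr (hq y y.2)
  obtain ⟨ri, hri⟩ := exists_rep_inv hrs fun y => (hpos y).ne'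
  set r := ofSmooth _ hrs with hrdef
  have hr : r * r = h.alg.gradSq s := ext_ev fun y => by
    rw [map_mul, ← hqr y]; exact Real.mul_self_sqrt (hq y y.2).le
  have hqri : ri * ri * h.alg.gradSq s = 1 := by
    rw [← hr]; linear_combination (r * ri + 1) * hri
  have hn1 : (n : ℝ) ≠ 1 := by norm_cast; omega
  obtain ⟨Z, hZ⟩ := h.alg.meanCurv_eq hn1 (by omega) hSA hr hri
  -- Along the zero locus `|ds| = 1` and `H = -rho`, so the normal tractor and the scale tractor
  -- have the same components there.
  have hNI : T - h.alg.scaleI s ∈ h.alg.vanT (vanishIdeal s) 1 := by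
    refine mem_vanT_of_evT_eq h fun y hy => ?_
    have hfy : f y = 0 := (hfs y).trans hy
    have hri1 : ev y ri = 1 := by
      have e1 : ev y (h.alg.gradSq s) = 1 := by
        have e2 := congrArg (ev y) (h.alg.scaleSq_eq s)
        rw [← hSr y, hS y y.2, hfy, zero_pow hn0] at e2
        simp only [map_add, map_mul, hy, zero_mul, mul_zero, add_zero] at e2
        exact e2.symm
      have e3 := congrArg (ev y) hr
      have e4 := congrArg (ev y) hri
      rw [map_mul, e1] at e3
      rw [map_mul, map_one] at e4
      have e5 : ev y r = 1 := by
        have := hpos y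
        nlinarith
      rwa [e5, one_mul] at e4
    have hmc : ev y (h.alg.meanCurv s ri) = -ev y (h.alg.rho s) := by
      rw [hZ, map_add, map_neg, map_mul, map_mul, hri1, hy, zero_mul, add_zero, mul_one]
    rw [map_sub, ← hT y, hNf y y.2 hfy, sub_eq_zero, evT_apply, normalTractor,
      rep_meanCurvature h hfs hr hpos hri y, hmc, neg_neg]
    refine Prod.ext hy.symm (Prod.ext (funext fun a => ?_) rfl)
    exact (rep_conormal h hfs hr hpos hri a y).trans (by rw [map_mul, hri1, mul_one]; rfl)
  have hmem := h.alg.bracket_mem (isZeroLocus h hqri) (k := n - 2) (by omega) (by omega) hSA ht hNI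
  have hev := evT_eq_of_mem_vanT h hmem (x := x) ((hfs x).symm.trans hx)
  have hk : n - 2 + 1 = n - 1 := by omega
  -- The weight prescribed for the extrinsic Laplacian of order `n - 1` is 0, the weight of `N`.
  have hw : (((n - 1 : ℕ) : ℝ) - n + 1) / 2 = 0 := by
    rw [Nat.cast_sub (by omega)]; push_cast; ring
  rw [map_sub, sub_eq_zero, map_add, map_smul, hk, ← rep_yPow h hfs hn2 hn0 ht _ hT 0 x,
    ← rep_robinPow h hfs hn2 hn0 _ (rep_canonical (rep_kExt h hfs hn2 hn0)) (-1) x] at hev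
  rw [extrinsicLaplacian, hw, hev, evT_apply]
  simp only [map_zero, map_smul, Pi.zero_apply, smul_eq_mul]
  rfl

/-- The bracket in the holographic formula along the zero locus of a unit scale. -/
theorem bracket_eq (hn : 3 ≤ n) {U : Opens (Coord n)} {G : MetricField n}
    (h : IsMetricOn G U) {f B : Coord n → ℝ} {N : Coord n → Tri n ℝ}
    (hf : ContDiffOn ℝ ∞ f U) (hB : ContDiffOn ℝ ∞ B U) (hN : ContDiffOn ℝ ∞ N U)
    (hS : ∀ x ∈ U, scaleTractorSq G f x = 1 + f x ^ n * B x)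
    (hNf : ∀ x ∈ U, f x = 0 → N x = normalTractor G f x) (x : U) (hx : f x = 0) :
    extrinsicLaplacian G f (n - 1) N x + (-1 : ℝ) ^ (n - 2) •
      laplaceRobinPow G f (n - 2) (-1) (canonicalTractorMul (kExt G f)) x =
      (0, 0, (n.factorial : ℝ) * (n - 2).factorial / 2 * B x) := by
  have hn0 : n ≠ 0 := by omega
  have hfs : Rep f (ofSmooth f hf) := rep_ofSmooth hf
  have hSr := rep_scaleSq h hfs hn0
  have hqr := rep_gradSq h hfs
  have hS1 : scaleTractorSq G f x = 1 := by
    rw [hS x x.2, hx, zero_pow hn0, zero_mul, add_zero]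
  have hq1 : ∑ b, ∑ c, (G x)⁻¹ b c * pd f b x * pd f c x = 1 := by
    have e := congrArg (ev x) (h.alg.scaleSq_eq (ofSmooth f hf))
    rw [← hSr x, hS1, map_add, map_mul, map_mul, ← hfs x, hx, ← hqr x] at e
    linarith
  -- Both `I²` and `|ds|²` equal 1 at `x`, so they stay nonzero and positive on a neighbourhood; the
  -- assertion at `x` is local.
  obtain ⟨V, hVU, hVS⟩ : ∃ V : Opens (Coord n), V ≤ U ∧ (x : Coord n) ∈ V ∧
      ∀ y ∈ V, scaleTractorSq G f y ≠ 0 ∧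
        0 < ∑ b, ∑ c, (G y)⁻¹ b c * pd f b y * pd f c y := by
    have c1 := hSr.contDiffOn.continuousOn.continuousAt (U.isOpen.mem_nhds x.2)
    have c2 := hqr.contDiffOn.continuousOn.continuousAt (U.isOpen.mem_nhds x.2)
    have e1 := c1.eventually_ne (by rw [hS1]; exact one_ne_zero : scaleTractorSq G f x ≠ 0)
    have e2 := c2.eventually (lt_mem_nhds (by simp only [hq1]; exact zero_lt_one))
    obtain ⟨V, hV, hVo, hxV⟩ := eventually_nhds_iff.mp
      ((e1.and e2).and (U.isOpen.mem_nhds x.2))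
    exact ⟨⟨V, hVo⟩, fun y hy => (hV y hy).2, hxV, fun y hy => (hV y hy).1⟩
  exact bracket_eq_of_ne_zero hn (h.mono hVU) (hf.mono hVU) (hB.mono hVU) (hN.mono hVU)
    (fun y hy => hS y (hVU hy)) (fun y hy => (hVS.2 y hy).1) (fun y hy => (hVS.2 y hy).2)
    (fun y hy => hNf y (hVU hy)) ⟨x, hVS.1⟩ hx

end Bracket

/-! ## The divergence of the restricted bracket -/

/-- The restriction of a multiple of the canonical tractor. -/
lemma sigmaRestrict_canonical {m n : ℕ} (G : MetricField n) (s : Coord n → ℝ)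
    (j : Coord m → Coord n) (V : Coord n → Tri n ℝ) (y : Coord m) (r : ℝ)
    (hV : V (j y) = (0, 0, r)) : sigmaRestrict G s j V y = (0, 0, r) := by
  have h1 : tractorMetric (G (j y)) (0, 0, r) (normalTractor G s (j y)) = 0 := by
    simp [tractorMetric, contract, normalTractor]
  rw [sigmaRestrict, projNormal, hV, h1, zero_smul, sub_zero, toIntrinsic]
  refine Prod.ext rfl (Prod.ext (funext fun i => ?_) ?_)
  · simp
  · simp

/-- `D̄_A (X^A f) = m f` for `X^A f` of weight `-m` on an `m`-manifold. -/
lemma thomasDiv_canonical {m : ℕ} (G : MetricField m) {V : Coord m → Tri m ℝ} {f : Coord m → ℝ}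
    {y : Coord m} (hdet : IsUnit (G y).det) (hsymm : (G y).transpose = G y)
    (hV : ∀ᶠ z in nhds y, V z = (0, 0, f z)) : thomasDiv G (-(m : ℝ)) V y = m * f y := by
  have hpd : ∀ {F : Coord m → ℝ} (z : Coord m), (∀ᶠ u in nhds z, F u = 0) →
      ∀ a, pd F a z = 0 := fun {F} z hF a => by
    have : F =ᶠ[nhds z] fun _ => 0 := hF
    rw [pd, this.fderiv_eq]; simp
  have hy : V y = (0, 0, f y) := hV.self_of_nhds
  have hnab : ∀ᶠ z in nhds y, ∀ a, (tractorNabla G V a z).1 = 0 := by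
    filter_upwards [hV.eventually_nhds] with z hz a
    have hz0 : V z = (0, 0, f z) := hz.self_of_nhds
    rw [tractorNabla, hpd z (hz.mono fun u hu => by rw [hu]), hz0]
    simp
  have hmid : ∀ a b, (tractorNabla G V a y).2.1 b = G y a b * f y := fun a b => by
    simp only [tractorNabla]
    rw [hpd y (hV.mono fun u hu => by rw [hu]; rfl), hy]
    simp
  -- The top slot of `∇V` vanishes on a whole neighbourhood, so its derivative drops out and only
  -- the middle slot survives. No Schouten tensor appears, in any dimension.
  have hnab2 : ∀ a b, (tractorNabla G (fun z => tractorNabla G V b z) a y).1 = -(G y b a * f y) :=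
    fun a b => by
    have e : (tractorNabla G (fun z => tractorNabla G V b z) a y).1 =
        pd (fun z => (tractorNabla G V b z).1) a y - (tractorNabla G V b y).2.1 a := rfl
    rw [e, hmid, hpd y (hnab.mono fun z hz => hz b), zero_sub]
  have htr : ∑ a, ∑ b, (G y)⁻¹ a b * G y b a = m := by
    have : ((G y)⁻¹ * G y).trace = m := by
      rw [Matrix.nonsing_inv_mul _ hdet, Matrix.trace_one, Fintype.card_fin]
    rw [← this]
    rfl
  have hsy : ∀ a b, G y a b = G y b a := fun a b => congrFun (congrFun hsymm b) a
  have hlap : (laplacian G (tractorNabla G) V y).1 = -(m * f y) := by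
    have hn0 := hnab.self_of_nhds
    simp only [laplacian, Prod.fst_sum, Prod.smul_fst, Prod.fst_sub, hnab2, hn0, smul_eq_mul,
      mul_zero, Finset.sum_const_zero, sub_zero]
    rw [← htr, Finset.sum_mul, ← Finset.sum_neg_distrib]
    refine Finset.sum_congr rfl fun a _ => ?_
    rw [Finset.sum_mul, ← Finset.sum_neg_distrib]
    exact Finset.sum_congr rfl fun b _ => by ring
  have hmidsum : ∑ a, ∑ b, (G y)⁻¹ a b * ((((m : ℝ) + 2 * -(m : ℝ) - 2) •
      tractorNabla G V a y).2.1 b) = ((m : ℝ) + 2 * -(m : ℝ) - 2) * (m * f y) := by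
    rw [← htr]
    simp only [Prod.smul_fst, Prod.smul_snd, Pi.smul_apply, hmid, Finset.mul_sum, Finset.sum_mul,
      smul_eq_mul]
    exact Finset.sum_congr rfl fun a _ => Finset.sum_congr rfl fun b _ => by
      rw [hsy a b]; ring
  have hdiv : thomasDiv G (-(m : ℝ)) V y =
      ((-(m : ℝ) * ((m : ℝ) + 2 * -(m : ℝ) - 2)) • V y).2.2
      + ∑ a, ∑ b, (G y)⁻¹ a b * ((((m : ℝ) + 2 * -(m : ℝ) - 2) • tractorNabla G V a y).2.1 b)
      + (-(laplacian G (tractorNabla G) V y + (-(m : ℝ) * schoutenTrace G y) • V y)).1 := rfl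
  -- The three slots give `m (m + 2) f`, `-(m + 2) m f` and `m f`; the `J` term is multiplied by the
  -- zero top slot of `V`.
  rw [hdiv, hmidsum, Prod.fst_neg, Prod.fst_add, hlap, hy]
  simp only [Prod.smul_fst, Prod.smul_snd, smul_eq_mul]
  ring

theorem toLp_eq_sum_single {n : ℕ} (v : Fin n → ℝ) :
    (WithLp.toLp 2 v : Coord n) = ∑ a, v a • EuclideanSpace.single a (1 : ℝ) := by
  ext i
  simp [Finset.sum_apply, Pi.single_apply]

/-- The components of the pullback of a scalar product by an injective linear map form a positive
definite matrix. -/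
theorem posDef_gram {n : ℕ} {F : Type*} [AddCommGroup F] [Module ℝ F] [TopologicalSpace F]
    [IsTopologicalAddGroup F] [ContinuousSMul ℝ F] (β : F →L[ℝ] F →L[ℝ] ℝ)
    (hsymm : ∀ v w, β v w = β w v) (hpos : ∀ v, v ≠ 0 → 0 < β v v) (L : Coord n →L[ℝ] F)
    (hL : Function.Injective L) :
    (Matrix.of fun a b => β (L (EuclideanSpace.single a 1))
      (L (EuclideanSpace.single b 1)) : Matrix (Fin n) (Fin n) ℝ).PosDef := by
  refine Matrix.PosDef.of_dotProduct_mulVec_pos ?_ fun v hv => ?_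
  · ext a b
    simpa using hsymm _ _
  · have hne : L (WithLp.toLp 2 v) ≠ 0 := fun h0 => hv <| by
      have := hL (h0.trans (map_zero L).symm)
      ext i
      exact congrArg (fun w : Coord n => w i) this
    have := hpos _ hne
    rw [toLp_eq_sum_single] at this
    simp only [map_sum, map_smul, sum_apply, smul_apply, smul_eq_mul] at this
    refine this.trans_eq ?_
    simp only [dotProduct, Matrix.mulVec, Matrix.of_apply, star_trivial, Pi.star_apply,
      Finset.mul_sum]
    rw [Finset.sum_comm]
    exact Finset.sum_congr rfl fun a _ => Finset.sum_congr rfl fun b _ => by ring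

/-! ### Metrics and functions in a chart of the manifold -/

section Charts

variable {d : ℕ} {M : Type*} [TopologicalSpace M] [ChartedSpace (Coord d) M]

theorem mfderiv_symm_injective {φ : OpenPartialHomeomorph M (Coord d)}
    (hφ : φ ∈ IsManifold.maximalAtlas (𝓡 d) ∞ M) {x : Coord d} (hx : x ∈ φ.target) :
    Function.Injective (mfderiv (𝓡 d) (𝓡 d) φ.symm x) := by
  have h : φ.MDifferentiable (𝓡 d) (𝓡 d) :=
    ⟨(contMDiffOn_of_mem_maximalAtlas hφ).mdifferentiableOn (by simp),
      (contMDiffOn_symm_of_mem_maximalAtlas hφ).mdifferentiableOn (by simp)⟩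
  exact h.symm.mfderiv_injective hx

/-- A function on a manifold is smooth in each chart. -/
theorem contDiffOn_comp_symm {φ : OpenPartialHomeomorph M (Coord d)}
    (hφ : φ ∈ IsManifold.maximalAtlas (𝓡 d) ∞ M) {f : M → ℝ} (hf : ContMDiff (𝓡 d) 𝓘(ℝ) ∞ f) :
    ContDiffOn ℝ ∞ (fun x => f (φ.symm x)) φ.target :=
  contMDiffOn_iff_contDiffOn.1 (hf.comp_contMDiffOn (contMDiffOn_symm_of_mem_maximalAtlas hφ))

variable [IsManifold (𝓡 d) ∞ M]

/-- The frame is the image of a constant vector field under the tangent map of the inverse chart. -/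
theorem contMDiffOn_frame {φ : OpenPartialHomeomorph M (Coord d)}
    (hφ : φ ∈ IsManifold.maximalAtlas (𝓡 d) ∞ M) (a : Fin d) :
    ContMDiffOn (𝓡 d) ((𝓡 d).prod 𝓘(ℝ, Coord d)) ∞
      (fun x => Bundle.TotalSpace.mk' (Coord d) (E := fun p : M => TangentSpace (𝓡 d) p)
        (φ.symm x) (frame φ x a)) φ.target := by
  have h1 := (contMDiffOn_symm_of_mem_maximalAtlas hφ).contMDiffOn_tangentMapWithin
    (m := ∞) (by simp) φ.open_target.uniqueMDiffOn
  have h2 : ContMDiffOn (𝓡 d) ((𝓡 d).prod 𝓘(ℝ, Coord d)) ∞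
      (fun x : Coord d => (⟨x, EuclideanSpace.single a (1 : ℝ)⟩ : TangentBundle (𝓡 d) (Coord d)))
      φ.target :=
    contMDiffOn_vectorSpace_iff_contDiffOn.2 contDiffOn_const
  refine (h1.comp h2 fun x hx => hx).congr fun x hx => ?_
  simp only [Function.comp_apply, tangentMapWithin, frame]
  rw [mfderivWithin_of_isOpen φ.open_target hx]

theorem isMetricOn_metricComps (g : Metric (d := d) M) {φ : OpenPartialHomeomorph M (Coord d)}
    (hφ : φ ∈ IsManifold.maximalAtlas (𝓡 d) ∞ M) :
    IsMetricOn (metricComps g φ) ⟨φ.target, φ.open_target⟩ where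
  smooth a b := by
    rw [← contMDiffOn_iff_contDiffOn]
    have h1 := g.contMDiff.comp_contMDiffOn (contMDiffOn_symm_of_mem_maximalAtlas hφ)
    intro x hx
    have : ContMDiffWithinAt (𝓡 d) ((𝓡 d).prod 𝓘(ℝ)) ∞
        (fun x => Bundle.TotalSpace.mk' ℝ (E := Bundle.Trivial M ℝ) (φ.symm x)
          (g.inner (φ.symm x) (frame φ x a) (frame φ x b))) φ.target x := by
      apply ContMDiffWithinAt.clm_bundle_apply₂ (F₁ := Coord d) (F₂ := Coord d)
      · exact h1 x hx
      · exact contMDiffOn_frame hφ a x hx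
      · exact contMDiffOn_frame hφ b x hx
    simp only [Bundle.contMDiffWithinAt_totalSpace] at this
    exact this.2
  symm x _ := by
    ext a b
    exact g.symm _ _ _
  posDef x hx := by
    exact posDef_gram (g.inner (φ.symm x)) (g.symm _) (g.pos _) (mfderiv (𝓡 d) (𝓡 d) φ.symm x)
      (mfderiv_symm_injective hφ hx)

end Charts

/-- A parametrised immersed hypersurface inherits a positive definite metric. -/
theorem posDef_inducedMetric {m n : ℕ} {G : MetricField n} {j : Coord m → Coord n} {y : Coord m}
    (hG : (G (j y)).PosDef) (hj : DifferentiableAt ℝ j y)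
    (hinj : Function.Injective (fderiv ℝ j y)) : (inducedMetric G j y).PosDef := by
  set A : Matrix (Fin n) (Fin m) ℝ := Matrix.of fun a i => pd (fun z => j z a) i y
  have hpd : ∀ a i, pd (fun z => j z a) i y = fderiv ℝ j y (EuclideanSpace.single i 1) a := by
    intro a i
    have h := ((EuclideanSpace.proj (𝕜 := ℝ) a).hasFDerivAt.comp y hj.hasFDerivAt).fderiv
    have h' : fderiv ℝ (fun z => j z a) y =
        (EuclideanSpace.proj (𝕜 := ℝ) a).comp (fderiv ℝ j y) := h
    rw [pd, h']
    rfl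
  -- The induced metric is a congruence by the Jacobian matrix, and injectivity of the differential
  -- makes this matrix injective.
  have hA : inducedMetric G j y = A.conjTranspose * G (j y) * A := by
    ext i k
    simp only [inducedMetric, Matrix.of_apply, Matrix.mul_apply, Matrix.conjTranspose_apply, A,
      star_trivial, Finset.sum_mul]
    rw [Finset.sum_comm]
    exact Finset.sum_congr rfl fun b _ => Finset.sum_congr rfl fun a _ => by ring
  have hAv : ∀ v, A.mulVec v = WithLp.ofLp (fderiv ℝ j y (WithLp.toLp 2 v)) := by
    intro v
    rw [toLp_eq_sum_single, map_sum]
    ext a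
    simp [Matrix.mulVec, dotProduct, A, hpd, Finset.sum_apply, mul_comm]
  rw [hA]
  refine hG.conjTranspose_mul_mul_same fun v w hvw => ?_
  rw [hAv, hAv] at hvw
  exact WithLp.toLp_injective 2 (hinj (WithLp.ofLp_injective 2 hvw))

/-! ### Immersions in arbitrary charts -/

section Immersion

variable {m n : ℕ} {M : Type*} [TopologicalSpace M] [ChartedSpace (Coord n) M]
  {S : Type*} [TopologicalSpace S] [ChartedSpace (Coord m) S]

/-- In charts adapted to the immersion, `ι` is `u ↦ (u, 0)`. Projecting to the first factor and
changing charts gives a local differentiable left inverse `K`, and the chain rule does the rest. -/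
theorem injective_fderiv_of_isImmersionAt {ι : S → M}
    {φ : OpenPartialHomeomorph M (Coord n)} (hφ : φ ∈ IsManifold.maximalAtlas (𝓡 n) ∞ M)
    {ψ : OpenPartialHomeomorph S (Coord m)} (hψ : ψ ∈ IsManifold.maximalAtlas (𝓡 m) ∞ S)
    {q : S} (hι : Manifold.IsImmersionAt (𝓡 m) (𝓡 n) ∞ ι q)
    (hq : q ∈ ψ.source) (hιq : ι q ∈ φ.source) :
    DifferentiableAt ℝ (fun y => φ (ι (ψ.symm y))) (ψ q) ∧
      Function.Injective (fderiv ℝ (fun y => φ (ι (ψ.symm y))) (ψ q)) := by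
  have hq' : ψ.symm (ψ q) = q := ψ.left_inv hq
  have hj : DifferentiableAt ℝ (fun y => φ (ι (ψ.symm y))) (ψ q) := by
    have h1 : ContMDiffAt (𝓡 m) (𝓡 m) ∞ ψ.symm (ψ q) :=
      contMDiffAt_symm_of_mem_maximalAtlas hψ (ψ.map_source hq)
    have h2 : ContMDiffAt (𝓡 m) (𝓡 n) ∞ ι (ψ.symm (ψ q)) := by rw [hq']; exact hι.contMDiffAt
    have h3 : ContMDiffAt (𝓡 n) (𝓡 n) ∞ φ (ι (ψ.symm (ψ q))) := by
      rw [hq']; exact contMDiffAt_of_mem_maximalAtlas hφ hιq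
    exact (contMDiffAt_iff_contDiffAt.1 ((h3.comp (ψ q) (h2.comp (ψ q) h1)))).differentiableAt
      (by simp)
  refine ⟨hj, ?_⟩
  set α := hι.domChart
  set β := hι.codChart
  set e := hι.equiv
  have hw := hι.writtenInCharts
  let K : Coord n → Coord m := fun x => ψ (α.symm ((e.symm (β (φ.symm x))).1))
  have hmem : α q ∈ (α.extend (𝓡 m)).target := by
    have := (α.extend (𝓡 m)).map_source (x := q) (by simpa using hι.mem_domChart_source)
    simpa using this
  have hval : ∀ z ∈ α.source, (e.symm (β (ι z))).1 = α z := by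
    intro z hz
    have hz' : α z ∈ (α.extend (𝓡 m)).target := by
      have := (α.extend (𝓡 m)).map_source (x := z) (by simpa using hz)
      simpa using this
    have := hw hz'
    simp only [Function.comp_apply, OpenPartialHomeomorph.extend_coe,
      OpenPartialHomeomorph.extend_coe_symm, modelWithCornersSelf_coe,
      modelWithCornersSelf_coe_symm, id, α] at this
    rw [hι.domChart.left_inv hz] at this
    change (e.symm (β (ι z))).1 = _
    simp only [β, e, this, ContinuousLinearEquiv.symm_apply_apply]
    rfl
  have hKd : DifferentiableAt ℝ K (φ (ι q)) := by
    have h1 : ContMDiffAt (𝓡 n) (𝓡 n) ∞ φ.symm (φ (ι q)) :=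
      contMDiffAt_symm_of_mem_maximalAtlas hφ (φ.map_source hιq)
    have h2 : ContMDiffAt (𝓡 n) (𝓡 n) ∞ β (φ.symm (φ (ι q))) := by
      rw [φ.left_inv hιq]
      exact contMDiffAt_of_mem_maximalAtlas hι.codChart_mem_maximalAtlas hι.mem_codChart_source
    let P : Coord n →L[ℝ] Coord m :=
      (ContinuousLinearMap.fst ℝ _ _).comp e.symm.toContinuousLinearMap
    have h3 : ContMDiffAt (𝓡 n) (𝓡 m) ∞ P (β (φ.symm (φ (ι q)))) :=
      P.contMDiff.contMDiffAt
    have hPv : P (β (φ.symm (φ (ι q)))) = α q := by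
      rw [φ.left_inv hιq]; exact hval q hι.mem_domChart_source
    have h4 : ContMDiffAt (𝓡 m) (𝓡 m) ∞ α.symm (P (β (φ.symm (φ (ι q))))) := by
      rw [hPv]
      exact contMDiffAt_symm_of_mem_maximalAtlas hι.domChart_mem_maximalAtlas
        (α.map_source hι.mem_domChart_source)
    have h5 : ContMDiffAt (𝓡 m) (𝓡 m) ∞ ψ (α.symm (P (β (φ.symm (φ (ι q)))))) := by
      rw [hPv, α.left_inv hι.mem_domChart_source]
      exact contMDiffAt_of_mem_maximalAtlas hψ hq
    have := h5.comp (φ (ι q)) (h4.comp (φ (ι q)) (h3.comp (φ (ι q)) (h2.comp (φ (ι q)) h1)))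
    exact (contMDiffAt_iff_contDiffAt.1 this).differentiableAt (by simp)
  have hcont : ContinuousAt ψ.symm (ψ q) := ψ.continuousAt_symm (ψ.map_source hq)
  have hKj : (K ∘ fun y => φ (ι (ψ.symm y))) =ᶠ[nhds (ψ q)] id := by
    have e1 : ∀ᶠ y in nhds (ψ q), ψ.symm y ∈ α.source :=
      hcont (by rw [hq']; exact α.open_source.mem_nhds hι.mem_domChart_source)
    have e2 : ∀ᶠ y in nhds (ψ q), ι (ψ.symm y) ∈ φ.source := by
      have : ContinuousAt (fun y => ι (ψ.symm y)) (ψ q) :=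
        ContinuousAt.comp (by rw [hq']; exact hι.continuousAt) hcont
      exact this (by simp only [hq']; exact φ.open_source.mem_nhds hιq)
    have e3 : ∀ᶠ y in nhds (ψ q), y ∈ ψ.target := ψ.open_target.mem_nhds (ψ.map_source hq)
    filter_upwards [e1, e2, e3] with y h1 h2 h3
    simp only [Function.comp_apply, K, id]
    rw [φ.left_inv h2, hval _ h1, α.left_inv h1, ψ.right_inv h3]
  have hKd' : DifferentiableAt ℝ K ((fun y => φ (ι (ψ.symm y))) (ψ q)) := by
    simp only [hq']; exact hKd
  have hcomp := fderiv_comp (ψ q) hKd' hj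
  rw [hKj.fderiv_eq, fderiv_id] at hcomp
  refine Function.LeftInverse.injective (g := fderiv ℝ K (φ (ι (ψ.symm (ψ q))))) fun v => ?_
  exact (DFunLike.congr_fun hcomp v).symm

end Immersion

end

end ConformalHypersurface

/-! ### The holographic formula on the manifold -/

theorem mainTheorem8 (d : ℕ) (hd : 3 ≤ d)
    {M : Type*} [TopologicalSpace M] [ChartedSpace (ConformalHypersurface.Coord d) M]
    [IsManifold (𝓡 d) ∞ M]
    {S : Type*} [TopologicalSpace S] [ChartedSpace (ConformalHypersurface.Coord (d - 1)) S]
    [IsManifold (𝓡 (d - 1)) ∞ S]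
    (c : Set (ConformalHypersurface.Metric (d := d) M))
    (hc : ConformalHypersurface.IsConformalStructure c)
    (ι : S → M) (hι : Manifold.IsSmoothEmbedding (𝓡 (d - 1)) (𝓡 d) ∞ ι)
    (σ : ConformalHypersurface.Metric (d := d) M → M → ℝ)
    (hσ : ConformalHypersurface.IsUnitDefiningDensity c (Set.range ι) σ)
    (b : ConformalHypersurface.Metric (d := d) M → Set.range ι → ℝ)
    (hb : ConformalHypersurface.IsObstructionDensity c (Set.range ι) σ b)
    (N : ConformalHypersurface.Metric (d := d) M → ConformalHypersurface.TripleField (d := d) M)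
    (hN : ConformalHypersurface.IsNormalTractorExtension c (Set.range ι) σ N) :
    ∀ g ∈ c,
      ∀ φ ∈ IsManifold.maximalAtlas (𝓡 d) ∞ M,
      ∀ ψ ∈ IsManifold.maximalAtlas (𝓡 (d - 1)) ∞ S,
      ∀ q ∈ ψ.source, ι q ∈ φ.source →
        b g ⟨ι q, Set.mem_range_self q⟩ =
          ConformalHypersurface.holographic (ConformalHypersurface.metricComps g φ)
            (fun x => σ g (φ.symm x)) ((N g).comps φ) (fun y => φ (ι (ψ.symm y))) (ψ q) := by
  intro g hg φ hφ ψ hψ q hq hιq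
  obtain ⟨B, ⟨hBd, hBI⟩, hbB⟩ := hb
  obtain ⟨⟨hσd, hσ0, -⟩, -⟩ := hσ
  set G := ConformalHypersurface.metricComps g φ
  set s : ConformalHypersurface.Coord d → ℝ := fun x => σ g (φ.symm x)
  set j : ConformalHypersurface.Coord (d - 1) → ConformalHypersurface.Coord d :=
    fun y => φ (ι (ψ.symm y))
  have hG : ConformalHypersurface.IsMetricOn G ⟨φ.target, φ.open_target⟩ :=
    ConformalHypersurface.isMetricOn_metricComps g hφ
  have hq' : ψ.symm (ψ q) = q := ψ.left_inv hq
  have hbr := fun (x : ConformalHypersurface.Coord d) (hx : x ∈ φ.target) (h0 : s x = 0) =>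
    ConformalHypersurface.bracket_eq hd hG
      (ConformalHypersurface.contDiffOn_comp_symm hφ (hσd.1 g hg))
      (ConformalHypersurface.contDiffOn_comp_symm hφ (hBd.1 g hg))
      (hN.1.1 g hg φ hφ) (fun x hx => hBI g hg φ hφ x hx)
      (fun x hx h0 => hN.2 g hg φ hφ x hx ((hσ0 g hg _).1 h0)) ⟨x, hx⟩ h0
  have hnear : ∀ᶠ y in nhds (ψ q), ι (ψ.symm y) ∈ φ.source := by
    have hc : ContinuousAt (fun y => ι (ψ.symm y)) (ψ q) :=
      hι.contMDiff.continuous.continuousAt.comp (ψ.continuousAt_symm (ψ.map_source hq))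
    exact hc (by simp only [hq']; exact φ.open_source.mem_nhds hιq)
  have hzero : ∀ y, ι (ψ.symm y) ∈ φ.source → s (j y) = 0 := fun y hy => by
    simp only [s, j, φ.left_inv hy]
    exact (hσ0 g hg _).2 (Set.mem_range_self _)
  obtain ⟨hjd, hinj⟩ := ConformalHypersurface.injective_fderiv_of_isImmersionAt hφ hψ
    (hι.isImmersion.isImmersionAt q) hq hιq
  have hpd : (ConformalHypersurface.inducedMetric G j (ψ q)).PosDef :=
    ConformalHypersurface.posDef_inducedMetric (hG.posDef _ (φ.map_source (by rw [hq']; exact hιq)))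
      hjd hinj
  -- The weight of the bracket is minus the dimension of the hypersurface, as `thomasDiv_canonical`
  -- requires.
  have hm : (1 - (d : ℝ)) = -((d - 1 : ℕ) : ℝ) := by
    rw [Nat.cast_sub (by omega)]
    push_cast
    ring
  have hfac : ((d - 1).factorial : ℝ) = ((d - 1 : ℕ) : ℝ) * ((d - 2).factorial : ℝ) := by
    rw [← Nat.mul_factorial_pred (by omega : d - 1 ≠ 0)]
    push_cast
    rfl
  rw [hbB g hg, ConformalHypersurface.holographic, hm, ConformalHypersurface.thomasDiv_canonical
    (f := fun y => (d.factorial : ℝ) * (d - 2).factorial / 2 * B g (φ.symm (j y)))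
    (hdet := (Matrix.isUnit_iff_isUnit_det _).1 hpd.isUnit)
    (hsymm := by simpa [Matrix.IsHermitian, Matrix.conjTranspose_eq_transpose_of_trivial]
      using hpd.isHermitian)
    -- The Thomas divergence differentiates, so the bracket has to be known at all nearby points of
    -- the hypersurface, not only at `q`.
    (hV := by
      filter_upwards [hnear] with y hy
      exact ConformalHypersurface.sigmaRestrict_canonical _ _ _ _ _ _
        (hbr _ (φ.map_source hy) (hzero y hy)))]
  have hBq : B g (φ.symm (j (ψ q))) = B g (ι q) := by
    simp only [j, hq', φ.left_inv hιq]
  have h1 : ((d - 1 : ℕ) : ℝ) ≠ 0 := Nat.cast_ne_zero.2 (by omega)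
  have h2 : ((d - 2).factorial : ℝ) ≠ 0 := Nat.cast_ne_zero.2 (Nat.factorial_ne_zero _)
  have h3 : (d.factorial : ℝ) ≠ 0 := Nat.cast_ne_zero.2 (Nat.factorial_ne_zero _)
  -- The constants cancel: `2 / (d! (d-1)!)` times `(d-1) d! (d-2)! / 2` is 1.
  rw [hBq, hfac]
  field_simp
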